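/- A directed graph $E=(E^0,E^1,r,s)$ consists of sets $E^0$ (vertices) and $E^1$ (edges) and maps $r,s:E^1\to E^0$; it is row-finite if $s^{-1}(v)$ is finite for every $v\in E^0$. A closed path based at $v$ is a path $e_1\cdots e_n$, $n\ge 1$, $r(e_i)=s(e_{i+1})$, with $s(e_1)=r(e_n)=v$; it is a closed simple path based at $v$ if $s(e_i)\neq v$ for $i>1$, and a cycle if the vertices $s(e_1),\dots,s(e_n)$ are distinct. An exit of a cycle $e_1\cdots e_n$ is an edge $f$ with $s(f)=s(e_i)$ and $f\neq e_i$ for some $i$. $E$ has Condition (L) if every cycle has an exit, and Condition (K) if no vertex is the base of exactly one closed simple path. For a row-finite graph $E$, the graded monoid $M_E^{\mathrm{gr}}$ is the commutative monoid generated by the symbols $v(i)$, $v\in E^0$, $i\in\mathbb Z$, subject to $v(i)=\sum_{e\in s^{-1}(v)} r(e)(i+1)$ for every $v\in E^0$ that is not a sink and every $i\in\mathbb Z$. The group $\mathbb Z$ acts on it by ${}^n v(i)=v(i+n)$. A $\mathbb Z$-module isomorphism is a monoid isomorphism commuting with the action. An element $a\neq 0$ is minimal if $a=b+c$ with $b\ne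 0$ implies $b=a$; an element $a$ is periodic if ${}^n a=a$ for some $n\neq 0$; $O(a)=\{{}^n a\mid n\in\mathbb Z\}$. For a field $F$, the Leavitt path algebra $L_F(E)$ of a row-finite graph $E$ is the (not necessarily unital) associative $F$-algebra generated by $\{v, e, e^*\mid v\in E^0, e\in E^1\}$ subject to $vw=\delta_{v,w}v$; $s(e)e=e=e\,r(e)$; $r(e)e^*=e^*=e^*s(e)$; $e^*f=\delta_{e,f}r(e)$; and $v=\sum_{e\in s^{-1}(v)}ee^*$ for every $v$ that is not a sink. It is $\mathbb Z$-graded with $\deg v=0$, $\deg e=1$, $\deg e^*=-1$. A (two-sided) ideal $I$ is graded if $I=\sum_n (I\cap L_F(E)_n)$, and non-graded otherwise. **Theorem.** Let $F$ be a field and let $E_1$ and $E_2$ be row-finite graphs. Suppose there is a $\mathbb Z$-module isomorphism $\phi: M^{\mathrm{gr}}_{E_1}\to M^{\mathrm{gr}}_{E_2}$. Then: 1. $E_1$ has Condition (L) if and only if $E_2$ has Condition (L). 2. $E_1$ has Condition (K) if and only if $E_2$ has Condition (K). 3. There is an inclusion-preserving one-to-one correspondence (a lattice isomorphism) between the graded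 ideals of $L_F(E_1)$ and the graded ideals of $L_F(E_2)$. 4. There is a one-to-one correspondence between the non-graded ideals of $L_F(E_1)$ and the non-graded ideals of $L_F(E_2)$. 5. There is a one-to-one correspondence between the isomorphism classes of minimal left ideals of $L_F(E_1)$ and of $L_F(E_2)$, and likewise one between the isomorphism classes of minimal right ideals. Moreover, for $E=E_1$ and for $E=E_2$, sending a cycle $c$ without exits to $O(v(0))$, where $v$ is any vertex on $c$, is a well-defined bijection from the set of cycles without exits of $E$ (considered up to the choice of the base point) onto the set of orbits of minimal periodic elements of $M_E^{\mathrm{gr}}$, and the length of $c$ equals the number of elements of the corresponding orbit. -/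

import Mathlib

universe u v u' v' w

/-- A directed graph `(E⁰, E¹, r, s)`: a set of vertices, a set of edges, and range and source
maps. Loops, parallel edges and infinite sets are allowed. -/
structure DirectedGraph where
  Vertex : Type u
  Edge : Type v
  s : Edge → Vertex
  r : Edge → Vertex

namespace DirectedGraph

/-! ### Graphs: row-finiteness, paths, cycles, Conditions (L) and (K) -/

/-- A graph is row-finite if every vertex emits only finitely many edges. -/
class RowFinite (E : DirectedGraph.{u, v}) : Prop where
  finite_out : ∀ x : E.Vertex, {e : E.Edge | E.s e = x}.Finite

/-- The finite set `s⁻¹(x)` of edges emitted by the vertex `x` of a row-finite graph. -/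
noncomputable def out (E : DirectedGraph.{u, v}) [E.RowFinite] (x : E.Vertex) : Finset E.Edge :=
  (RowFinite.finite_out x).toFinset

theorem mem_out (E : DirectedGraph.{u, v}) [E.RowFinite] (x : E.Vertex) (e : E.Edge) :
    e ∈ E.out x ↔ E.s e = x := by
  simp [out]

/-- `E.IsPath x p y`: the list of edges `p` is a path from `x` to `y`; the empty list is the
trivial path at a vertex. -/
def IsPath (E : DirectedGraph.{u, v}) : E.Vertex → List E.Edge → E.Vertex → Prop
  | x, [], y => x = y
  | x, e :: p, y => E.s e = x ∧ E.IsPath (E.r e) p y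

/-- A closed path of positive length based at `x`. -/
def IsClosedPath (E : DirectedGraph.{u, v}) (x : E.Vertex) (p : List E.Edge) : Prop :=
  p ≠ [] ∧ E.IsPath x p x

/-- A closed simple path based at `x`: a closed path that does not pass through `x` in between. -/
def IsClosedSimplePath (E : DirectedGraph.{u, v}) (x : E.Vertex) (p : List E.Edge) : Prop :=
  E.IsClosedPath x p ∧ ∀ e ∈ p.tail, E.s e ≠ x

/-- A cycle, with a base point: a closed path that passes through no vertex twice. -/
def IsCycle (E : DirectedGraph.{u, v}) (p : List E.Edge) : Prop :=
  (∃ x, E.IsClosedPath x p) ∧ (p.map E.s).Nodup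

/-- A path has an exit if some edge starts at the source of one of the edges of the path and is
different from that edge. -/
def HasExit (E : DirectedGraph.{u, v}) (p : List E.Edge) : Prop :=
  ∃ e ∈ p, ∃ f : E.Edge, E.s f = E.s e ∧ f ≠ e

/-- Condition (L): every cycle has an exit. -/
def ConditionL (E : DirectedGraph.{u, v}) : Prop :=
  ∀ p : List E.Edge, E.IsCycle p → E.HasExit p

/-- Condition (K): no vertex is the base of exactly one closed simple path. -/
def ConditionK (E : DirectedGraph.{u, v}) : Prop :=
  ∀ (x : E.Vertex) (p : List E.Edge), E.IsClosedSimplePath x p →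
    ∃ q : List E.Edge, E.IsClosedSimplePath x q ∧ q ≠ p

/-- The set of cycles without exits of `E`. A cycle is considered up to the choice of its base
point, so its sequence of edges is an element of Mathlib's `Cycle` (lists modulo rotation). -/
def exitlessCycles (E : DirectedGraph.{u, v}) : Set (Cycle E.Edge) :=
  {c | ∃ p : List E.Edge, (p : Cycle E.Edge) = c ∧ E.IsCycle p ∧ ¬ E.HasExit p}

/-! ### The graded (talented) monoid -/

section GradedMonoid

variable (E : DirectedGraph.{u, v}) [E.RowFinite]

/-- The defining relations `x(i) = ∑_{s(e) = x} r(e)(i + 1)`, where `x` is not a sink, on the free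
commutative monoid on the symbols `x(i) = (x, i)`. -/
inductive GradedMonoidRel : Multiset (E.Vertex × ℤ) → Multiset (E.Vertex × ℤ) → Prop
  | rel (x : E.Vertex) (i : ℤ) (hx : ∃ e, E.s e = x) :
      GradedMonoidRel {(x, i)} ((E.out x).val.map fun e => (E.r e, i + 1))

/-- The graded monoid `M_E^gr`. -/
def GradedMonoid : Type u := (addConGen E.GradedMonoidRel).Quotient

noncomputable instance : AddCommMonoid E.GradedMonoid :=
  inferInstanceAs (AddCommMonoid (addConGen E.GradedMonoidRel).Quotient)

/-- The quotient map from the free commutative monoid. -/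
noncomputable def GradedMonoid.mk : Multiset (E.Vertex × ℤ) →+ E.GradedMonoid :=
  AddCon.mk' (addConGen E.GradedMonoidRel)

/-- The element `x(i)` of `M_E^gr`. -/
noncomputable def GradedMonoid.of (x : E.Vertex) (i : ℤ) : E.GradedMonoid :=
  GradedMonoid.mk E {(x, i)}

theorem GradedMonoid.mk_surjective : Function.Surjective (GradedMonoid.mk E) :=
  AddCon.mk'_surjective

theorem GradedMonoid.mk_rel {a b : Multiset (E.Vertex × ℤ)} (h : E.GradedMonoidRel a b) :
    GradedMonoid.mk E a = GradedMonoid.mk E b :=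
  (AddCon.eq _).2 (AddConGen.Rel.of _ _ h)

/-- The shift by `n`, on the free commutative monoid: `x(i) ↦ x(i + n)`. -/
def freeShift (n : ℤ) : Multiset (E.Vertex × ℤ) →+ Multiset (E.Vertex × ℤ) :=
  Multiset.mapAddMonoidHom fun y => (y.1, y.2 + n)

/-- The shift by `n` on `M_E^gr`, the endomorphism with `x(i) ↦ x(i + n)`. -/
noncomputable def GradedMonoid.shift (n : ℤ) : E.GradedMonoid →+ E.GradedMonoid :=
  AddCon.lift (addConGen E.GradedMonoidRel) ((GradedMonoid.mk E).comp (E.freeShift n)) <|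
    AddCon.addConGen_le.2 fun a b h => by
      obtain ⟨x, i, hx⟩ := h
      have h' := GradedMonoid.mk_rel E (GradedMonoidRel.rel x (i + n) hx)
      simpa [freeShift, AddCon.ker_rel, Multiset.map_map, Function.comp_def,
        add_right_comm] using h'

theorem GradedMonoid.shift_mk (n : ℤ) (a : Multiset (E.Vertex × ℤ)) :
    GradedMonoid.shift E n (GradedMonoid.mk E a) = GradedMonoid.mk E (E.freeShift n a) := rfl

/-- The action of `ℤ` on `M_E^gr`: `n +ᵥ x(i) = x(i + n)`. -/
noncomputable instance : AddAction ℤ E.GradedMonoid where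
  vadd n a := GradedMonoid.shift E n a
  zero_vadd a := by
    obtain ⟨a, rfl⟩ := GradedMonoid.mk_surjective E a
    change GradedMonoid.shift E 0 _ = _
    rw [GradedMonoid.shift_mk]
    simp [freeShift]
  add_vadd m n a := by
    obtain ⟨a, rfl⟩ := GradedMonoid.mk_surjective E a
    change GradedMonoid.shift E (m + n) _ = GradedMonoid.shift E m (GradedMonoid.shift E n _)
    simp only [GradedMonoid.shift_mk]
    congr 1
    simp [freeShift, Multiset.map_map, add_assoc, add_comm n m]

/-- A (nonzero) element `a` of a commutative monoid is minimal if the only nonzero `b` with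
`b ≤ a`, that is with `a = b + c` for some `c`, is `b = a`. -/
def IsMinimalElement {M : Type w} [AddCommMonoid M] (a : M) : Prop :=
  a ≠ 0 ∧ ∀ b c : M, b ≠ 0 → a = b + c → b = a

/-- An element of a set with an action of `ℤ` is periodic if it is fixed by a nonzero integer. -/
def IsPeriodicElement {M : Type w} [AddAction ℤ M] (a : M) : Prop :=
  ∃ n : ℤ, n ≠ 0 ∧ n +ᵥ a = a

/-- The set of orbits of minimal periodic elements of `M_E^gr`. -/
def minimalPeriodicOrbits : Set (Set E.GradedMonoid) :=
  {O | ∃ a : E.GradedMonoid, IsMinimalElement a ∧ IsPeriodicElement a ∧ O = AddAction.orbit ℤ a}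

end GradedMonoid

/-! ### Leavitt path algebras -/

section Leavitt

/-- The generators of the Leavitt path algebra: vertices `x`, edges `e` and ghost edges `e*`. -/
inductive LeavittGen (E : DirectedGraph.{u, v}) : Type (max u v)
  | vertex (x : E.Vertex)
  | edge (e : E.Edge)
  | ghost (e : E.Edge)

variable (F : Type w) [Field F] (E : DirectedGraph.{u, v})

/-- The free associative (non-unital) `F`-algebra on the generators: its basis consists of the
nonempty words in the generators. -/
abbrev FreeLeavitt : Type _ := MonoidAlgebra F (FreeSemigroup E.LeavittGen)

/-- A generator as an element of the free algebra. -/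
noncomputable def freeGen (g : E.LeavittGen) : FreeLeavitt F E :=
  MonoidAlgebra.single (FreeSemigroup.of g) 1

variable [E.RowFinite]

open LeavittGen in
/-- The defining relations of the Leavitt path algebra, closed under scalar multiples. -/
inductive LeavittRel : FreeLeavitt F E → FreeLeavitt F E → Prop
  | vertex_mul_self (x : E.Vertex) :
      LeavittRel (freeGen F E (vertex x) * freeGen F E (vertex x)) (freeGen F E (vertex x))
  | vertex_mul_of_ne (x y : E.Vertex) (h : x ≠ y) :
      LeavittRel (freeGen F E (vertex x) * freeGen F E (vertex y)) 0
  | source_mul_edge (e : E.Edge) :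
      LeavittRel (freeGen F E (vertex (E.s e)) * freeGen F E (edge e)) (freeGen F E (edge e))
  | edge_mul_range (e : E.Edge) :
      LeavittRel (freeGen F E (edge e) * freeGen F E (vertex (E.r e))) (freeGen F E (edge e))
  | range_mul_ghost (e : E.Edge) :
      LeavittRel (freeGen F E (vertex (E.r e)) * freeGen F E (ghost e)) (freeGen F E (ghost e))
  | ghost_mul_source (e : E.Edge) :
      LeavittRel (freeGen F E (ghost e) * freeGen F E (vertex (E.s e))) (freeGen F E (ghost e))
  | ghost_mul_edge_self (e : E.Edge) :
      LeavittRel (freeGen F E (ghost e) * freeGen F E (edge e)) (freeGen F E (vertex (E.r e)))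
  | ghost_mul_edge_of_ne (e f : E.Edge) (h : e ≠ f) :
      LeavittRel (freeGen F E (ghost e) * freeGen F E (edge f)) 0
  | sum_edge_mul_ghost (x : E.Vertex) (hx : ∃ e, E.s e = x) :
      LeavittRel (∑ e ∈ E.out x, freeGen F E (edge e) * freeGen F E (ghost e))
        (freeGen F E (vertex x))
  | smul (c : F) (a b : FreeLeavitt F E) : LeavittRel a b → LeavittRel (c • a) (c • b)

/-- The Leavitt path algebra `L_F(E)`: the (in general non-unital) associative `F`-algebra
presented by the above generators and relations. -/
def LeavittPathAlgebra : Type _ := (ringConGen (LeavittRel F E)).Quotient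

noncomputable instance : NonUnitalRing (LeavittPathAlgebra F E) :=
  inferInstanceAs (NonUnitalRing (ringConGen (LeavittRel F E)).Quotient)

namespace LeavittPathAlgebra

/-- The quotient map from the free algebra. -/
noncomputable def mk (a : FreeLeavitt F E) : LeavittPathAlgebra F E :=
  (a : (ringConGen (LeavittRel F E)).Quotient)

theorem mk_surjective : Function.Surjective (mk F E) := Quotient.mk_surjective

theorem mk_add (a b : FreeLeavitt F E) : mk F E (a + b) = mk F E a + mk F E b := rfl

theorem mk_mul (a b : FreeLeavitt F E) : mk F E (a * b) = mk F E a * mk F E b := rfl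

theorem mk_zero : mk F E 0 = 0 := rfl

theorem con_smul (c : F) {a b : FreeLeavitt F E} (h : ringConGen (LeavittRel F E) a b) :
    ringConGen (LeavittRel F E) (c • a) (c • b) := by
  change RingConGen.Rel _ a b at h
  change RingConGen.Rel _ (c • a) (c • b)
  induction h with
  | of a b h => exact .of _ _ (.smul c a b h)
  | refl a => exact .refl _
  | symm _ ih => exact ih.symm
  | trans _ _ ih₁ ih₂ => exact ih₁.trans ih₂
  | add _ _ ih₁ ih₂ => simpa only [smul_add] using ih₁.add ih₂
  | mul _ h₂ ih₁ _ => simpa only [smul_mul_assoc] using ih₁.mul h₂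

noncomputable instance : SMul F (LeavittPathAlgebra F E) where
  smul c := Quotient.map (c • ·) fun _ _ h => con_smul F E c h

theorem mk_smul (c : F) (a : FreeLeavitt F E) : mk F E (c • a) = c • mk F E a := rfl

noncomputable instance : Module F (LeavittPathAlgebra F E) :=
  Function.Surjective.module F
    (⟨⟨mk F E, mk_zero F E⟩, mk_add F E⟩ : FreeLeavitt F E →+ LeavittPathAlgebra F E)
    (mk_surjective F E) (mk_smul F E)

instance : IsScalarTower F (LeavittPathAlgebra F E) (LeavittPathAlgebra F E) where
  smul_assoc c a b := by
    obtain ⟨a, rfl⟩ := mk_surjective F E a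
    obtain ⟨b, rfl⟩ := mk_surjective F E b
    simp only [smul_eq_mul, ← mk_smul, ← mk_mul, smul_mul_assoc]

instance : SMulCommClass F (LeavittPathAlgebra F E) (LeavittPathAlgebra F E) where
  smul_comm c a b := by
    obtain ⟨a, rfl⟩ := mk_surjective F E a
    obtain ⟨b, rfl⟩ := mk_surjective F E b
    simp only [smul_eq_mul, ← mk_smul, ← mk_mul, mul_smul_comm]

end LeavittPathAlgebra

/-- The degree of a generator: `0` for vertices, `1` for edges, `-1` for ghost edges. -/
def LeavittGen.degree {E : DirectedGraph.{u, v}} : E.LeavittGen → ℤ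
  | .vertex _ => 0
  | .edge _ => 1
  | .ghost _ => -1

/-- The degree of a word in the generators: the sum of the degrees of its letters. -/
def wordDegree (x : FreeSemigroup E.LeavittGen) : ℤ :=
  x.head.degree + (x.tail.map LeavittGen.degree).sum

namespace LeavittPathAlgebra

/-- The homogeneous component of degree `n` in the canonical `ℤ`-grading: the span of the words
of degree `n`. -/
noncomputable def homogeneousComponent (n : ℤ) : Submodule F (LeavittPathAlgebra F E) :=
  Submodule.span F
    {a | ∃ x : FreeSemigroup E.LeavittGen, wordDegree E x = n ∧
      a = mk F E (MonoidAlgebra.single x 1)}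

variable {F E}

/-- A two-sided ideal `I` is graded if `I = ∑ₙ I ∩ L_F(E)ₙ`, that is, each of its elements is a
finite sum of homogeneous elements of `I`. -/
def IsGraded (I : TwoSidedIdeal (LeavittPathAlgebra F E)) : Prop :=
  ∀ a ∈ I, ∃ f : ℤ →₀ LeavittPathAlgebra F E,
    (∀ n, f n ∈ I ∧ f n ∈ homogeneousComponent F E n) ∧ f.sum (fun _ b => b) = a

end LeavittPathAlgebra

end Leavitt

end DirectedGraph

/-! ### One-sided ideals of rings without unit -/

section OneSided

variable (A : Type w) [NonUnitalRing A]

/-- The left ideals of a ring, possibly without unit. -/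
def NonUnitalLeftIdeal : Type w :=
  {I : AddSubgroup A // ∀ a x : A, x ∈ I → a * x ∈ I}

/-- The right ideals of a ring, possibly without unit. -/
def NonUnitalRightIdeal : Type w :=
  {I : AddSubgroup A // ∀ a x : A, x ∈ I → x * a ∈ I}

/-- The minimal left ideals: nonzero, and containing no nonzero left ideal but themselves. -/
def MinimalLeftIdeal : Type w :=
  {I : NonUnitalLeftIdeal A // I.1 ≠ ⊥ ∧
    ∀ J : NonUnitalLeftIdeal A, J.1 ≤ I.1 → J.1 ≠ ⊥ → J.1 = I.1}

/-- The minimal right ideals: nonzero, and containing no nonzero right ideal but themselves. -/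
def MinimalRightIdeal : Type w :=
  {I : NonUnitalRightIdeal A // I.1 ≠ ⊥ ∧
    ∀ J : NonUnitalRightIdeal A, J.1 ≤ I.1 → J.1 ≠ ⊥ → J.1 = I.1}

/-- Isomorphism of minimal left ideals as left modules. -/
def minimalLeftIdealSetoid : Setoid (MinimalLeftIdeal A) where
  r I J := ∃ f : I.1.1 ≃+ J.1.1, ∀ (a : A) (x : I.1.1),
    f ⟨a * x, I.1.2 a x x.2⟩ = ⟨a * f x, J.1.2 a (f x) (f x).2⟩
  iseqv :=
    { refl := fun _ => ⟨AddEquiv.refl _, fun _ _ => rfl⟩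
      symm := fun ⟨f, hf⟩ => ⟨f.symm, fun a x => by
        rw [AddEquiv.symm_apply_eq, hf]
        simp⟩
      trans := fun ⟨f, hf⟩ ⟨g, hg⟩ => ⟨f.trans g, fun a x => by
        simp only [AddEquiv.trans_apply, hf, hg]⟩ }

/-- Isomorphism of minimal right ideals as right modules. -/
def minimalRightIdealSetoid : Setoid (MinimalRightIdeal A) where
  r I J := ∃ f : I.1.1 ≃+ J.1.1, ∀ (a : A) (x : I.1.1),
    f ⟨x * a, I.1.2 a x x.2⟩ = ⟨f x * a, J.1.2 a (f x) (f x).2⟩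
  iseqv :=
    { refl := fun _ => ⟨AddEquiv.refl _, fun _ _ => rfl⟩
      symm := fun ⟨f, hf⟩ => ⟨f.symm, fun a x => by
        rw [AddEquiv.symm_apply_eq, hf]
        simp⟩
      trans := fun ⟨f, hf⟩ ⟨g, hg⟩ => ⟨f.trans g, fun a x => by
        simp only [AddEquiv.trans_apply, hf, hg]⟩ }

/-- The isomorphism classes of minimal left ideals. -/
def MinimalLeftIdealClasses : Type w := Quotient (minimalLeftIdealSetoid A)

/-- The isomorphism classes of minimal right ideals. -/
def MinimalRightIdealClasses : Type w := Quotient (minimalRightIdealSetoid A)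

end OneSided

/-! Every item in the conclusion is governed by hereditary saturated sets, by cycles without exits
in quotient graphs, or by line points. The monoid with its `ℤ`-action recovers all three.

On the monoid side, the submonoids closed under summands and shifts correspond to the hereditary
saturated sets `H` (`invariantIdealOrderIso`), and the monoid of the quotient graph is the quotient
by the order ideal of `H` (`toQuot_eq_iff`). An equivariant isomorphism therefore matches the sets
`H` on both sides and induces equivariant isomorphisms between the monoids of the quotient graphs
(`exists_quot_addEquiv`). Equal elements agree after expanding far enough along the edges
(`exists_expand_eq`). Counting terms of expansions shows that the minimal elements are exactly the
`x(i)` for which no vertex reachable from `x` emits two edges, and that such an element is periodic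
exactly when `x` leads to a cycle. Hence the orbits of minimal periodic elements are the cycles
without exits (`cycleOrbit_bijective`), while the other minimal orbits are the line points up to
having a common descendant. Condition (L) says that there are no cycles without exits, and Condition
(K) is Condition (L) for all quotient graphs (`conditionK_iff`).

On the algebra side, an ideal is determined by the set `H` of its vertices and, for each cycle `c`
without exits of the quotient graph, the polynomials `f` with `f(c)` in the ideal. All such data
occur (`cycleIdeals_bijective`). Uniqueness is the reduction theorem `exists_mul_mul_path`;
existence comes from weighted representations on boundary paths (`exists_ideal_of_satIdeal`). An
ideal is graded exactly when all its polynomials are zero, so the graded ideals form the lattice of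
the sets `H`, and the non-graded ideals are the data with some nonzero polynomial ideal.

By the reduction theorem again, each minimal left ideal is isomorphic to the left multiples of a
line point; a cycle cannot occur because `c - 1` has no inverse. Two line points give isomorphic
ideals exactly when they have a common descendant. The involution `adj` turns right ideals into left
ones. -/

namespace DirectedGraph

namespace LeavittPathAlgebra

/-! ### Leavitt path algebras: generators and relations -/

section Basic

variable (F : Type w) [Field F] (E : DirectedGraph.{u, v}) [E.RowFinite]

/-- The image of a vertex in the Leavitt path algebra. -/
noncomputable def vtx (x : E.Vertex) : E.LeavittPathAlgebra F := mk F E (freeGen F E (.vertex x))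

/-- The image of an edge in the Leavitt path algebra. -/
noncomputable def edg (e : E.Edge) : E.LeavittPathAlgebra F := mk F E (freeGen F E (.edge e))

/-- The image of a ghost edge in the Leavitt path algebra. -/
noncomputable def gho (e : E.Edge) : E.LeavittPathAlgebra F := mk F E (freeGen F E (.ghost e))

variable {F E}

theorem mk_eq_of_rel {a b : FreeLeavitt F E} (h : LeavittRel F E a b) : mk F E a = mk F E b :=
  (RingCon.eq _).2 (RingConGen.Rel.of _ _ h)

theorem mk_sum {ι : Type*} (s : Finset ι) (f : ι → FreeLeavitt F E) :
    mk F E (∑ i ∈ s, f i) = ∑ i ∈ s, mk F E (f i) :=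
  map_sum (⟨⟨mk F E, mk_zero F E⟩, mk_add F E⟩ : FreeLeavitt F E →+ LeavittPathAlgebra F E) f s

theorem vtx_mul_self (x : E.Vertex) : vtx F E x * vtx F E x = vtx F E x :=
  mk_eq_of_rel (.vertex_mul_self x)

theorem vtx_mul_of_ne {x y : E.Vertex} (h : x ≠ y) : vtx F E x * vtx F E y = 0 :=
  mk_eq_of_rel (.vertex_mul_of_ne x y h)

theorem vtx_mul_edg (e : E.Edge) : vtx F E (E.s e) * edg F E e = edg F E e :=
  mk_eq_of_rel (.source_mul_edge e)

theorem edg_mul_vtx (e : E.Edge) : edg F E e * vtx F E (E.r e) = edg F E e :=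
  mk_eq_of_rel (.edge_mul_range e)

theorem vtx_mul_gho (e : E.Edge) : vtx F E (E.r e) * gho F E e = gho F E e :=
  mk_eq_of_rel (.range_mul_ghost e)

theorem gho_mul_vtx (e : E.Edge) : gho F E e * vtx F E (E.s e) = gho F E e :=
  mk_eq_of_rel (.ghost_mul_source e)

theorem gho_mul_edg (e : E.Edge) : gho F E e * edg F E e = vtx F E (E.r e) :=
  mk_eq_of_rel (.ghost_mul_edge_self e)

theorem gho_mul_edg_of_ne {e f : E.Edge} (h : e ≠ f) : gho F E e * edg F E f = 0 :=
  mk_eq_of_rel (.ghost_mul_edge_of_ne e f h)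

theorem sum_edg_mul_gho {x : E.Vertex} (hx : ∃ e, E.s e = x) :
    ∑ e ∈ E.out x, edg F E e * gho F E e = vtx F E x := by
  rw [vtx, ← mk_eq_of_rel (.sum_edge_mul_ghost x hx), mk_sum]
  rfl

theorem edg_mul_vtx_of_ne {x : E.Vertex} {e : E.Edge} (h : E.r e ≠ x) :
    edg F E e * vtx F E x = 0 := by
  rw [← edg_mul_vtx, mul_assoc, vtx_mul_of_ne h, mul_zero]

theorem gho_mul_vtx_of_ne {x : E.Vertex} {e : E.Edge} (h : E.s e ≠ x) :
    gho F E e * vtx F E x = 0 := by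
  rw [← gho_mul_vtx, mul_assoc, vtx_mul_of_ne h, mul_zero]

variable (F E) in
/-- The image of a generator. -/
noncomputable def gen : E.LeavittGen → E.LeavittPathAlgebra F
  | .vertex x => vtx F E x
  | .edge e => edg F E e
  | .ghost e => gho F E e

theorem mk_freeGen (g : E.LeavittGen) : mk F E (freeGen F E g) = gen F E g := by
  cases g <;> rfl

theorem mk_single_of_mul (g : E.LeavittGen) (x : FreeSemigroup E.LeavittGen) :
    mk F E (MonoidAlgebra.single (FreeSemigroup.of g * x) 1) =
      gen F E g * mk F E (MonoidAlgebra.single x 1) := by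
  rw [← mk_freeGen, ← mk_mul, freeGen, MonoidAlgebra.single_mul_single, one_mul]

theorem span_words_induction {P : E.LeavittPathAlgebra F → Prop} (h0 : P 0)
    (hadd : ∀ a b, P a → P b → P (a + b)) (hsmul : ∀ (c : F) a, P a → P (c • a))
    (hword : ∀ x : FreeSemigroup E.LeavittGen, P (mk F E (MonoidAlgebra.single x 1)))
    (a : E.LeavittPathAlgebra F) : P a := by
  obtain ⟨a, rfl⟩ := mk_surjective F E a
  induction a using MonoidAlgebra.induction_linear with
  | zero => exact h0
  | add a b ha hb => exact hadd _ _ ha hb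
  | single x c =>
    have : (MonoidAlgebra.single x c : FreeLeavitt F E) = c • MonoidAlgebra.single x 1 := by
      simp
    rw [this, mk_smul]
    exact hsmul _ _ (hword x)

/-- Induction on elements, multiplying by generators from the left. -/
theorem induction {P : E.LeavittPathAlgebra F → Prop} (h0 : P 0)
    (hadd : ∀ a b, P a → P b → P (a + b)) (hsmul : ∀ (c : F) a, P a → P (c • a))
    (hgen : ∀ g, P (gen F E g)) (hmul : ∀ g a, P a → P (gen F E g * a))
    (a : E.LeavittPathAlgebra F) : P a := by
  refine span_words_induction h0 hadd hsmul (fun x => ?_) a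
  induction x using FreeSemigroup.recOnMul with
  | ih1 g => exact mk_freeGen (F := F) g ▸ hgen g
  | ih2 g x _ ih => rw [mk_single_of_mul]; exact hmul g _ ih

/-! #### The universal property -/

variable (E) in
/-- A family of elements satisfying the relations of the Leavitt path algebra. -/
structure LeavittFamily (R : Type*) [NonUnitalRing R] where
  vtx : E.Vertex → R
  edg : E.Edge → R
  gho : E.Edge → R
  vtx_mul_self : ∀ x, vtx x * vtx x = vtx x
  vtx_mul_of_ne : ∀ x y, x ≠ y → vtx x * vtx y = 0
  vtx_mul_edg : ∀ e, vtx (E.s e) * edg e = edg e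
  edg_mul_vtx : ∀ e, edg e * vtx (E.r e) = edg e
  vtx_mul_gho : ∀ e, vtx (E.r e) * gho e = gho e
  gho_mul_vtx : ∀ e, gho e * vtx (E.s e) = gho e
  gho_mul_edg : ∀ e, gho e * edg e = vtx (E.r e)
  gho_mul_edg_of_ne : ∀ e f, e ≠ f → gho e * edg f = 0
  sum_edg_mul_gho : ∀ x, (∃ e, E.s e = x) → ∑ e ∈ E.out x, edg e * gho e = vtx x

section Lift

variable {R : Type*} [NonUnitalRing R] [Module F R] [IsScalarTower F R R] [SMulCommClass F R R]

/-- The value of a Leavitt family on a generator. -/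
def LeavittFamily.gen (f : LeavittFamily E R) : E.LeavittGen → R
  | .vertex x => f.vtx x
  | .edge e => f.edg e
  | .ghost e => f.gho e

/-- The map from the free algebra given by a Leavitt family. -/
noncomputable def LeavittFamily.freeLift (f : LeavittFamily E R) : FreeLeavitt F E →ₙₐ[F] R :=
  MonoidAlgebra.liftMagma F (FreeSemigroup.lift f.gen)

theorem LeavittFamily.freeLift_freeGen (f : LeavittFamily E R) (g : E.LeavittGen) :
    f.freeLift (freeGen F E g) = f.gen g := by
  simp [freeLift, freeGen]

theorem LeavittFamily.freeLift_rel (f : LeavittFamily E R) {a b : FreeLeavitt F E}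
    (h : LeavittRel F E a b) : f.freeLift a = f.freeLift b := by
  induction h with
  | smul c a b _ ih => rw [map_smul, map_smul, ih]
  | vertex_mul_self x => simpa [freeLift_freeGen, LeavittFamily.gen] using f.vtx_mul_self x
  | vertex_mul_of_ne x y h => simpa [freeLift_freeGen, LeavittFamily.gen] using f.vtx_mul_of_ne x y h
  | source_mul_edge e => simpa [freeLift_freeGen, LeavittFamily.gen] using f.vtx_mul_edg e
  | edge_mul_range e => simpa [freeLift_freeGen, LeavittFamily.gen] using f.edg_mul_vtx e
  | range_mul_ghost e => simpa [freeLift_freeGen, LeavittFamily.gen] using f.vtx_mul_gho e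
  | ghost_mul_source e => simpa [freeLift_freeGen, LeavittFamily.gen] using f.gho_mul_vtx e
  | ghost_mul_edge_self e => simpa [freeLift_freeGen, LeavittFamily.gen] using f.gho_mul_edg e
  | ghost_mul_edge_of_ne e e' h => simpa [freeLift_freeGen, LeavittFamily.gen] using f.gho_mul_edg_of_ne e e' h
  | sum_edge_mul_ghost x hx => simpa [freeLift_freeGen, LeavittFamily.gen] using f.sum_edg_mul_gho x hx

variable (F) in
/-- The algebra homomorphism given by a Leavitt family. -/
noncomputable def LeavittFamily.lift (f : LeavittFamily E R) :
    E.LeavittPathAlgebra F →ₙₐ[F] R where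
  toFun := Quotient.lift (fun a => f.freeLift a) fun a b h => by
    change RingConGen.Rel _ a b at h
    induction h with
    | of a b h => exact f.freeLift_rel h
    | refl a => rfl
    | symm _ ih => exact ih.symm
    | trans _ _ ih₁ ih₂ => exact ih₁.trans ih₂
    | add _ _ ih₁ ih₂ => simpa only [map_add] using congr_arg₂ (· + ·) ih₁ ih₂
    | mul _ _ ih₁ ih₂ => simpa only [map_mul] using congr_arg₂ (· * ·) ih₁ ih₂
  map_smul' c a := by
    obtain ⟨a, rfl⟩ := mk_surjective F E a
    exact map_smul f.freeLift c a
  map_zero' := map_zero f.freeLift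
  map_add' a b := by
    obtain ⟨a, rfl⟩ := mk_surjective F E a
    obtain ⟨b, rfl⟩ := mk_surjective F E b
    exact map_add f.freeLift a b
  map_mul' a b := by
    obtain ⟨a, rfl⟩ := mk_surjective F E a
    obtain ⟨b, rfl⟩ := mk_surjective F E b
    exact map_mul f.freeLift a b

@[simp] theorem LeavittFamily.lift_vtx (f : LeavittFamily E R) (x : E.Vertex) :
    f.lift F (LeavittPathAlgebra.vtx F E x) = f.vtx x := f.freeLift_freeGen _

@[simp] theorem LeavittFamily.lift_edg (f : LeavittFamily E R) (e : E.Edge) :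
    f.lift F (LeavittPathAlgebra.edg F E e) = f.edg e := f.freeLift_freeGen _

@[simp] theorem LeavittFamily.lift_gho (f : LeavittFamily E R) (e : E.Edge) :
    f.lift F (LeavittPathAlgebra.gho F E e) = f.gho e := f.freeLift_freeGen _

end Lift

/-! #### Local units and ideals -/

theorem exists_vtx_mul_gen (g : E.LeavittGen) : ∃ x, vtx F E x * gen F E g = gen F E g := by
  cases g with
  | vertex x => exact ⟨x, vtx_mul_self x⟩
  | edge e => exact ⟨_, vtx_mul_edg e⟩
  | ghost e => exact ⟨_, vtx_mul_gho e⟩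

open Classical in
theorem sum_vtx_mul_vtx {S : Finset E.Vertex} {x : E.Vertex} (hx : x ∈ S) :
    (∑ y ∈ S, vtx F E y) * vtx F E x = vtx F E x := by
  rw [Finset.sum_mul, Finset.sum_eq_single_of_mem x hx, vtx_mul_self]
  exact fun y _ h => vtx_mul_of_ne h

open Classical in
-- Asking for every larger set `T` as well is what lets the units of two summands be merged into
-- one.
theorem exists_left_unit_superset (a : E.LeavittPathAlgebra F) :
    ∃ S : Finset E.Vertex, ∀ T, S ⊆ T → (∑ x ∈ T, vtx F E x) * a = a := by
  induction a using induction with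
  | h0 => exact ⟨∅, by simp⟩
  | hadd a b ha hb =>
    obtain ⟨S, hS⟩ := ha
    obtain ⟨T, hT⟩ := hb
    refine ⟨S ∪ T, fun U hU => ?_⟩
    rw [mul_add, hS U (Finset.union_subset_left hU), hT U (Finset.union_subset_right hU)]
  | hsmul c a ha =>
    obtain ⟨S, hS⟩ := ha
    exact ⟨S, fun T hT => by rw [mul_smul_comm, hS T hT]⟩
  | hgen g =>
    obtain ⟨x, hx⟩ := exists_vtx_mul_gen (F := F) g
    refine ⟨{x}, fun T hT => ?_⟩
    rw [← hx, ← mul_assoc, sum_vtx_mul_vtx (by simpa using hT)]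
  | hmul g a _ =>
    obtain ⟨x, hx⟩ := exists_vtx_mul_gen (F := F) g
    refine ⟨{x}, fun T hT => ?_⟩
    rw [← hx, ← mul_assoc, ← mul_assoc, sum_vtx_mul_vtx (by simpa using hT)]

theorem exists_left_unit (a : E.LeavittPathAlgebra F) :
    ∃ S : Finset E.Vertex, (∑ x ∈ S, vtx F E x) * a = a :=
  (exists_left_unit_superset a).imp fun S h => h S subset_rfl

variable (F E) in
/-- The adjoint family, in the opposite algebra. -/
noncomputable def starFamily : LeavittFamily E (E.LeavittPathAlgebra F)ᵐᵒᵖ where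
  vtx x := .op (LeavittPathAlgebra.vtx F E x)
  edg e := .op (LeavittPathAlgebra.gho F E e)
  gho e := .op (LeavittPathAlgebra.edg F E e)
  vtx_mul_self x := by rw [← MulOpposite.op_mul, LeavittPathAlgebra.vtx_mul_self]
  vtx_mul_of_ne x y h := by
    rw [← MulOpposite.op_mul, LeavittPathAlgebra.vtx_mul_of_ne h.symm, MulOpposite.op_zero]
  vtx_mul_edg e := by rw [← MulOpposite.op_mul, LeavittPathAlgebra.gho_mul_vtx]
  edg_mul_vtx e := by rw [← MulOpposite.op_mul, LeavittPathAlgebra.vtx_mul_gho]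
  vtx_mul_gho e := by rw [← MulOpposite.op_mul, LeavittPathAlgebra.edg_mul_vtx]
  gho_mul_vtx e := by rw [← MulOpposite.op_mul, LeavittPathAlgebra.vtx_mul_edg]
  gho_mul_edg e := by rw [← MulOpposite.op_mul, LeavittPathAlgebra.gho_mul_edg]
  gho_mul_edg_of_ne e f h := by
    rw [← MulOpposite.op_mul, LeavittPathAlgebra.gho_mul_edg_of_ne h.symm, MulOpposite.op_zero]
  sum_edg_mul_gho x hx := by
    simp_rw [← MulOpposite.op_mul]
    rw [← LeavittPathAlgebra.sum_edg_mul_gho hx, Finset.op_sum]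

/-- The involution of the Leavitt path algebra, exchanging edges and ghost edges. -/
noncomputable def adj (a : E.LeavittPathAlgebra F) : E.LeavittPathAlgebra F :=
  ((starFamily F E).lift F a).unop

@[simp] theorem adj_zero : adj (0 : E.LeavittPathAlgebra F) = 0 := by simp [adj]

@[simp] theorem adj_add (a b : E.LeavittPathAlgebra F) : adj (a + b) = adj a + adj b := by
  simp [adj]

@[simp] theorem adj_smul (c : F) (a : E.LeavittPathAlgebra F) : adj (c • a) = c • adj a := by
  simp [adj]

@[simp] theorem adj_mul (a b : E.LeavittPathAlgebra F) : adj (a * b) = adj b * adj a := by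
  simp [adj]

@[simp] theorem adj_vtx (x : E.Vertex) : adj (vtx F E x) = vtx F E x := by
  simp [adj, starFamily]

@[simp] theorem adj_edg (e : E.Edge) : adj (edg F E e) = gho F E e := by
  simp [adj, starFamily]

@[simp] theorem adj_gho (e : E.Edge) : adj (gho F E e) = edg F E e := by
  simp [adj, starFamily]

@[simp] theorem adj_sum {ι : Type*} (s : Finset ι) (f : ι → E.LeavittPathAlgebra F) :
    adj (∑ i ∈ s, f i) = ∑ i ∈ s, adj (f i) :=
  map_sum (⟨⟨adj, adj_zero⟩, adj_add⟩ : E.LeavittPathAlgebra F →+ E.LeavittPathAlgebra F) f s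

theorem adj_gen_gen (g : E.LeavittGen) : adj (adj (gen F E g)) = gen F E g := by
  cases g <;> simp [gen]

@[simp] theorem adj_adj (a : E.LeavittPathAlgebra F) : adj (adj a) = a := by
  induction a using induction with
  | h0 => simp
  | hadd a b ha hb => simp [ha, hb]
  | hsmul c a ha => simp [ha]
  | hgen g => exact adj_gen_gen g
  | hmul g a ha => simp [ha, adj_gen_gen]

theorem exists_right_unit (a : E.LeavittPathAlgebra F) :
    ∃ S : Finset E.Vertex, a * (∑ x ∈ S, vtx F E x) = a := by
  obtain ⟨S, hS⟩ := exists_left_unit (adj a)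
  refine ⟨S, ?_⟩
  simpa using congr_arg adj hS

section Ideal

variable {K : TwoSidedIdeal (E.LeavittPathAlgebra F)} {a : E.LeavittPathAlgebra F}

/-- An ideal of a ring without unit is not a subspace by definition, but a local unit `u` of `a`
turns `c • a` into the multiple `(c • u) * a`. -/
theorem smul_mem_ideal (c : F) (ha : a ∈ K) : c • a ∈ K := by
  obtain ⟨S, hS⟩ := exists_left_unit a
  rw [← hS, ← smul_mul_assoc]
  exact K.mul_mem_left _ _ ha

theorem exists_vtx_mul_notMem (ha : a ∉ K) : ∃ x, vtx F E x * a ∉ K := by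
  by_contra! h
  obtain ⟨S, hS⟩ := exists_left_unit a
  rw [← hS, Finset.sum_mul] at ha
  exact ha (sum_mem fun x _ => h x)

theorem exists_mul_vtx_notMem (ha : a ∉ K) : ∃ x, a * vtx F E x ∉ K := by
  by_contra! h
  obtain ⟨S, hS⟩ := exists_right_unit a
  rw [← hS, Finset.mul_sum] at ha
  exact ha (sum_mem fun x _ => h x)

/-- Since `x = ∑ e e*`, if all `a e` were in the ideal then so would be `a x`. This pushes an
element outside `K` along edges. -/
theorem exists_mul_edg_notMem {x : E.Vertex} (hx : ∃ e, E.s e = x) (ha : a * vtx F E x ∉ K) :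
    ∃ e, E.s e = x ∧ a * edg F E e ∉ K := by
  by_contra! h
  rw [← sum_edg_mul_gho hx, Finset.mul_sum] at ha
  refine ha (sum_mem fun e he => ?_)
  rw [← mul_assoc]
  exact K.mul_mem_right _ _ (h e ((E.mem_out x e).1 he))

theorem exists_gho_mul_notMem {x : E.Vertex} (hx : ∃ e, E.s e = x) (ha : vtx F E x * a ∉ K) :
    ∃ e, E.s e = x ∧ gho F E e * a ∉ K := by
  by_contra! h
  rw [← sum_edg_mul_gho hx, Finset.sum_mul] at ha
  refine ha (sum_mem fun e he => ?_)
  rw [mul_assoc]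
  exact K.mul_mem_left _ _ (h e ((E.mem_out x e).1 he))

end Ideal

end Basic

end LeavittPathAlgebra

end DirectedGraph

namespace DirectedGraph

/-! ### Paths and closed simple paths -/

section Paths

variable {E : DirectedGraph.{u, v}}

theorem isPath_append {x z : E.Vertex} {p q : List E.Edge} :
    E.IsPath x (p ++ q) z ↔ ∃ y, E.IsPath x p y ∧ E.IsPath y q z := by
  induction p generalizing x with
  | nil => simp [IsPath]
  | cons e p ih => simp [IsPath, ih, and_assoc]

theorem IsPath.append {x y z : E.Vertex} {p q : List E.Edge} (hp : E.IsPath x p y)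
    (hq : E.IsPath y q z) : E.IsPath x (p ++ q) z :=
  isPath_append.2 ⟨y, hp, hq⟩

theorem isPath_singleton (e : E.Edge) : E.IsPath (E.s e) [e] (E.r e) := ⟨rfl, rfl⟩

theorem IsPath.target_unique {x y z : E.Vertex} {p : List E.Edge} (hp : E.IsPath x p y)
    (hq : E.IsPath x p z) : y = z := by
  induction p generalizing x with
  | nil => exact hp.symm.trans hq
  | cons e p ih => exact ih hp.2 hq.2

theorem IsPath.source_unique {x y z w : E.Vertex} {p : List E.Edge} (hp : E.IsPath x p y)
    (hq : E.IsPath z p w) (hne : p ≠ []) : x = z := by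
  cases p with
  | nil => exact absurd rfl hne
  | cons e p => exact hp.1.symm.trans hq.1

theorem IsPath.s_head {x y : E.Vertex} {p : List E.Edge} (hp : E.IsPath x p y)
    (h : 0 < p.length) : E.s p[0] = x := by
  cases p with
  | nil => simp at h
  | cons e p => exact hp.1

theorem IsPath.r_getElem {x y : E.Vertex} {p : List E.Edge} (hp : E.IsPath x p y) (i : ℕ)
    (h : i + 1 < p.length) : E.r p[i] = E.s p[i + 1] := by
  induction p generalizing x i with
  | nil => simp at h
  | cons e p ih =>
    cases i with
    | zero => exact (hp.2.s_head (by simpa using h)).symm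
    | succ i => exact ih hp.2 i (by simpa using h)

theorem IsPath.r_last {x y : E.Vertex} {p : List E.Edge} (hp : E.IsPath x p y) (i : ℕ)
    (h : i + 1 = p.length) : E.r (p[i]'(by omega)) = y := by
  induction p generalizing x i with
  | nil => simp at h
  | cons e p ih =>
    cases i with
    | zero =>
      have : p = [] := by simpa using h.symm
      subst this
      exact hp.2
    | succ i => exact ih hp.2 i (by simpa using h)

/-- A path can be shortened to one that passes through no vertex twice. -/
theorem IsPath.exists_simple {x y : E.Vertex} {p : List E.Edge} (hp : E.IsPath x p y) :
    ∃ q, E.IsPath x q y ∧ (q.map E.s).Nodup ∧ y ∉ q.map E.s := by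
  induction p generalizing x with
  | nil => exact ⟨[], hp, by simp⟩
  | cons e p ih =>
    obtain ⟨q, hq, hn, hy⟩ := ih hp.2
    by_cases hxy : x = y
    · exact ⟨[], hxy, by simp⟩
    -- If the shortened tail comes back to `x`, the path can start from that visit instead.
    by_cases hx : x ∈ q.map E.s
    · obtain ⟨f, hf, hfx⟩ := List.mem_map.1 hx
      obtain ⟨q₁, q₂, rfl⟩ := List.append_of_mem hf
      obtain ⟨z, _, h₂⟩ := isPath_append.1 hq
      refine ⟨f :: q₂, ⟨hfx, h₂.2⟩, ?_, fun h => hy ?_⟩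
      · rw [List.map_append] at hn
        exact hn.of_append_right
      · rw [List.map_append]
        exact List.mem_append_right _ h
    · refine ⟨e :: q, ⟨hp.1, hq⟩, ?_, ?_⟩
      · rw [List.map_cons, hp.1]
        exact List.nodup_cons.2 ⟨hx, hn⟩
      · rw [List.map_cons, hp.1, List.mem_cons, not_or]
        exact ⟨fun h => hxy h.symm, hy⟩

/-- Keep the first edge and shorten the way back. A shortened path does not meet its end `x`
earlier, so the first source stays distinct from the others. -/
theorem IsClosedPath.exists_nodup {x : E.Vertex} {p : List E.Edge} (hp : E.IsClosedPath x p) :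
    ∃ q, E.IsClosedPath x q ∧ (q.map E.s).Nodup := by
  obtain ⟨hne, hp⟩ := hp
  cases p with
  | nil => exact absurd rfl hne
  | cons e p =>
    obtain ⟨q, hq, hn, hy⟩ := hp.2.exists_simple
    refine ⟨e :: q, ⟨by simp, hp.1, hq⟩, ?_⟩
    rw [List.map_cons, hp.1]
    exact List.nodup_cons.2 ⟨hy, hn⟩

theorem isClosedSimplePath_of_nodup {x : E.Vertex} {p : List E.Edge} (hp : E.IsClosedPath x p)
    (hn : (p.map E.s).Nodup) : E.IsClosedSimplePath x p := by
  refine ⟨hp, fun e he hx => ?_⟩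
  obtain ⟨hne, hp⟩ := hp
  cases p with
  | nil => exact absurd rfl hne
  | cons f p =>
    rw [List.map_cons, List.nodup_cons, hp.1] at hn
    exact hn.1 (hx ▸ List.mem_map_of_mem he)

end Paths

/-! ### Cycles with a base point -/

/-- A cycle with a base point. -/
structure BasedCycle (E : DirectedGraph.{u, v}) where
  edges : List E.Edge
  base : E.Vertex
  ne_nil : edges ≠ []
  isPath : E.IsPath base edges base
  nodup : (edges.map E.s).Nodup

namespace BasedCycle

variable {E : DirectedGraph.{u, v}} (c : E.BasedCycle)

/-- The cycle has no exits. -/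
def NoExit : Prop := ¬ E.HasExit c.edges

theorem isCycle : E.IsCycle c.edges := ⟨⟨c.base, c.ne_nil, c.isPath⟩, c.nodup⟩

/-- The length of the cycle. -/
def len : ℕ := c.edges.length

theorem len_pos : 0 < c.len := List.length_pos_iff.2 c.ne_nil

/-- The `i`-th edge of the cycle, for `i` modulo the length. -/
def nth (i : ℕ) : E.Edge := c.edges[i % c.len]'(Nat.mod_lt _ c.len_pos)

theorem nth_mem (i : ℕ) : c.nth i ∈ c.edges := List.getElem_mem _

theorem nth_mod (i : ℕ) : c.nth (i % c.len) = c.nth i := by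
  unfold nth
  congr 1
  exact Nat.mod_mod _ _

theorem nth_add_len (i : ℕ) : c.nth (i + c.len) = c.nth i := by
  unfold nth
  congr 1
  exact Nat.add_mod_right _ _

theorem nth_of_lt {i : ℕ} (h : i < c.edges.length) : c.nth i = c.edges[i] := by
  simp only [nth]
  congr 1
  exact Nat.mod_eq_of_lt h

theorem exists_nth_eq {e : E.Edge} (he : e ∈ c.edges) : ∃ i, i < c.len ∧ c.nth i = e := by
  obtain ⟨i, h, rfl⟩ := List.mem_iff_getElem.1 he
  exact ⟨i, h, c.nth_of_lt h⟩

theorem s_nth_zero : E.s (c.nth 0) = c.base := by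
  rw [c.nth_of_lt c.len_pos]
  exact c.isPath.s_head c.len_pos

theorem r_nth (i : ℕ) : E.r (c.nth i) = E.s (c.nth (i + 1)) := by
  have hlt := Nat.mod_lt i c.len_pos
  rw [← c.nth_mod i, ← c.nth_mod (i + 1), ← Nat.mod_add_mod]
  generalize i % c.len = j at hlt
  rw [c.nth_of_lt hlt]
  rcases Nat.lt_or_ge (j + 1) c.len with h | h
  · rw [Nat.mod_eq_of_lt h, c.nth_of_lt h]
    exact c.isPath.r_getElem j h
  · have h' : j + 1 = c.len := by omega
    rw [h', Nat.mod_self, s_nth_zero]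
    exact c.isPath.r_last j h'

theorem mod_eq_of_s_nth_eq {i j : ℕ} (h : E.s (c.nth i) = E.s (c.nth j)) :
    i % c.len = j % c.len := by
  have := c.nodup
  rw [List.nodup_iff_injective_getElem] at this
  have h2 := @this ⟨i % c.len, by simpa [len] using Nat.mod_lt i c.len_pos⟩
    ⟨j % c.len, by simpa [len] using Nat.mod_lt j c.len_pos⟩
    (by simp only [List.getElem_map]; exact h)
  simpa using h2

/-- The segment of length `k` of the cycle, starting with the `i`-th edge. -/
def seg (i k : ℕ) : List E.Edge := (List.range k).map fun j => c.nth (i + j)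

@[simp] theorem seg_zero (i : ℕ) : c.seg i 0 = [] := rfl

@[simp] theorem length_seg (i k : ℕ) : (c.seg i k).length = k := by simp [seg]

theorem seg_add (i k l : ℕ) : c.seg i (k + l) = c.seg i k ++ c.seg (i + k) l := by
  simp [seg, List.range_add, Function.comp_def, add_assoc]

theorem seg_one (i : ℕ) : c.seg i 1 = [c.nth i] := by simp [seg]

theorem seg_succ (i k : ℕ) : c.seg i (k + 1) = c.nth i :: c.seg (i + 1) k := by
  rw [add_comm k, seg_add, seg_one]
  rfl

theorem getElem_seg (i k j : ℕ) (h : j < (c.seg i k).length) : (c.seg i k)[j] = c.nth (i + j) := by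
  simp [seg]

theorem seg_zero_len : c.seg 0 c.len = c.edges := by
  refine List.ext_getElem (by simp [len]) fun j h₁ h₂ => ?_
  rw [getElem_seg, zero_add, c.nth_of_lt]

theorem seg_add_len (i k : ℕ) : c.seg (i + c.len) k = c.seg i k := by
  simp only [seg, add_right_comm, nth_add_len]

theorem isPath_seg (i k : ℕ) : E.IsPath (E.s (c.nth i)) (c.seg i k) (E.s (c.nth (i + k))) := by
  induction k generalizing i with
  | zero => rfl
  | succ k ih =>
    rw [seg_succ]
    refine ⟨rfl, ?_⟩
    rw [r_nth, add_comm k, ← add_assoc]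
    exact ih (i + 1)

variable {c}

theorem NoExit.eq_nth (hc : c.NoExit) {e : E.Edge} {i : ℕ} (h : E.s e = E.s (c.nth i)) :
    e = c.nth i := by
  by_contra hne
  exact hc ⟨c.nth i, c.nth_mem i, e, h, hne⟩

/-- At each vertex of a cycle without exits the next edge is forced, so a path that starts there can
only run around the cycle. -/
theorem NoExit.eq_seg (hc : c.NoExit) {q : List E.Edge} {y : E.Vertex} {i : ℕ}
    (h : E.IsPath (E.s (c.nth i)) q y) :
    q = c.seg i q.length ∧ y = E.s (c.nth (i + q.length)) := by
  induction q generalizing i with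
  | nil => exact ⟨rfl, h.symm⟩
  | cons e q ih =>
    obtain rfl := hc.eq_nth h.1
    have h2 := h.2
    rw [r_nth] at h2
    obtain ⟨h₁, h₂⟩ := ih h2
    refine ⟨?_, ?_⟩
    · rw [List.length_cons, seg_succ, ← h₁]
    · rw [h₂, List.length_cons, add_right_comm, add_assoc]

/-- From the common vertex on, `c` is forced to follow `d`. Each length is then a period of the
other cycle, so the lengths divide one another. -/
theorem NoExit.isRotated {d : E.BasedCycle} (hd : d.NoExit) {i j : ℕ}
    (h : E.s (c.nth i) = E.s (d.nth j)) : c.edges ~r d.edges := by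
  have key : ∀ k, c.nth (i + k) = d.nth (j + k) := by
    intro k
    induction k with
    | zero => exact hd.eq_nth h
    | succ k ih =>
      refine hd.eq_nth ?_
      rw [← add_assoc, ← add_assoc, ← r_nth, ← r_nth, ih]
  have h₁ : c.len ∣ d.len := by
    have : E.s (c.nth (i + d.len)) = E.s (c.nth i) := by
      rw [key, nth_add_len, ← h]
    have := c.mod_eq_of_s_nth_eq this
    exact (Nat.modEq_zero_iff_dvd).1 (Nat.ModEq.add_left_cancel' i this)
  have h₂ : d.len ∣ c.len := by
    have : E.s (d.nth (j + c.len)) = E.s (d.nth j) := by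
      rw [← key, nth_add_len, ← h]
    have := d.mod_eq_of_s_nth_eq this
    exact (Nat.modEq_zero_iff_dvd).1 (Nat.ModEq.add_left_cancel' j this)
  have hlen : c.len = d.len := Nat.dvd_antisymm h₁ h₂
  have h₃ : c.edges.rotate i = d.edges.rotate j := by
    refine List.ext_getElem (by simpa [len] using hlen) fun k hk₁ hk₂ => ?_
    rw [List.getElem_rotate, List.getElem_rotate]
    have := key k
    simpa [nth, len, add_comm] using this
  exact (List.IsRotated.forall c.edges i).symm.trans (h₃ ▸ List.IsRotated.forall d.edges j)

end BasedCycle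

theorem exists_basedCycle_of_isCycle {E : DirectedGraph.{u, v}} {p : List E.Edge}
    (hp : E.IsCycle p) : ∃ c : E.BasedCycle, c.edges = p := by
  obtain ⟨⟨x, hne, h⟩, hn⟩ := hp
  exact ⟨⟨p, x, hne, h, hn⟩, rfl⟩

theorem IsClosedPath.exists_basedCycle {E : DirectedGraph.{u, v}} {x : E.Vertex}
    {p : List E.Edge} (hp : E.IsClosedPath x p) : ∃ c : E.BasedCycle, c.base = x := by
  obtain ⟨q, hq, hn⟩ := hp.exists_nodup
  exact ⟨⟨q, x, hq.1, hq.2, hn⟩, rfl⟩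

theorem exists_exitlessCycle_rep {E : DirectedGraph.{u, v}} (c : E.exitlessCycles) :
    ∃ d : E.BasedCycle, d.NoExit ∧ (d.edges : Cycle E.Edge) = c.1 := by
  obtain ⟨c, p, rfl, hp, hx⟩ := c
  obtain ⟨d, rfl⟩ := exists_basedCycle_of_isCycle hp
  exact ⟨d, hx, rfl⟩

/-- A representative of a cycle without exits. -/
noncomputable def exitlessCycles.rep {E : DirectedGraph.{u, v}} (c : E.exitlessCycles) :
    E.BasedCycle := (exists_exitlessCycle_rep c).choose

theorem exitlessCycles.rep_noExit {E : DirectedGraph.{u, v}} (c : E.exitlessCycles) :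
    (rep c).NoExit := (exists_exitlessCycle_rep c).choose_spec.1

theorem exitlessCycles.coe_rep {E : DirectedGraph.{u, v}} (c : E.exitlessCycles) :
    ((rep c).edges : Cycle E.Edge) = c.1 := (exists_exitlessCycle_rep c).choose_spec.2

/-- The class of a based cycle without exits. -/
def BasedCycle.toExitless {E : DirectedGraph.{u, v}} (d : E.BasedCycle) (hd : d.NoExit) :
    E.exitlessCycles := ⟨d.edges, d.edges, rfl, d.isCycle, hd⟩

theorem exitlessCycles.eq_of_s_nth_eq {E : DirectedGraph.{u, v}} {c d : E.exitlessCycles}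
    {i j : ℕ} (h : E.s ((rep c).nth i) = E.s ((rep d).nth j)) : c = d := by
  refine Subtype.ext ?_
  rw [← coe_rep, ← coe_rep, Cycle.coe_eq_coe]
  exact (rep_noExit d).isRotated h

theorem conditionL_iff {E : DirectedGraph.{u, v}} : E.ConditionL ↔ IsEmpty E.exitlessCycles := by
  constructor
  · exact fun h => ⟨fun ⟨_, p, _, hp, hx⟩ => hx (h p hp)⟩
  · intro h p hp
    by_contra hx
    exact h.false ⟨p, p, rfl, hp, hx⟩

/-! ### Hereditary saturated sets and quotient graphs -/

/-- A set of vertices is hereditary and saturated if it is closed under passing to the ranges of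
the edges, and contains each vertex emitting edges all of whose ranges it contains. -/
def IsHereditarySaturated (E : DirectedGraph.{u, v}) (H : Set E.Vertex) : Prop :=
  (∀ e, E.s e ∈ H → E.r e ∈ H) ∧
    ∀ x, (∃ e, E.s e = x) → (∀ e, E.s e = x → E.r e ∈ H) → x ∈ H

/-- The hereditary saturated sets of vertices. -/
abbrev HSet (E : DirectedGraph.{u, v}) := {H : Set E.Vertex // E.IsHereditarySaturated H}

/-- The quotient graph by a hereditary saturated set. -/
def quot (E : DirectedGraph.{u, v}) (H : E.HSet) : DirectedGraph.{u, v} where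
  Vertex := {x : E.Vertex // x ∉ H.1}
  Edge := {e : E.Edge // E.r e ∉ H.1}
  s e := ⟨E.s e.1, fun h => e.2 (H.2.1 _ h)⟩
  r e := ⟨E.r e.1, e.2⟩

section Quot

variable {E : DirectedGraph.{u, v}} {H : E.HSet}

/-- A vertex of the quotient graph, as a vertex of the graph. -/
def quotV (x : (E.quot H).Vertex) : E.Vertex := x.1

/-- An edge of the quotient graph, as an edge of the graph. -/
def quotE (e : (E.quot H).Edge) : E.Edge := e.1

theorem quotV_injective : Function.Injective (quotV (E := E) (H := H)) := Subtype.val_injective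

theorem quotE_injective : Function.Injective (quotE (E := E) (H := H)) := Subtype.val_injective

theorem quotV_notMem (x : (E.quot H).Vertex) : quotV x ∉ H.1 := x.2

theorem r_quotE (e : (E.quot H).Edge) : E.r (quotE e) = quotV ((E.quot H).r e) := rfl

theorem s_quotE (e : (E.quot H).Edge) : E.s (quotE e) = quotV ((E.quot H).s e) := rfl

theorem exists_quotV {x : E.Vertex} (hx : x ∉ H.1) : ∃ y : (E.quot H).Vertex, quotV y = x :=
  ⟨⟨x, hx⟩, rfl⟩

theorem exists_quotE {e : E.Edge} (he : E.r e ∉ H.1) : ∃ f : (E.quot H).Edge, quotE f = e :=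
  ⟨⟨e, he⟩, rfl⟩

theorem s_quot_eq_iff {e : (E.quot H).Edge} {x : (E.quot H).Vertex} :
    (E.quot H).s e = x ↔ E.s (quotE e) = quotV x := by
  rw [s_quotE, quotV_injective.eq_iff]

instance [E.RowFinite] : (E.quot H).RowFinite where
  finite_out x := by
    refine Set.Finite.of_finite_image (f := quotE) ?_ quotE_injective.injOn
    refine (RowFinite.finite_out (E := E) (quotV x)).subset ?_
    rintro _ ⟨e, he, rfl⟩
    exact s_quot_eq_iff.1 he

theorem isPath_quot {x y : (E.quot H).Vertex} {p : List (E.quot H).Edge}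
    (hp : (E.quot H).IsPath x p y) : E.IsPath (quotV x) (p.map quotE) (quotV y) := by
  induction p generalizing x with
  | nil => exact congr_arg quotV hp
  | cons e p ih => exact ⟨s_quot_eq_iff.1 hp.1, ih hp.2⟩

/-- Once a path enters a hereditary set it stays there. A path ending outside `H` therefore avoids
`H` throughout, and it is lifted backwards from its end. -/
theorem IsPath.exists_quot {x : E.Vertex} {y : (E.quot H).Vertex} {p : List E.Edge}
    (hp : E.IsPath x p (quotV y)) : ∃ (z : (E.quot H).Vertex) (q : List (E.quot H).Edge),
      quotV z = x ∧ q.map quotE = p ∧ (E.quot H).IsPath z q y := by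
  induction p generalizing x with
  | nil => exact ⟨y, [], hp.symm, rfl, rfl⟩
  | cons e p ih =>
    obtain ⟨z, q, hz, rfl, hq⟩ := ih hp.2
    obtain ⟨f, rfl⟩ := exists_quotE (hz ▸ quotV_notMem z : E.r e ∉ H.1)
    rw [r_quotE] at hz
    rw [quotV_injective hz] at hq
    exact ⟨(E.quot H).s f, f :: q, hp.1, rfl, rfl, hq⟩

theorem IsPath.exists_quot' {x y : (E.quot H).Vertex} {p : List E.Edge}
    (hp : E.IsPath (quotV x) p (quotV y)) : ∃ q : List (E.quot H).Edge,
      q.map quotE = p ∧ (E.quot H).IsPath x q y := by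
  obtain ⟨z, q, hz, hqp, hq⟩ := hp.exists_quot
  exact ⟨q, hqp, quotV_injective hz ▸ hq⟩

/-- This is where saturation enters: passing to the quotient graph creates no new sinks, so the
relations at `x` persist. -/
theorem exists_edge_quot {x : (E.quot H).Vertex} (hx : ∃ e, E.s e = quotV x) :
    ∃ e, (E.quot H).s e = x := by
  by_contra! h
  refine quotV_notMem x (H.2.2 _ hx fun e he => ?_)
  by_contra hr
  obtain ⟨f, rfl⟩ := exists_quotE hr
  exact h f (s_quot_eq_iff.2 he)

theorem sum_out_quot [E.RowFinite] {M : Type*} [AddCommMonoid M] (x : (E.quot H).Vertex)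
    (g : E.Edge → M) (hg : ∀ e, E.s e = quotV x → E.r e ∈ H.1 → g e = 0) :
    ∑ e ∈ E.out (quotV x), g e = ∑ e ∈ (E.quot H).out x, g (quotE e) := by
  refine (Finset.sum_map ((E.quot H).out x) ⟨quotE, quotE_injective⟩ g).symm.trans ?_ |>.symm
  refine Finset.sum_subset ?_ fun e he hn => ?_
  · intro e he
    obtain ⟨f, hf, rfl⟩ := Finset.mem_map.1 he
    exact (E.mem_out _ _).2 (s_quot_eq_iff.1 (((E.quot H).mem_out _ _).1 hf))
  · have hs := (E.mem_out _ _).1 he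
    refine hg e hs ?_
    by_contra hr
    obtain ⟨f, rfl⟩ := exists_quotE hr
    exact hn (Finset.mem_map.2 ⟨f, ((E.quot H).mem_out _ _).2 (s_quot_eq_iff.2 hs), rfl⟩)

theorem nodup_quotE_iff {p : List (E.quot H).Edge} :
    ((p.map quotE).map E.s).Nodup ↔ (p.map (E.quot H).s).Nodup := by
  rw [← List.nodup_map_iff quotV_injective, List.map_map, List.map_map]
  rfl

theorem isPath_seg_quot (c : (E.quot H).BasedCycle) :
    E.IsPath (quotV c.base) (c.edges.map quotE) (quotV c.base) := isPath_quot c.isPath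

end Quot

/-! ### Condition (K) in terms of quotient graphs -/

theorem isClosedSimplePath_cons_append {E : DirectedGraph.{u, v}} {c : E.BasedCycle} {e f : E.Edge}
    {p₁ p₂ q : List E.Edge} (hc : c.edges = p₁ ++ e :: p₂) (hs : E.s f = E.s e)
    (hq : E.IsPath (E.r f) q c.base) (hx : c.base ∉ q.map E.s) :
    E.IsClosedSimplePath c.base (p₁ ++ f :: q) := by
  have hp := c.isPath
  have hsimp := (isClosedSimplePath_of_nodup ⟨c.ne_nil, hp⟩ c.nodup).2
  rw [hc] at hp hsimp
  obtain ⟨y, h₁, h₂⟩ := isPath_append.1 hp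
  refine ⟨⟨by simp, h₁.append ⟨hs.trans h₂.1, hq⟩⟩, fun g hg h => ?_⟩
  cases p₁ with
  | nil => exact hx (h ▸ List.mem_map_of_mem (by simpa using hg))
  | cons a p₁ =>
    simp only [List.cons_append, List.tail_cons, List.mem_append, List.mem_cons] at hg hsimp
    rcases hg with hg | rfl | hg
    · exact hsimp g (.inl hg) h
    · exact hsimp e (.inr (.inl rfl)) (hs ▸ h)
    · exact hx (h ▸ List.mem_map_of_mem hg)

/-- A cycle without exits in a quotient graph is the only closed simple path at its base, because
any closed path there lifts to the quotient and runs around the cycle. Conversely, let `p` be the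
only closed simple path at `x`, and discard the vertices that do not lead to `x`. An exit of `p` in
what remains leads back to `x` and yields a second closed simple path. -/
theorem conditionK_iff {E : DirectedGraph.{u, v}} :
    E.ConditionK ↔ ∀ H : E.HSet, (E.quot H).ConditionL := by
  constructor
  · intro hK H p hp
    by_contra hx
    obtain ⟨c, rfl⟩ := exists_basedCycle_of_isCycle hp
    have hc : c.NoExit := hx
    have hcsp : E.IsClosedSimplePath (quotV c.base) (c.edges.map quotE) :=
      isClosedSimplePath_of_nodup ⟨fun h => c.ne_nil (List.map_eq_nil_iff.1 h),
        isPath_quot c.isPath⟩ (nodup_quotE_iff.2 c.nodup)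
    obtain ⟨q, ⟨⟨hne, hq⟩, hq'⟩, hqp⟩ := hK _ _ hcsp
    obtain ⟨q, rfl, hq₂⟩ := hq.exists_quot'
    rw [← c.s_nth_zero] at hq₂
    obtain ⟨h₁, h₂⟩ := hc.eq_seg hq₂
    refine hqp ?_
    suffices q.length = c.len by rw [h₁, this, c.seg_zero_len]
    have hpos : 0 < q.length := by
      rw [List.length_pos_iff]
      rintro rfl
      exact hne rfl
    have hlen := c.len_pos
    have hdvd : c.len ∣ q.length := by
      have := c.mod_eq_of_s_nth_eq h₂
      rw [zero_add, Nat.zero_mod] at this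
      exact Nat.dvd_of_mod_eq_zero this.symm
    refine le_antisymm ?_ (Nat.le_of_dvd hpos hdvd)
    -- A run longer than one turn passes through the base in between, which a simple path may not
    -- do.
    by_contra! hlt
    have hsplit : q = c.nth 0 :: (c.seg 1 (c.len - 1) ++
        c.nth 0 :: c.seg (c.len + 1) (q.length - c.len - 1)) := by
      have h3 : q.length = ((c.len - 1) + ((q.length - c.len - 1) + 1)) + 1 := by omega
      have h4 : c.nth c.len = c.nth 0 := by rw [← zero_add c.len, c.nth_add_len]
      conv_lhs => rw [h₁, h3, c.seg_succ, c.seg_add, zero_add, Nat.add_sub_cancel' hlen,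
        c.seg_succ, h4]
    refine hq' (quotE (c.nth 0)) ?_ ?_
    · rw [hsplit]
      simp
    · rw [s_quotE, c.s_nth_zero]
  · intro hL x p hp
    by_contra! huniq
    -- The only delicate case of saturation is `x` itself: the first edge of `p` leads to a vertex
    -- from which `x` is reached.
    let H : E.HSet := ⟨{y | ¬ ∃ q, E.IsPath y q x}, by
      refine ⟨fun e he ⟨q, hq⟩ => he ⟨e :: q, rfl, hq⟩, ?_⟩
      rintro y ⟨e, rfl⟩ hr ⟨q, hq⟩
      cases q with
      | nil =>
        obtain ⟨⟨hne, hpath⟩, _⟩ := hp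
        cases p with
        | nil => exact hne rfl
        | cons f p => exact hr f (hpath.1.trans hq.symm) ⟨p, hpath.2⟩
      | cons f q => exact hr f hq.1 ⟨q, hq.2⟩⟩
    obtain ⟨y, hy⟩ := exists_quotV (H := H) (x := x) fun h => h ⟨[], rfl⟩
    obtain ⟨c, hcx⟩ := hp.1.exists_basedCycle
    have hcp : c.edges = p :=
      huniq _ (isClosedSimplePath_of_nodup ⟨c.ne_nil, hcx ▸ c.isPath⟩ c.nodup)
    have hpath : E.IsPath (quotV y) c.edges (quotV y) := by
      rw [hy, ← hcx]
      exact c.isPath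
    obtain ⟨q, hqp, hq⟩ := hpath.exists_quot'
    obtain ⟨e, he, f, hs, hfe⟩ := hL H q ⟨⟨_, by
      rintro rfl
      exact c.ne_nil hqp.symm, hq⟩, nodup_quotE_iff.1 (hqp ▸ c.nodup)⟩
    have he' : quotE e ∈ c.edges := hqp ▸ List.mem_map_of_mem he
    obtain ⟨p₁, p₂, hpp⟩ := List.append_of_mem he'
    -- The exit ends outside `H`, that is, at a vertex that leads to `x`.
    obtain ⟨q', hq'⟩ := not_not.1 f.2
    obtain ⟨q'', hq'', _, hn⟩ := hq'.exists_simple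
    have h := huniq _ (hcx ▸ isClosedSimplePath_cons_append (f := quotE f) hpp
      (by rw [s_quotE, s_quotE, hs]) (hcx ▸ hq'') (hcx ▸ hn))
    rw [← hcp, hpp, List.append_cancel_left_eq, List.cons.injEq] at h
    exact hfe (quotE_injective h.1)

end DirectedGraph

namespace DirectedGraph

namespace LeavittPathAlgebra

/-! ### Paths and their linear combinations in the algebra -/

section Paths

variable (F : Type w) [Field F] {E : DirectedGraph.{u, v}} [E.RowFinite]

/-- The image of a path with source `x` in the Leavitt path algebra. -/
noncomputable def path (x : E.Vertex) : List E.Edge → E.LeavittPathAlgebra F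
  | [] => vtx F E x
  | e :: p => edg F E e * path (E.r e) p

variable {F}

@[simp] theorem path_nil (x : E.Vertex) : path F x [] = vtx F E x := rfl

@[simp] theorem path_cons (x : E.Vertex) (e : E.Edge) (p : List E.Edge) :
    path F x (e :: p) = edg F E e * path F (E.r e) p := rfl

theorem path_singleton (x : E.Vertex) (e : E.Edge) : path F x [e] = edg F E e :=
  edg_mul_vtx e

variable {x y z : E.Vertex} {p q : List E.Edge}

theorem vtx_mul_path (hp : E.IsPath x p y) : vtx F E x * path F x p = path F x p := by
  cases p with
  | nil => exact vtx_mul_self x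
  | cons e p => rw [path_cons, ← mul_assoc, ← hp.1, vtx_mul_edg]

theorem vtx_mul_path_of_ne (hp : E.IsPath x p y) (h : z ≠ x) : vtx F E z * path F x p = 0 := by
  rw [← vtx_mul_path hp, ← mul_assoc, vtx_mul_of_ne h, zero_mul]

theorem path_mul_vtx (hp : E.IsPath x p y) : path F x p * vtx F E y = path F x p := by
  induction p generalizing x with
  | nil =>
    obtain rfl : x = y := hp
    exact vtx_mul_self x
  | cons e p ih => rw [path_cons, mul_assoc, ih hp.2]

theorem path_append (hp : E.IsPath x p y) (hq : E.IsPath y q z) :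
    path F x (p ++ q) = path F x p * path F y q := by
  induction p generalizing x with
  | nil =>
    obtain rfl : x = y := hp
    exact (vtx_mul_path hq).symm
  | cons e p ih => rw [List.cons_append, path_cons, path_cons, ih hp.2, mul_assoc]

theorem adj_path_mul_vtx (hp : E.IsPath x p y) :
    adj (path F x p) * vtx F E x = adj (path F x p) := by
  simpa using congr_arg adj (vtx_mul_path (F := F) hp)

theorem vtx_mul_adj_path (hp : E.IsPath x p y) :
    vtx F E y * adj (path F x p) = adj (path F x p) := by
  simpa using congr_arg adj (path_mul_vtx (F := F) hp)

theorem adj_path_mul_path (hp : E.IsPath x p y) :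
    adj (path F x p) * path F x p = vtx F E y := by
  induction p generalizing x with
  | nil =>
    obtain rfl : x = y := hp
    simp [vtx_mul_self]
  | cons e p ih =>
    rw [path_cons, adj_mul, adj_edg, mul_assoc, ← mul_assoc (gho F E e), gho_mul_edg,
      vtx_mul_path hp.2, ih hp.2]

/-- Ghost edges cancel against equal edges from the inside out, and the first mismatch gives zero.
-/
theorem prefix_of_adj_path_mul_path_ne_zero {y' : E.Vertex} (hp : E.IsPath x p y)
    (hq : E.IsPath x q y') (h : adj (path F x p) * path F x q ≠ 0) : p <+: q ∨ q <+: p := by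
  induction p generalizing x q with
  | nil => exact .inl List.nil_prefix
  | cons e p ih =>
    cases q with
    | nil => exact .inr List.nil_prefix
    | cons f q =>
      rw [path_cons, path_cons, adj_mul, adj_edg, mul_assoc, ← mul_assoc (gho F E e)] at h
      by_cases hef : e = f
      · subst hef
        rw [gho_mul_edg, vtx_mul_path hq.2] at h
        simpa using ih hp.2 hq.2 h
      · rw [gho_mul_edg_of_ne hef] at h
        simp at h

/-! #### Polynomials in a closed path -/

variable (F) in
/-- The powers of a closed path based at `x`. -/
noncomputable def cpow (x : E.Vertex) (p : List E.Edge) : ℕ → E.LeavittPathAlgebra F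
  | 0 => vtx F E x
  | k + 1 => path F x p * cpow x p k

theorem vtx_mul_cpow (hp : E.IsPath x p x) (k : ℕ) : vtx F E x * cpow F x p k = cpow F x p k := by
  cases k with
  | zero => exact vtx_mul_self x
  | succ k => rw [cpow, ← mul_assoc, vtx_mul_path hp]

open Polynomial in
variable (F) in
/-- Evaluation of polynomials at a closed path. -/
noncomputable def ev (x : E.Vertex) (p : List E.Edge) : F[X] →ₗ[F] E.LeavittPathAlgebra F :=
  Polynomial.lsum fun k => LinearMap.toSpanSingleton F _ (cpow F x p k)

open Polynomial

theorem ev_monomial (x : E.Vertex) (p : List E.Edge) (k : ℕ) (a : F) :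
    ev F x p (monomial k a) = a • cpow F x p k := by
  simp [ev, Polynomial.lsum_apply]

theorem ev_C (x : E.Vertex) (p : List E.Edge) (a : F) : ev F x p (C a) = a • vtx F E x :=
  ev_monomial x p 0 a

theorem ev_one (x : E.Vertex) (p : List E.Edge) : ev F x p 1 = vtx F E x := by
  simpa using ev_C x p (1 : F)

theorem ev_X_pow (x : E.Vertex) (p : List E.Edge) (k : ℕ) :
    ev F x p (X ^ k) = cpow F x p k := by
  rw [X_pow_eq_monomial, ev_monomial, one_smul]

theorem ev_X_mul (x : E.Vertex) (p : List E.Edge) (f : F[X]) :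
    ev F x p (X * f) = path F x p * ev F x p f := by
  induction f using Polynomial.induction_on' with
  | add f g hf hg => rw [mul_add, map_add, map_add, hf, hg, mul_add]
  | monomial k a => rw [X_mul_monomial, ev_monomial, ev_monomial, mul_smul_comm]; rfl

theorem vtx_mul_ev (hp : E.IsPath x p x) (f : F[X]) : vtx F E x * ev F x p f = ev F x p f := by
  induction f using Polynomial.induction_on' with
  | add f g hf hg => rw [map_add, mul_add, hf, hg]
  | monomial k a => rw [ev_monomial, mul_smul_comm, vtx_mul_cpow hp]

theorem ev_mul (hp : E.IsPath x p x) (f g : F[X]) :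
    ev F x p (f * g) = ev F x p f * ev F x p g := by
  induction f using Polynomial.induction_on generalizing g with
  | C a => rw [ev_C, smul_mul_assoc, vtx_mul_ev hp, ← smul_eq_C_mul, map_smul]
  | add f₁ f₂ h₁ h₂ => rw [add_mul, map_add, map_add, h₁, h₂, add_mul]
  | monomial k a ih =>
    rw [show (C a : F[X]) * X ^ (k + 1) = X * (C a * X ^ k) by ring, mul_assoc, ev_X_mul, ev_X_mul,
      ih, mul_assoc]

/-- The polynomials whose value at a closed path lies in an ideal. -/
noncomputable def evIdeal (K : TwoSidedIdeal (E.LeavittPathAlgebra F)) (hp : E.IsPath x p x) :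
    Ideal F[X] where
  carrier := {f | ev F x p f ∈ K}
  add_mem' {f g} hf hg := by
    change ev F x p (f + g) ∈ K
    rw [map_add]
    exact K.add_mem hf hg
  zero_mem' := by
    change ev F x p 0 ∈ K
    rw [map_zero]
    exact K.zero_mem
  smul_mem' f g hg := by
    change ev F x p (f * g) ∈ K
    rw [ev_mul hp]
    exact K.mul_mem_left _ _ hg

theorem mem_evIdeal {K : TwoSidedIdeal (E.LeavittPathAlgebra F)} {hp : E.IsPath x p x}
    {f : F[X]} : f ∈ evIdeal K hp ↔ ev F x p f ∈ K := Iff.rfl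

/-- The adjoint of a closed path is a left inverse of it at its base, so a factor `X` can be
cancelled. Thus these ideals of `F[X]` are restrictions of ideals of Laurent polynomials. -/
theorem mem_evIdeal_of_X_mul_mem {K : TwoSidedIdeal (E.LeavittPathAlgebra F)}
    {hp : E.IsPath x p x} {f : F[X]} (h : X * f ∈ evIdeal K hp) : f ∈ evIdeal K hp := by
  rw [mem_evIdeal, ev_X_mul] at h
  have := K.mul_mem_left (adj (path F x p)) _ h
  rwa [← mul_assoc, adj_path_mul_path hp, vtx_mul_ev hp] at this

/-- Conjugation by the first edge moves the base point of a closed path one step on, and it is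
compatible with powers. -/
theorem ev_rotate {e : E.Edge} (hp : E.IsPath x (e :: p) x) (f : F[X]) :
    ev F (E.r e) (p ++ [e]) f = gho F E e * ev F x (e :: p) f * edg F E e := by
  obtain ⟨rfl, hp⟩ : E.s e = x ∧ E.IsPath (E.r e) p x := hp
  induction f using Polynomial.induction_on' with
  | add f g hf hg => rw [map_add, map_add, hf, hg, mul_add, add_mul]
  | monomial k a =>
    rw [ev_monomial, ev_monomial, mul_smul_comm, smul_mul_assoc]
    congr 1
    induction k with
    | zero => rw [cpow, cpow, gho_mul_vtx, gho_mul_edg]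
    | succ k ih =>
      rw [cpow, cpow, ih, path_append hp (isPath_singleton e), path_singleton, path_cons]
      -- In general `e e*` is not a vertex, but it fixes everything that begins with `e`. The
      -- product of the `k`-th power and `e` does so even for `k = 0`, where it is `e`.
      have h : edg F E e * (gho F E e * cpow F (E.s e) (e :: p) k * edg F E e) =
          cpow F (E.s e) (e :: p) k * edg F E e := by
        rw [← mul_assoc, ← mul_assoc]
        cases k with
        | zero =>
          rw [cpow, mul_assoc _ (vtx F E _), vtx_mul_edg, mul_assoc, gho_mul_edg, edg_mul_vtx]
        | succ k =>
          rw [cpow, path_cons]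
          simp only [mul_assoc]
          rw [← mul_assoc (gho F E e), gho_mul_edg, ← mul_assoc (vtx F E _), vtx_mul_path hp]
      rw [mul_assoc (path F _ p), h]
      simp only [mul_assoc]
      rw [← mul_assoc (gho F E e), gho_mul_edg, ← mul_assoc (vtx F E _), vtx_mul_path hp]

theorem ev_mem_of_isRotated {K : TwoSidedIdeal (E.LeavittPathAlgebra F)} {f : F[X]}
    (hp : E.IsPath x p x) (hq : E.IsPath y q y) (hne : p ≠ []) (h : p ~r q)
    (hf : ev F x p f ∈ K) : ev F y q f ∈ K := by
  obtain ⟨n, rfl⟩ := h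
  induction n generalizing y with
  | zero =>
    rw [List.rotate_zero] at hq ⊢
    rwa [← hp.source_unique hq hne]
  | succ n ih =>
    have hne' : p.rotate n ≠ [] := by simpa using hne
    rw [← List.rotate_rotate] at hq ⊢
    obtain ⟨e, q, heq⟩ := List.exists_cons_of_ne_nil hne'
    rw [heq, List.rotate_cons_succ, List.rotate_zero] at hq ⊢
    obtain ⟨z, hz₁, hz₂⟩ := isPath_append.1 hq
    obtain ⟨hs, hr⟩ := hz₂
    obtain rfl : E.r e = y := hr
    have h2 : E.IsPath (E.s e) (e :: q) (E.s e) := ⟨rfl, hs ▸ hz₁⟩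
    rw [ev_rotate h2]
    rw [heq] at ih
    exact K.mul_mem_right _ _ (K.mul_mem_left _ _ (ih h2))

/-! #### Spans of paths -/

variable (F) in
/-- The span of the paths of length at least `m` with range `z`. -/
noncomputable def pathsTo (z : E.Vertex) (m : ℕ) : Submodule F (E.LeavittPathAlgebra F) :=
  Submodule.span F {a | ∃ x p, E.IsPath x p z ∧ m ≤ p.length ∧ a = path F x p}

theorem path_mem_pathsTo {m : ℕ} (hp : E.IsPath x p z) (hm : m ≤ p.length) :
    path F x p ∈ pathsTo F z m :=
  Submodule.subset_span ⟨x, p, hp, hm, rfl⟩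

theorem pathsTo_anti {m n : ℕ} (h : m ≤ n) : pathsTo F z n ≤ pathsTo F z m :=
  Submodule.span_mono fun _ ⟨x, p, hp, hn, ha⟩ => ⟨x, p, hp, h.trans hn, ha⟩

/-- A generator shortens a path by at most one edge. Trouble arises only for a ghost edge applied to
a trivial path; at a sink that product is zero, hence the alternative in `hm`. -/
theorem gen_mul_mem_pathsTo {m : ℕ} (hm : 1 ≤ m ∨ ¬ ∃ e, E.s e = z) {b : E.LeavittPathAlgebra F}
    (hb : b ∈ pathsTo F z m) (g : E.LeavittGen) : gen F E g * b ∈ pathsTo F z (m - 1) := by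
  induction hb using Submodule.span_induction with
  | zero => simp
  | add a b _ _ ha hb => rw [mul_add]; exact add_mem ha hb
  | smul c a _ ha => rw [mul_smul_comm]; exact Submodule.smul_mem _ _ ha
  | mem a ha =>
    obtain ⟨x, p, hp, hl, rfl⟩ := ha
    cases g with
    | vertex y =>
      change vtx F E y * _ ∈ _
      by_cases hxy : y = x
      · rw [hxy, vtx_mul_path hp]
        exact path_mem_pathsTo hp (by omega)
      · rw [vtx_mul_path_of_ne hp hxy]
        exact zero_mem _
    | edge e =>
      change edg F E e * _ ∈ _
      by_cases hxy : E.r e = x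
      · subst hxy
        exact path_mem_pathsTo (x := E.s e) (p := e :: p) ⟨rfl, hp⟩ (by simp; omega)
      · rw [← vtx_mul_path hp, ← mul_assoc, edg_mul_vtx_of_ne hxy, zero_mul]
        exact zero_mem _
    | ghost e =>
      change gho F E e * _ ∈ _
      cases p with
      | nil =>
        obtain rfl : x = z := hp
        rcases hm with hm | hm
        · simp at hl
          omega
        · rw [path_nil, gho_mul_vtx_of_ne fun h => hm ⟨e, h⟩]
          exact zero_mem _
      | cons f p =>
        rw [path_cons, ← mul_assoc]
        by_cases hef : e = f
        · subst hef
          rw [gho_mul_edg, vtx_mul_path hp.2]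
          exact path_mem_pathsTo hp.2 (by simp at hl; omega)
        · rw [gho_mul_edg_of_ne hef, zero_mul]
          exact zero_mem _

/-- Every element multiplies long paths into the span of the paths. -/
theorem exists_mul_path_mem_pathsTo (a : E.LeavittPathAlgebra F) :
    ∃ N : ℕ, ∀ (y : E.Vertex) (q : List E.Edge) (z : E.Vertex), E.IsPath y q z →
      (N ≤ q.length ∨ ¬ ∃ e, E.s e = z) → a * path F y q ∈ pathsTo F z (q.length - N) := by
  induction a using induction with
  | h0 => exact ⟨0, by simp⟩
  | hadd a b ha hb =>
    obtain ⟨M, hM⟩ := ha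
    obtain ⟨N, hN⟩ := hb
    refine ⟨max M N, fun y q z hq h => ?_⟩
    rw [add_mul]
    exact add_mem (pathsTo_anti (by omega) (hM y q z hq (h.imp_left (by omega))))
      (pathsTo_anti (by omega) (hN y q z hq (h.imp_left (by omega))))
  | hsmul c a ha =>
    obtain ⟨N, hN⟩ := ha
    refine ⟨N, fun y q z hq h => ?_⟩
    rw [smul_mul_assoc]
    exact Submodule.smul_mem _ _ (hN y q z hq h)
  | hgen g =>
    exact ⟨1, fun y q z hq h => gen_mul_mem_pathsTo h (path_mem_pathsTo hq le_rfl) g⟩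
  | hmul g a ha =>
    obtain ⟨N, hN⟩ := ha
    refine ⟨N + 1, fun y q z hq h => ?_⟩
    rw [mul_assoc, ← Nat.sub_sub]
    exact gen_mul_mem_pathsTo (h.imp_left (by omega)) (hN y q z hq (h.imp_left (by omega))) g

/-- By `exists_mul_edg_notMem` the path can be extended edge by edge while staying outside `K`,
until it is long enough or stuck at a sink. These are the two cases that
`exists_mul_path_mem_pathsTo` covers. -/
theorem exists_mul_path_notMem {K : TwoSidedIdeal (E.LeavittPathAlgebra F)}
    {a : E.LeavittPathAlgebra F} (ha : a ∉ K) (N : ℕ) :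
    ∃ (y : E.Vertex) (q : List E.Edge) (z : E.Vertex), E.IsPath y q z ∧
      (N ≤ q.length ∨ ¬ ∃ e, E.s e = z) ∧ a * path F y q ∉ K := by
  induction N with
  | zero =>
    obtain ⟨x, hx⟩ := exists_mul_vtx_notMem ha
    exact ⟨x, [], x, rfl, .inl le_rfl, hx⟩
  | succ N ih =>
    obtain ⟨y, q, z, hq, h, hn⟩ := ih
    by_cases hz : ∃ e, E.s e = z
    · rw [← path_mul_vtx hq, ← mul_assoc] at hn
      obtain ⟨e, rfl, he⟩ := exists_mul_edg_notMem hz hn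
      refine ⟨y, q ++ [e], E.r e, hq.append (isPath_singleton e), .inl ?_, ?_⟩
      · rw [List.length_append, List.length_singleton]
        have := h.resolve_right (not_not.2 hz)
        omega
      · rwa [path_append hq (isPath_singleton e), path_singleton, ← mul_assoc]
    · exact ⟨y, q, z, hq, .inr hz, hn⟩

variable (F) in
/-- The span of the paths from `x` to `z` with lengths between `m` and `D`. -/
noncomputable def pathsBetween (x z : E.Vertex) (m D : ℕ) :
    Submodule F (E.LeavittPathAlgebra F) :=
  Submodule.span F {a | ∃ p, E.IsPath x p z ∧ m ≤ p.length ∧ p.length ≤ D ∧ a = path F x p}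

theorem exists_vtx_mul_mem_pathsBetween {m : ℕ} {b : E.LeavittPathAlgebra F}
    (hb : b ∈ pathsTo F z m) : ∃ D₀, ∀ D, D₀ ≤ D → ∀ x, vtx F E x * b ∈ pathsBetween F x z 0 D := by
  induction hb using Submodule.span_induction with
  | zero => exact ⟨0, by simp⟩
  | add a b _ _ ha hb =>
    obtain ⟨M, hM⟩ := ha
    obtain ⟨N, hN⟩ := hb
    refine ⟨max M N, fun D hD x => ?_⟩
    rw [mul_add]
    exact add_mem (hM D (by omega) x) (hN D (by omega) x)
  | smul c a _ ha =>
    obtain ⟨N, hN⟩ := ha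
    refine ⟨N, fun D hD x => ?_⟩
    rw [mul_smul_comm]
    exact Submodule.smul_mem _ _ (hN D hD x)
  | mem a ha =>
    obtain ⟨y, p, hp, hl, rfl⟩ := ha
    refine ⟨p.length, fun D hD x => ?_⟩
    by_cases hxy : x = y
    · subst hxy
      rw [vtx_mul_path hp]
      exact Submodule.subset_span ⟨p, hp, Nat.zero_le _, hD, rfl⟩
    · rw [vtx_mul_path_of_ne hp hxy]
      exact zero_mem _

theorem mem_pathsBetween_zero {D : ℕ} {b : E.LeavittPathAlgebra F}
    (hb : b ∈ pathsBetween F x z 0 D) :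
    ∃ (k : F) (t : E.LeavittPathAlgebra F), t ∈ pathsBetween F x z 1 D ∧ b = k • vtx F E z + t ∧
      (k ≠ 0 → x = z) := by
  induction hb using Submodule.span_induction with
  | zero => exact ⟨0, 0, zero_mem _, by simp, by simp⟩
  | add a b _ _ ha hb =>
    obtain ⟨k, t, ht, rfl, hk⟩ := ha
    obtain ⟨l, s, hs, rfl, hl⟩ := hb
    refine ⟨k + l, t + s, add_mem ht hs, by rw [add_smul]; abel, fun h => ?_⟩
    by_contra hx
    exact h (by rw [not_not.1 (mt hk hx), not_not.1 (mt hl hx), add_zero])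
  | smul c a _ ha =>
    obtain ⟨k, t, ht, rfl, hk⟩ := ha
    exact ⟨c * k, c • t, Submodule.smul_mem _ _ ht, by rw [smul_add, mul_smul],
      fun h => hk (right_ne_zero_of_mul h)⟩
  | mem a ha =>
    obtain ⟨p, hp, _, hl, rfl⟩ := ha
    cases p with
    | nil =>
      obtain rfl : x = z := hp
      exact ⟨1, 0, zero_mem _, by simp, fun _ => rfl⟩
    | cons e p =>
      exact ⟨0, _, Submodule.subset_span ⟨_, hp, by simp, hl, rfl⟩, by simp, by simp⟩

theorem gho_mul_mem_pathsBetween {D : ℕ} {b : E.LeavittPathAlgebra F} (e : E.Edge)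
    (hb : b ∈ pathsBetween F (E.s e) z 1 (D + 1)) :
    gho F E e * b ∈ pathsBetween F (E.r e) z 0 D := by
  induction hb using Submodule.span_induction with
  | zero => simp
  | add a b _ _ ha hb => rw [mul_add]; exact add_mem ha hb
  | smul c a _ ha => rw [mul_smul_comm]; exact Submodule.smul_mem _ _ ha
  | mem a ha =>
    obtain ⟨p, hp, hl, hD, rfl⟩ := ha
    cases p with
    | nil => simp at hl
    | cons f p =>
      rw [path_cons, ← mul_assoc]
      by_cases hef : e = f
      · subst hef
        rw [gho_mul_edg, vtx_mul_path hp.2]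
        exact Submodule.subset_span ⟨p, hp.2, Nat.zero_le _, by simpa using hD, rfl⟩
      · rw [gho_mul_edg_of_ne hef, zero_mul]
        exact zero_mem _

theorem eq_zero_of_mem_pathsBetween {m D : ℕ} {b : E.LeavittPathAlgebra F}
    (hb : b ∈ pathsBetween F x z m D)
    (h : ∀ p, E.IsPath x p z → m ≤ p.length → D < p.length) : b = 0 := by
  have : pathsBetween F x z m D = ⊥ := by
    rw [pathsBetween, Submodule.span_eq_bot]
    rintro _ ⟨p, hp, h₁, h₂, -⟩
    exact absurd h₂ (h p hp h₁).not_ge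
  rwa [this, Submodule.mem_bot] at hb

/-- Multiplication by ghost edges produces a nonzero constant term. -/
theorem exists_mul_eq_smul_vtx_add {K : TwoSidedIdeal (E.LeavittPathAlgebra F)} {D : ℕ}
    {b : E.LeavittPathAlgebra F} (hb : b ∈ pathsBetween F x z 0 D) (hK : b ∉ K) :
    ∃ (l : E.LeavittPathAlgebra F) (k : F) (D' : ℕ), ∃ t ∈ pathsBetween F z z 1 D',
      l * b = k • vtx F E z + t ∧ k ≠ 0 ∧ l * b ∉ K := by
  induction D generalizing x b with
  | zero =>
    obtain ⟨k, t, ht, rfl, hk⟩ := mem_pathsBetween_zero hb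
    have ht0 : t = 0 := eq_zero_of_mem_pathsBetween ht fun _ _ h => h
    subst ht0
    have : vtx F E z * (k • vtx F E z + 0) = k • vtx F E z + 0 := by
      rw [add_zero, mul_smul_comm, vtx_mul_self]
    refine ⟨vtx F E z, k, 0, 0, zero_mem _, this, ?_, this.symm ▸ hK⟩
    rintro rfl
    exact hK (by simp)
  | succ D ih =>
    obtain ⟨k, t, ht, hbt, hk⟩ := mem_pathsBetween_zero hb
    have hxb : vtx F E x * b = b := by
      refine Submodule.span_induction (p := fun b _ => vtx F E x * b = b) ?_ (by simp) ?_ ?_ hb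
      · rintro _ ⟨p, hp, _, _, rfl⟩
        exact vtx_mul_path hp
      · intro a b _ _ ha hb
        rw [mul_add, ha, hb]
      · intro c a _ ha
        rw [mul_smul_comm, ha]
    -- With zero constant term only paths of positive length remain. Some ghost edge then strips
    -- their first edges while staying outside `K`, and the length bound drops. Otherwise the
    -- constant term forces `x = z`.
    by_cases hk0 : k = 0
    · subst hk0
      rw [zero_smul, zero_add] at hbt
      subst hbt
      have hx : ∃ e, E.s e = x := by
        by_contra! h
        refine hK ?_
        rw [eq_zero_of_mem_pathsBetween ht]
        · exact K.zero_mem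
        · intro p hp h1
          cases p with
          | nil => simp at h1
          | cons e p => exact absurd hp.1 (h e)
      rw [← hxb] at hK
      obtain ⟨e, rfl, he⟩ := exists_gho_mul_notMem hx hK
      obtain ⟨l, k', D', t', ht', h₁, h₂, h₃⟩ := ih (gho_mul_mem_pathsBetween e ht) he
      exact ⟨l * gho F E e, k', D', t', ht', by rw [mul_assoc, h₁], h₂, by rwa [mul_assoc]⟩
    · obtain rfl := hk hk0
      exact ⟨vtx F E x, k, D + 1, t, ht, by rw [hxb, hbt], hk0, by rwa [hxb]⟩

/-! #### The reduction theorem -/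

/-- The vertices in an ideal form a hereditary saturated set. -/
def vertexSet (K : TwoSidedIdeal (E.LeavittPathAlgebra F)) : E.HSet :=
  ⟨{x | vtx F E x ∈ K}, by
    refine ⟨fun e he => ?_, fun x hx h => ?_⟩
    · change vtx F E _ ∈ K at he ⊢
      rw [← gho_mul_edg, ← vtx_mul_edg]
      exact K.mul_mem_left _ _ (K.mul_mem_right _ _ he)
    · change vtx F E x ∈ K
      rw [← sum_edg_mul_gho hx]
      refine sum_mem fun e he => ?_
      rw [← edg_mul_vtx]
      exact K.mul_mem_right _ _ (K.mul_mem_left _ _ (h e ((E.mem_out x e).1 he)))⟩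

theorem mem_vertexSet {K : TwoSidedIdeal (E.LeavittPathAlgebra F)} {x : E.Vertex} :
    x ∈ (vertexSet K).1 ↔ vtx F E x ∈ K := Iff.rfl

end Paths

section Reduction

open Polynomial

variable {F : Type w} [Field F] {E : DirectedGraph.{u, v}} [E.RowFinite] {H : E.HSet}

variable (F) in
/-- Evaluation of polynomials at a cycle of a quotient graph, in the Leavitt path algebra of the
graph. -/
noncomputable def evq (c : (E.quot H).BasedCycle) : F[X] →ₗ[F] E.LeavittPathAlgebra F :=
  ev F (quotV c.base) (c.edges.map quotE)

theorem path_seg_mul_len (c : (E.quot H).BasedCycle) (j : ℕ) :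
    path F (quotV c.base) ((c.seg 0 (j * c.len)).map quotE) =
      cpow F (quotV c.base) (c.edges.map quotE) j := by
  induction j with
  | zero => rw [zero_mul, c.seg_zero]; rfl
  | succ j ih =>
    have h := c.isPath_seg 0 (j * c.len)
    rw [c.s_nth_zero] at h
    rw [Nat.succ_mul, add_comm, c.seg_add, c.seg_zero_len, c.seg_add_len, List.map_append,
      path_append (isPath_seg_quot c) (isPath_quot h), ih]
    rfl

/-- A closed path at the base of a cycle without exits runs around it a whole number of times, so it
is a power of the cycle. -/
theorem pathsBetween_le_range_evq (c : (E.quot H).BasedCycle) (hc : c.NoExit) (m D : ℕ) :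
    pathsBetween F (quotV c.base) (quotV c.base) m D ≤ LinearMap.range (evq F c) := by
  refine Submodule.span_le.2 ?_
  rintro _ ⟨p, hp, -, -, rfl⟩
  obtain ⟨q, rfl, hq⟩ := hp.exists_quot'
  rw [← c.s_nth_zero] at hq
  obtain ⟨h₁, h₂⟩ := hc.eq_seg hq
  have hdvd : c.len ∣ q.length := by
    have := c.mod_eq_of_s_nth_eq h₂
    rw [zero_add, Nat.zero_mod] at this
    exact Nat.dvd_of_mod_eq_zero this.symm
  obtain ⟨j, hj⟩ := hdvd
  refine ⟨X ^ j, ?_⟩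
  rw [evq, ev_X_pow, ← path_seg_mul_len, mul_comm, ← hj, ← h₁]

/-- If a cycle has an exit, then some path is orthogonal to its translates by the closed paths of
bounded length. -/
theorem exists_adj_path_mul_eq_zero (c : (E.quot H).BasedCycle) (hc : ¬ c.NoExit) (D : ℕ) :
    ∃ (q : List (E.quot H).Edge) (y : (E.quot H).Vertex), (E.quot H).IsPath c.base q y ∧
      ∀ t ∈ pathsBetween F (quotV c.base) (quotV c.base) 1 D,
        adj (path F (quotV c.base) (q.map quotE)) * t * path F (quotV c.base) (q.map quotE) = 0 := by
  obtain ⟨e, he, f, hs, hfe⟩ := not_not.1 hc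
  obtain ⟨i, _, rfl⟩ := c.exists_nth_eq he
  -- The path goes around the cycle `D` extra times before it takes the exit, so that no closed path
  -- of length at most `D` outruns its part on the cycle.
  have hm : D ≤ i + D * c.len := by
    have := Nat.le_mul_of_pos_right D c.len_pos
    omega
  have hme : c.nth (i + D * c.len) = c.nth i := by
    rw [← c.nth_mod (i + _), Nat.add_mul_mod_self_right, c.nth_mod]
  generalize i + D * c.len = m at hm hme
  rw [← hme] at hs hfe
  have hη : (E.quot H).IsPath c.base (c.seg 0 m ++ [f]) ((E.quot H).r f) := by
    have h := c.isPath_seg 0 m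
    rw [c.s_nth_zero, zero_add] at h
    exact h.append ⟨hs, rfl⟩
  refine ⟨_, _, hη, fun t ht => ?_⟩
  have hη' := isPath_quot hη
  induction ht using Submodule.span_induction with
  | zero => simp
  | add a b _ _ ha hb => rw [mul_add, add_mul, ha, hb, add_zero]
  | smul k a _ ha => rw [mul_smul_comm, smul_mul_assoc, ha, smul_zero]
  | mem a ha =>
    obtain ⟨p, hp, hl, hD, rfl⟩ := ha
    obtain ⟨p, rfl, hp'⟩ := hp.exists_quot'
    rw [mul_assoc, ← path_append hp hη']
    by_contra hne
    -- If the product is nonzero, `c.seg 0 m ++ [f]` is a prefix of its translate by `p`. As `p` has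
    -- length at most `m`, it runs along the cycle, and being closed its length is a multiple of
    -- `c.len`. Position `m` then reads `f = c.nth (m - p.length) = c.nth m`, which the exit `f` is
    -- not.
    have hpre := prefix_of_adj_path_mul_path_ne_zero hη' (hp.append hη') hne
    rw [← List.map_append] at hpre
    simp only [List.length_map] at hl hD
    have hpre' : c.seg 0 m ++ [f] <+: p ++ (c.seg 0 m ++ [f]) := by
      rcases hpre with h | h
      · exact (List.prefix_map_iff_of_injective quotE_injective).1 h
      · have := h.length_le
        simp only [List.length_map, List.length_append] at this
        omega
    have hget := fun (j : ℕ) (hj : j < (c.seg 0 m ++ [f]).length) => hpre'.getElem hj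
    have hp₂ : p = c.seg 0 p.length := by
      refine List.ext_getElem (by simp) fun j h₁ h₂ => ?_
      have := hget j (by simp; omega)
      rw [List.getElem_append_left h₁, List.getElem_append_left (by simp; omega)] at this
      rw [← this, c.getElem_seg, c.getElem_seg]
    have hdvd : p.length % c.len = 0 := by
      rw [hp₂] at hp'
      have h := c.isPath_seg 0 p.length
      rw [c.s_nth_zero, zero_add] at h
      have := h.target_unique hp'
      rw [← c.s_nth_zero] at this
      simpa using c.mod_eq_of_s_nth_eq this
    have h₁ := hget m (by simp)
    rw [List.getElem_append_right (by simp), List.getElem_append_right (by omega),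
      List.getElem_append_left (by simp; omega), c.getElem_seg] at h₁
    simp only [BasedCycle.length_seg, List.getElem_singleton, zero_add] at h₁
    refine hfe (h₁.trans ?_)
    rw [← c.nth_mod, ← c.nth_mod m]
    congr 1
    conv_rhs => rw [← Nat.sub_add_cancel (hD.trans hm), Nat.add_mod, hdvd, add_zero, Nat.mod_mod]

/-- The reduction theorem: an element outside an ideal can be multiplied by a path from the right
and an element from the left to give a vertex, or a polynomial in a cycle without exits of the
quotient graph, outside the ideal. -/
theorem exists_mul_mul_path (K : TwoSidedIdeal (E.LeavittPathAlgebra F))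
    {a : E.LeavittPathAlgebra F} (ha : a ∉ K) :
    ∃ (l : E.LeavittPathAlgebra F) (y z : E.Vertex) (q : List E.Edge), E.IsPath y q z ∧
      l * (a * path F y q) ∉ K ∧ (l * (a * path F y q) = vtx F E z ∨
        ∃ (c : (E.quot (vertexSet K)).BasedCycle) (f : F[X]), c.NoExit ∧ quotV c.base = z ∧
          l * (a * path F y q) = evq F c f) := by
  obtain ⟨N, hN⟩ := exists_mul_path_mem_pathsTo a
  obtain ⟨y, q, z, hq, h, hn⟩ := exists_mul_path_notMem ha N
  have hb := hN y q z hq h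
  obtain ⟨x, hx⟩ := exists_vtx_mul_notMem hn
  obtain ⟨D, hD⟩ := exists_vtx_mul_mem_pathsBetween hb
  obtain ⟨l, k, D, t, ht, h₁, hk, h₂⟩ := exists_mul_eq_smul_vtx_add (hD D le_rfl x) hx
  rw [← mul_assoc] at h₁ h₂
  generalize l * vtx F E x = l at h₁ h₂
  have hz : vtx F E z ∉ K := by
    intro hz
    refine h₂ ?_
    rw [← path_mul_vtx hq, ← mul_assoc, ← mul_assoc]
    exact K.mul_mem_left _ _ hz
  have hvtx : k • vtx F E z ∉ K := fun hk' => hz <| by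
    have := smul_mem_ideal k⁻¹ hk'
    rwa [smul_smul, inv_mul_cancel₀ hk, one_smul] at this
  obtain ⟨z, rfl⟩ := exists_quotV (H := vertexSet K) hz
  -- What is left is `k • z` plus closed paths of positive length at `z`. If there are none, it is a
  -- multiple of the vertex. If `z` lies on a cycle without exits in the quotient graph, it is a
  -- polynomial in that cycle. If the cycle has an exit, compression by a path through the exit
  -- kills all but the constant term.
  by_cases hcl : ∃ p, E.IsPath (quotV z) p (quotV z) ∧ 1 ≤ p.length
  · obtain ⟨p, hp, hpl⟩ := hcl
    obtain ⟨p, rfl, hp'⟩ := hp.exists_quot'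
    obtain ⟨c, rfl⟩ := IsClosedPath.exists_basedCycle (E := E.quot (vertexSet K)) (x := z) (p := p)
      ⟨by rintro rfl; simp at hpl, hp'⟩
    by_cases hc : c.NoExit
    · refine ⟨l, y, _, q, hq, h₂, .inr ⟨c, ?_⟩⟩
      obtain ⟨f, hf⟩ := pathsBetween_le_range_evq c hc _ _ ht
      exact ⟨C k + f, hc, rfl, by rw [h₁, map_add, hf, evq, ev_C]⟩
    · obtain ⟨η, w, hη, h0⟩ := exists_adj_path_mul_eq_zero (F := F) c hc D
      have hη' := isPath_quot hη
      have key : (k⁻¹ • (adj (path F (quotV c.base) (η.map quotE)) * l)) *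
          (a * path F y (q ++ η.map quotE)) = vtx F E (quotV w) := by
        rw [path_append hq hη', smul_mul_assoc, mul_assoc, ← mul_assoc a, ← mul_assoc l, h₁,
          ← mul_assoc, mul_add, add_mul, h0 t ht, add_zero, mul_smul_comm, smul_mul_assoc,
          adj_path_mul_vtx hη', adj_path_mul_path hη', smul_smul, inv_mul_cancel₀ hk, one_smul]
      exact ⟨_, y, _, _, hq.append hη', key ▸ quotV_notMem w, .inl key⟩
  · have ht0 : t = 0 := eq_zero_of_mem_pathsBetween ht fun p hp h => absurd ⟨p, hp, h⟩ hcl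
    rw [ht0, add_zero] at h₁
    refine ⟨k⁻¹ • l, y, _, q, hq, ?_⟩
    rw [smul_mul_assoc, h₁, smul_smul, inv_mul_cancel₀ hk, one_smul]
    exact ⟨hz, .inl rfl⟩

end Reduction

end LeavittPathAlgebra

end DirectedGraph

namespace DirectedGraph

/-! ### Boundary paths -/

section Boundary

variable (G : DirectedGraph.{u, v})

/-- Sequences of edges and vertices. An infinite path is a sequence of edges; a path to a sink
`z` is followed by the constant sequence `z`. -/
abbrev Seq := ℕ → G.Edge ⊕ G.Vertex

variable {G}

/-- The source of a step of a sequence. -/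
def stepS : G.Edge ⊕ G.Vertex → G.Vertex := Sum.elim G.s id

/-- The range of a step of a sequence. -/
def stepR : G.Edge ⊕ G.Vertex → G.Vertex := Sum.elim G.r id

/-- The boundary paths: the infinite paths and the paths to sinks. -/
def IsBoundary (ξ : G.Seq) : Prop :=
  (∀ n, stepR (ξ n) = stepS (ξ (n + 1))) ∧ ∀ n x, ξ n = .inr x → ¬ ∃ e, G.s e = x

/-- The sequence without its first step. -/
def Seq.tl (ξ : G.Seq) : G.Seq := fun n => ξ (n + 1)

/-- The sequence with an edge added in front. -/
def Seq.cons (e : G.Edge) (ξ : G.Seq) : G.Seq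
  | 0 => .inl e
  | n + 1 => ξ n

theorem Seq.cons_tl {ξ : G.Seq} {e : G.Edge} (h : ξ 0 = .inl e) : Seq.cons e ξ.tl = ξ := by
  funext n
  cases n with
  | zero => exact h.symm
  | succ n => rfl

theorem IsBoundary.tl {ξ : G.Seq} (h : IsBoundary ξ) : IsBoundary ξ.tl :=
  ⟨fun n => h.1 (n + 1), fun n => h.2 (n + 1)⟩

theorem IsBoundary.cons {ξ : G.Seq} (h : IsBoundary ξ) {e : G.Edge}
    (he : G.r e = stepS (ξ 0)) : IsBoundary (Seq.cons e ξ) := by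
  refine ⟨fun n => ?_, fun n x hx => ?_⟩
  · cases n with
    | zero => exact he
    | succ n => exact h.1 n
  · cases n with
    | zero => cases hx
    | succ n => exact h.2 n x hx

open Classical in
/-- The first step of a boundary path starting at a vertex. -/
noncomputable def firstStep (x : G.Vertex) : G.Edge ⊕ G.Vertex :=
  if h : ∃ e, G.s e = x then .inl h.choose else .inr x

theorem stepS_firstStep (x : G.Vertex) : stepS (firstStep x) = x := by
  unfold firstStep
  split_ifs with h
  · exact h.choose_spec
  · rfl

/-- Keep choosing an outgoing edge; at a sink the sequence becomes constant. -/
theorem exists_isBoundary (x : G.Vertex) : ∃ ξ : G.Seq, IsBoundary ξ ∧ stepS (ξ 0) = x := by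
  let ξ : G.Seq := fun n => Nat.rec (firstStep x) (fun _ a => firstStep (stepR a)) n
  have hξ : ∀ n, ∃ y, ξ n = firstStep y := fun n => by
    cases n with
    | zero => exact ⟨x, rfl⟩
    | succ n => exact ⟨stepR (ξ n), rfl⟩
  refine ⟨ξ, ⟨fun n => (stepS_firstStep _).symm, fun n y hy => ?_⟩, stepS_firstStep x⟩
  obtain ⟨z, hz⟩ := hξ n
  rw [hz, firstStep] at hy
  split_ifs at hy with h
  cases hy
  exact h

variable (G) in
/-- A set of boundary paths closed under adding and removing first edges. -/
structure BoundarySet where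
  carrier : Set G.Seq
  isBoundary : ∀ ξ ∈ carrier, IsBoundary ξ
  tl_mem : ∀ ξ ∈ carrier, Seq.tl ξ ∈ carrier
  cons_mem : ∀ ξ ∈ carrier, ∀ e, G.r e = stepS (ξ 0) → Seq.cons e ξ ∈ carrier

/-- The infinite path running around a cycle, starting with its `i`-th edge. -/
def BasedCycle.seq (c : G.BasedCycle) (i : ℕ) : G.Seq := fun k => .inl (c.nth (i + k))

theorem BasedCycle.tl_seq (c : G.BasedCycle) (i : ℕ) : (c.seq i).tl = c.seq (i + 1) := by
  funext k
  simp only [Seq.tl, seq]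
  rw [add_right_comm, add_assoc]

theorem BasedCycle.isBoundary_seq (c : G.BasedCycle) (i : ℕ) : IsBoundary (c.seq i) :=
  ⟨fun n => c.r_nth (i + n), fun n x h => by cases h⟩

theorem BasedCycle.NoExit.eq_seq {c : G.BasedCycle} (hc : c.NoExit) {ξ : G.Seq} {i : ℕ}
    (h : IsBoundary ξ) (hi : stepS (ξ 0) = G.s (c.nth i)) : ξ = c.seq i := by
  have step : ∀ k, stepS (ξ k) = G.s (c.nth (i + k)) → ξ k = .inl (c.nth (i + k)) := by
    intro k hk
    rcases hξ : ξ k with e | y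
    · rw [hξ] at hk
      rw [hc.eq_nth hk]
    · rw [hξ] at hk
      exact absurd ⟨_, hk.symm⟩ (h.2 k y hξ)
  funext k
  induction k with
  | zero => exact step 0 hi
  | succ k ih =>
    refine step (k + 1) ?_
    rw [← h.1, ih, ← add_assoc, ← c.r_nth]
    rfl

/-- The boundary paths that end in the given cycle. -/
def BasedCycle.EndsIn (c : G.BasedCycle) (ξ : G.Seq) : Prop :=
  ∃ i m, ∀ k, ξ (k + i) = .inl (c.nth (m + k))

theorem BasedCycle.EndsIn.tl {c : G.BasedCycle} {ξ : G.Seq} (h : c.EndsIn ξ) :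
    c.EndsIn ξ.tl := by
  obtain ⟨i, m, h⟩ := h
  refine ⟨i, m + 1, fun k => ?_⟩
  have := h (k + 1)
  rw [add_right_comm] at this
  rw [add_assoc, add_comm 1 k]
  exact this

theorem BasedCycle.endsIn_of_tl {c : G.BasedCycle} {ξ : G.Seq} (h : c.EndsIn ξ.tl) :
    c.EndsIn ξ := by
  obtain ⟨i, m, h⟩ := h
  exact ⟨i + 1, m, h⟩

theorem BasedCycle.endsIn_seq (c : G.BasedCycle) (i : ℕ) : c.EndsIn (c.seq i) :=
  ⟨0, i, fun _ => rfl⟩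

/-- The boundary paths that end in the given cycle. -/
def BasedCycle.boundarySet (c : G.BasedCycle) : G.BoundarySet where
  carrier := {ξ | IsBoundary ξ ∧ c.EndsIn ξ}
  isBoundary _ h := h.1
  tl_mem _ h := ⟨h.1.tl, h.2.tl⟩
  cons_mem ξ h e he := ⟨h.1.cons he, BasedCycle.endsIn_of_tl (ξ := Seq.cons e ξ) h.2⟩

variable (G) in
/-- The boundary paths that end in no cycle without exits. -/
def acyclicBoundarySet : G.BoundarySet where
  carrier := {ξ | IsBoundary ξ ∧ ∀ c : G.exitlessCycles, ¬ (exitlessCycles.rep c).EndsIn ξ}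
  isBoundary _ h := h.1
  tl_mem _ h := ⟨h.1.tl, fun c hc => h.2 c (BasedCycle.endsIn_of_tl hc)⟩
  cons_mem ξ h _ he := ⟨h.1.cons he, fun c hc => h.2 c (hc.tl : (exitlessCycles.rep c).EndsIn ξ)⟩

end Boundary

namespace LeavittPathAlgebra

/-! ### Weighted representations on boundary paths -/

section Representation

open Classical Polynomial

variable (F : Type w) [Field F] {G : DirectedGraph.{u, v}} [G.RowFinite]
variable (S : G.BoundarySet) {B : Type*} [CommRing B] [Algebra F B] (wt : G.Edge → Bˣ)

/-- The weighted representation on functions on a set of boundary paths. -/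
noncomputable def boundaryFamily : LeavittFamily G (Module.End B (G.Seq → B)) where
  vtx x :=
    { toFun := fun φ ξ => if ξ ∈ S.carrier ∧ stepS (ξ 0) = x then φ ξ else 0
      map_add' := fun φ ψ => by funext ξ; simp only [Pi.add_apply]; split_ifs <;> simp
      map_smul' := fun b φ => by funext ξ; simp }
  edg e :=
    { toFun := fun φ ξ => if ξ ∈ S.carrier ∧ ξ 0 = .inl e then wt e * φ ξ.tl else 0
      map_add' := fun φ ψ => by funext ξ; simp only [Pi.add_apply]; split_ifs <;> simp [mul_add]
      map_smul' := fun b φ => by funext ξ; simp [mul_left_comm] }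
  gho e :=
    { toFun := fun φ ξ =>
        if ξ ∈ S.carrier ∧ stepS (ξ 0) = G.r e then ((wt e)⁻¹ : Bˣ) * φ (ξ.cons e) else 0
      map_add' := fun φ ψ => by funext ξ; simp only [Pi.add_apply]; split_ifs <;> simp [mul_add]
      map_smul' := fun b φ => by funext ξ; simp [mul_left_comm] }
  vtx_mul_self x := by
    ext1 φ; funext ξ
    simp only [Module.End.mul_apply, LinearMap.coe_mk, AddHom.coe_mk]
    split_ifs <;> rfl
  vtx_mul_of_ne x y h := by
    ext1 φ; funext ξ
    simp only [Module.End.mul_apply, LinearMap.coe_mk, AddHom.coe_mk]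
    split_ifs with h₁ h₂
    · exact absurd (h₁.2.symm.trans h₂.2) h
    all_goals rfl
  vtx_mul_edg e := by
    ext1 φ; funext ξ
    simp only [Module.End.mul_apply, LinearMap.coe_mk, AddHom.coe_mk]
    split_ifs with h₁ h₂ h₂
    · rfl
    · rfl
    · exact absurd ⟨h₂.1, by rw [h₂.2]; rfl⟩ h₁
    · rfl
  edg_mul_vtx e := by
    ext1 φ; funext ξ
    simp only [Module.End.mul_apply, LinearMap.coe_mk, AddHom.coe_mk]
    split_ifs with h₁ h₂
    · rfl
    · refine absurd ⟨S.tl_mem ξ h₁.1, ?_⟩ h₂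
      have := (S.isBoundary ξ h₁.1).1 0
      rw [h₁.2] at this
      exact this.symm
    · rfl
  vtx_mul_gho e := by
    ext1 φ; funext ξ
    simp only [Module.End.mul_apply, LinearMap.coe_mk, AddHom.coe_mk]
    split_ifs <;> rfl
  gho_mul_vtx e := by
    ext1 φ; funext ξ
    simp only [Module.End.mul_apply, LinearMap.coe_mk, AddHom.coe_mk]
    split_ifs with h₁ h₂
    · rfl
    · exact absurd ⟨S.cons_mem ξ h₁.1 e h₁.2.symm, rfl⟩ h₂
    · rfl
  gho_mul_edg e := by
    ext1 φ; funext ξ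
    simp only [Module.End.mul_apply, LinearMap.coe_mk, AddHom.coe_mk]
    split_ifs with h₁ h₂
    · rw [Units.inv_mul_cancel_left]
      rfl
    · exact absurd ⟨S.cons_mem ξ h₁.1 e h₁.2.symm, rfl⟩ h₂
    · rfl
  gho_mul_edg_of_ne e f h := by
    ext1 φ; funext ξ
    simp only [Module.End.mul_apply, LinearMap.coe_mk, AddHom.coe_mk]
    split_ifs with h₁ h₂
    · exact absurd (Sum.inl_injective h₂.2) h
    · exact mul_zero _
    · rfl
  sum_edg_mul_gho x hx := by
    ext1 φ; funext ξ
    simp only [LinearMap.sum_apply, Finset.sum_apply, Module.End.mul_apply, LinearMap.coe_mk,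
      AddHom.coe_mk]
    by_cases h : ξ ∈ S.carrier ∧ stepS (ξ 0) = x
    · rw [if_pos h]
      -- Only the first edge of `ξ` contributes to the sum. A vertex in first position would be a
      -- sink, which `x` is not.
      rcases hξ : ξ 0 with f | y
      · have hf : G.s f = x := by rw [← h.2, hξ]; rfl
        rw [Finset.sum_eq_single_of_mem f ((G.mem_out x f).2 hf)]
        · have hr : stepS (ξ.tl 0) = G.r f := by
            have := (S.isBoundary ξ h.1).1 0
            rw [hξ] at this
            exact this.symm
          rw [if_pos ⟨h.1, rfl⟩, if_pos ⟨S.tl_mem ξ h.1, hr⟩, Units.mul_inv_cancel_left,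
            Seq.cons_tl hξ]
        · intro e _ hef
          rw [if_neg]
          rintro ⟨_, h'⟩
          exact hef (Sum.inl_injective h').symm
      · have hy : y = x := by rw [← h.2, hξ]; rfl
        exact absurd (hy ▸ hx) ((S.isBoundary ξ h.1).2 0 y hξ)
    · rw [if_neg h]
      refine Finset.sum_eq_zero fun e he => if_neg fun h' => h ⟨h'.1, ?_⟩
      rw [h'.2]
      exact (G.mem_out x e).1 he

/-- The weighted representation on functions on a set of boundary paths. -/
noncomputable def boundaryRep : G.LeavittPathAlgebra F →ₙₐ[F] Module.End B (G.Seq → B) :=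
  (boundaryFamily S wt).lift F

variable {F S}

theorem boundaryRep_vtx (x : G.Vertex) (φ : G.Seq → B) (ξ : G.Seq) :
    boundaryRep F S wt (vtx F G x) φ ξ = if ξ ∈ S.carrier ∧ stepS (ξ 0) = x then φ ξ else 0 := by
  rw [boundaryRep, LeavittFamily.lift_vtx]
  rfl

theorem boundaryRep_edg (e : G.Edge) (φ : G.Seq → B) (ξ : G.Seq) :
    boundaryRep F S wt (edg F G e) φ ξ =
      if ξ ∈ S.carrier ∧ ξ 0 = .inl e then wt e * φ ξ.tl else 0 := by
  rw [boundaryRep, LeavittFamily.lift_edg]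
  rfl

theorem boundaryRep_vtx_ne_zero [Nontrivial B] {ξ : G.Seq} (hξ : ξ ∈ S.carrier) :
    boundaryRep F S wt (vtx F G (stepS (ξ 0))) ≠ 0 := by
  intro h
  have := congr_fun (LinearMap.congr_fun h fun _ => 1) ξ
  rw [boundaryRep_vtx, if_pos ⟨hξ, rfl⟩] at this
  exact one_ne_zero this

theorem boundaryRep_path_seg (c : G.BasedCycle) (i k : ℕ) (φ : G.Seq → B)
    (hS : ∀ j, c.seq j ∈ S.carrier) :
    boundaryRep F S wt (path F (G.s (c.nth i)) (c.seg i k)) φ (c.seq i) =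
      (∏ j ∈ Finset.range k, (wt (c.nth (i + j)) : B)) * φ (c.seq (i + k)) := by
  induction k generalizing i with
  | zero =>
    rw [c.seg_zero, path_nil, boundaryRep_vtx, if_pos ⟨hS i, rfl⟩]
    simp
  | succ k ih =>
    rw [c.seg_succ, path_cons, map_mul, Module.End.mul_apply, boundaryRep_edg,
      if_pos ⟨hS i, rfl⟩, c.tl_seq, c.r_nth, ih, Finset.prod_range_succ', add_zero]
    simp only [add_assoc, add_comm 1]
    ring

/-- One turn around the cycle returns to the same infinite path and picks up the product of the
weights, so a polynomial in the cycle acts through its value at that product. -/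
theorem boundaryRep_ev (c : G.BasedCycle) (f : F[X]) (φ : G.Seq → B)
    (hS : ∀ j, c.seq j ∈ S.carrier) :
    boundaryRep F S wt (ev F c.base c.edges f) φ (c.seq 0) =
      aeval (∏ j ∈ Finset.range c.len, (wt (c.nth j) : B)) f * φ (c.seq 0) := by
  induction f using Polynomial.induction_on' with
  | add f g hf hg => rw [map_add, map_add, LinearMap.add_apply, Pi.add_apply, hf, hg, map_add,
      add_mul]
  | monomial k a =>
    rw [ev_monomial, map_smul, LinearMap.smul_apply, Pi.smul_apply, aeval_monomial, mul_assoc,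
      ← Algebra.smul_def]
    congr 1
    induction k with
    | zero =>
      rw [cpow, boundaryRep_vtx, if_pos ⟨hS 0, c.s_nth_zero⟩, pow_zero, one_mul]
    | succ k ih =>
      have h := boundaryRep_path_seg (F := F) wt c 0 c.len
        (boundaryRep F S wt (cpow F c.base c.edges k) φ) hS
      have h0 : c.seq (0 + c.len) = c.seq 0 := by
        funext j
        simp only [BasedCycle.seq, add_right_comm, c.nth_add_len]
      rw [c.seg_zero_len, c.s_nth_zero, h0, ih] at h
      rw [cpow, map_mul, Module.End.mul_apply, h, pow_succ']
      simp only [zero_add]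
      ring

/-- The only boundary path that starts at the base of a cycle without exits is the one running
around it. The operator vanishes at every other sequence, so only this one needs checking. -/
theorem boundaryRep_ev_eq_zero {c : G.BasedCycle} (hc : c.NoExit) (f : F[X])
    (h : aeval (∏ j ∈ Finset.range c.len, (wt (c.nth j) : B)) f = 0 ∨ c.seq 0 ∉ S.carrier) :
    boundaryRep F S wt (ev F c.base c.edges f) = 0 := by
  ext1 φ
  funext ξ
  rw [← vtx_mul_ev c.isPath, map_mul, Module.End.mul_apply, boundaryRep_vtx]
  split_ifs with hξ
  · have hξ' : ξ = c.seq 0 :=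
      hc.eq_seq (S.isBoundary ξ hξ.1) (hξ.2.trans c.s_nth_zero.symm)
    subst hξ'
    have hS : ∀ j, c.seq j ∈ S.carrier := by
      intro j
      induction j with
      | zero => exact hξ.1
      | succ j ih => rw [← c.tl_seq]; exact S.tl_mem _ ih
    rw [boundaryRep_ev wt c f φ hS, h.resolve_right (not_not.2 hξ.1), zero_mul]
    rfl
  · rfl

end Representation

/-! #### Ideals without vertices -/

section Existence

open Polynomial Classical

variable (F : Type w) [Field F]

/-- The ideals of `F[X]` that come from proper ideals of `F[X, X⁻¹]`. -/
abbrev SatIdeal := {J : Ideal F[X] // J ≠ ⊤ ∧ ∀ f, X * f ∈ J → f ∈ J}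

variable {F}

/-- The saturation condition makes `X` a non-zero-divisor modulo `J`, so `F[X] ⧸ J` embeds into its
localization at `X`, where `X` becomes a unit. -/
theorem SatIdeal.exists_ring (J : SatIdeal F) :
    ∃ (B : Type w) (_ : CommRing B) (_ : Algebra F B) (_ : Nontrivial B) (x : Bˣ),
      ∀ f : F[X], aeval (x : B) f = 0 ↔ f ∈ J.1 := by
  let A := F[X] ⧸ J.1
  let t : A := Ideal.Quotient.mk J.1 X
  have : Nontrivial A := Ideal.Quotient.nontrivial_iff.2 J.2.1
  have ht : t ∈ nonZeroDivisors A := by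
    rw [mem_nonZeroDivisors_iff_right]
    intro a ha
    obtain ⟨f, rfl⟩ := Ideal.Quotient.mk_surjective a
    rw [← map_mul, Ideal.Quotient.eq_zero_iff_mem, mul_comm] at ha
    exact Ideal.Quotient.eq_zero_iff_mem.2 (J.2.2 f ha)
  have hinj : Function.Injective (algebraMap A (Localization.Away t)) :=
    IsLocalization.injective (M := Submonoid.powers t) _ (Submonoid.powers_le.2 ht)
  have hu : IsUnit (algebraMap A (Localization.Away t) t) :=
    IsLocalization.Away.algebraMap_isUnit t
  refine ⟨Localization.Away t, inferInstance, inferInstance, hinj.nontrivial, hu.unit, fun f => ?_⟩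
  have key : ∀ f : F[X], aeval (hu.unit : Localization.Away t) f =
      algebraMap A (Localization.Away t) (Ideal.Quotient.mk J.1 f) := by
    intro f
    have h : (aeval (hu.unit : Localization.Away t) : F[X] →ₐ[F] _) =
        (IsScalarTower.toAlgHom F A (Localization.Away t)).comp (Ideal.Quotient.mkₐ F J.1) := by
      ext
      simp [t]
      rfl
    rw [h]
    rfl
  rw [key, map_eq_zero_iff _ hinj, Ideal.Quotient.eq_zero_iff_mem]

/-- The trivial ideal. -/
noncomputable def SatIdeal.bot : SatIdeal F :=
  ⟨⊥, bot_ne_top, fun f h => by simpa using h⟩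

variable {G : DirectedGraph.{u, v}} [G.RowFinite]

/-- Ideals without vertices, with prescribed polynomials in the cycles without exits. -/
theorem exists_ideal_of_satIdeal (J : G.exitlessCycles → SatIdeal F) :
    ∃ K : TwoSidedIdeal (G.LeavittPathAlgebra F), (∀ x, vtx F G x ∉ K) ∧
      ∀ (c : G.exitlessCycles) (f : F[X]),
        ev F (exitlessCycles.rep c).base (exitlessCycles.rep c).edges f ∈ K ↔ f ∈ (J c).1 := by
  choose B hB hA hN x hx using fun c => (J c).exists_ring
  let rep := fun c : G.exitlessCycles => exitlessCycles.rep c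
  -- The whole weight sits on a single edge, which makes the product around the cycle equal to `x
  -- c`.
  let wt : ∀ c, G.Edge → (B c)ˣ := fun c e => if e = (rep c).nth 0 then x c else 1
  have hwt : ∀ c, ∏ j ∈ Finset.range (rep c).len, (wt c ((rep c).nth j) : B c) = x c := by
    intro c
    rw [Finset.prod_eq_single_of_mem 0 (Finset.mem_range.2 (rep c).len_pos)]
    · simp [wt]
    · intro j hj hj0
      simp only [wt]
      rw [if_neg, Units.val_one]
      intro h
      have := (rep c).mod_eq_of_s_nth_eq (congr_arg G.s h)
      rw [Nat.mod_eq_of_lt (Finset.mem_range.1 hj), Nat.zero_mod] at this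
      exact hj0 this
  -- Each vertex starts a boundary path, and this either ends in some cycle without exits or lies in
  -- the remaining boundary set. So the intersection of all these kernels contains no vertex. `K₀`
  -- imposes nothing on polynomials in cycles without exits, which act there as zero.
  let K₀ : TwoSidedIdeal (G.LeavittPathAlgebra F) :=
    TwoSidedIdeal.ker (boundaryRep F G.acyclicBoundarySet (fun _ => (1 : Fˣ)))
  let K₁ : G.exitlessCycles → TwoSidedIdeal (G.LeavittPathAlgebra F) := fun c =>
    TwoSidedIdeal.ker (boundaryRep F (rep c).boundarySet (wt c))
  refine ⟨K₀ ⊓ ⨅ c, K₁ c, fun y hy => ?_, fun c f => ?_⟩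
  · rw [TwoSidedIdeal.mem_inf, TwoSidedIdeal.mem_iInf] at hy
    obtain ⟨ξ, hξ, rfl⟩ := exists_isBoundary y
    by_cases h : ∃ c, (rep c).EndsIn ξ
    · obtain ⟨c, hc⟩ := h
      have := hN c
      exact boundaryRep_vtx_ne_zero (F := F) (S := (rep c).boundarySet) (wt c) ⟨hξ, hc⟩
        ((TwoSidedIdeal.mem_ker _).1 (hy.2 c))
    · push Not at h
      exact boundaryRep_vtx_ne_zero (F := F) (S := G.acyclicBoundarySet) _ ⟨hξ, h⟩
        ((TwoSidedIdeal.mem_ker _).1 hy.1)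
  · have hc : (rep c).NoExit := exitlessCycles.rep_noExit c
    rw [TwoSidedIdeal.mem_inf, TwoSidedIdeal.mem_iInf]
    constructor
    · intro h
      have h0 := (TwoSidedIdeal.mem_ker _).1 (h.2 c)
      have := boundaryRep_ev (F := F) (S := (rep c).boundarySet) (wt c) (rep c) f (fun _ => 1)
        fun j => ⟨(rep c).isBoundary_seq j, (rep c).endsIn_seq j⟩
      rw [h0, hwt, mul_one] at this
      exact (hx c f).1 this.symm
    · intro hf
      refine ⟨(TwoSidedIdeal.mem_ker _).2 (boundaryRep_ev_eq_zero _ hc f (.inr ?_)), fun d =>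
        (TwoSidedIdeal.mem_ker _).2 ?_⟩
      · exact fun h => h.2 c ((rep c).endsIn_seq 0)
      · by_cases hcd : c = d
        · subst hcd
          refine boundaryRep_ev_eq_zero _ hc f (.inl ?_)
          rw [hwt]
          exact (hx c f).2 hf
        -- The infinite path around `c` cannot end in `d`: cycles without exits that share a vertex
        -- coincide.
        · refine boundaryRep_ev_eq_zero _ hc f (.inr fun h => hcd ?_)
          obtain ⟨i, m, h⟩ := h.2
          exact exitlessCycles.eq_of_s_nth_eq (congr_arg G.s (Sum.inl_injective (h 0)))

end Existence

end LeavittPathAlgebra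

end DirectedGraph

namespace DirectedGraph

section

variable {E : DirectedGraph.{u, v}} {H : E.HSet}

theorem extend_quotV {M : Type*} [Zero M] (f : (E.quot H).Vertex → M) (x : (E.quot H).Vertex) :
    Function.extend quotV f 0 (quotV x) = f x := quotV_injective.extend_apply _ _ _

theorem extend_quotV_of_mem {M : Type*} [Zero M] (f : (E.quot H).Vertex → M) {x : E.Vertex}
    (hx : x ∈ H.1) : Function.extend quotV f 0 x = 0 :=
  Function.extend_apply' _ _ _ fun ⟨y, hy⟩ => quotV_notMem y (hy ▸ hx)

theorem wordDegree_mul (x y : FreeSemigroup E.LeavittGen) :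
    wordDegree E (x * y) = wordDegree E x + wordDegree E y := by
  simp [wordDegree, FreeSemigroup.head_mul, FreeSemigroup.tail_mul, add_assoc]

end

namespace LeavittPathAlgebra

/-! #### The quotient map -/

section Quotient

open Polynomial

variable (F : Type w) [Field F] {E : DirectedGraph.{u, v}} [E.RowFinite] (H : E.HSet)

/-- The image of a vertex in the Leavitt path algebra of a quotient graph. -/
noncomputable def quotVtx : E.Vertex → (E.quot H).LeavittPathAlgebra F :=
  Function.extend quotV (vtx F (E.quot H)) 0

/-- The image of an edge in the Leavitt path algebra of a quotient graph. -/
noncomputable def quotEdg : E.Edge → (E.quot H).LeavittPathAlgebra F :=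
  Function.extend quotE (edg F (E.quot H)) 0

/-- The image of a ghost edge in the Leavitt path algebra of a quotient graph. -/
noncomputable def quotGho : E.Edge → (E.quot H).LeavittPathAlgebra F :=
  Function.extend quotE (gho F (E.quot H)) 0

variable {H}

theorem quotVtx_quotV (x : (E.quot H).Vertex) : quotVtx F H (quotV x) = vtx F _ x :=
  extend_quotV _ x

theorem quotVtx_of_mem {x : E.Vertex} (hx : x ∈ H.1) : quotVtx F H x = 0 :=
  extend_quotV_of_mem _ hx

theorem quotEdg_quotE (e : (E.quot H).Edge) : quotEdg F H (quotE e) = edg F _ e :=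
  quotE_injective.extend_apply _ _ _

theorem quotEdg_of_mem {e : E.Edge} (he : E.r e ∈ H.1) : quotEdg F H e = 0 :=
  Function.extend_apply' _ _ _ fun ⟨f, hf⟩ => quotV_notMem _ ((r_quotE f).symm ▸ hf ▸ he)

theorem quotGho_quotE (e : (E.quot H).Edge) : quotGho F H (quotE e) = gho F _ e :=
  quotE_injective.extend_apply _ _ _

theorem quotGho_of_mem {e : E.Edge} (he : E.r e ∈ H.1) : quotGho F H e = 0 :=
  Function.extend_apply' _ _ _ fun ⟨f, hf⟩ => quotV_notMem _ ((r_quotE f).symm ▸ hf ▸ he)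

variable (H)

/-- The family defining the quotient map. -/
noncomputable def quotFamily : LeavittFamily E ((E.quot H).LeavittPathAlgebra F) where
  vtx := quotVtx F H
  edg := quotEdg F H
  gho := quotGho F H
  vtx_mul_self x := by
    by_cases hx : x ∈ H.1
    · rw [quotVtx_of_mem F hx, mul_zero]
    · obtain ⟨x, rfl⟩ := exists_quotV hx
      rw [quotVtx_quotV, LeavittPathAlgebra.vtx_mul_self]
  vtx_mul_of_ne x y h := by
    by_cases hx : x ∈ H.1
    · rw [quotVtx_of_mem F hx, zero_mul]
    by_cases hy : y ∈ H.1
    · rw [quotVtx_of_mem F hy, mul_zero]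
    obtain ⟨x, rfl⟩ := exists_quotV hx
    obtain ⟨y, rfl⟩ := exists_quotV hy
    rw [quotVtx_quotV, quotVtx_quotV,
      LeavittPathAlgebra.vtx_mul_of_ne fun h' => h (congr_arg quotV h')]
  vtx_mul_edg e := by
    by_cases he : E.r e ∈ H.1
    · rw [quotEdg_of_mem F he, mul_zero]
    · obtain ⟨e, rfl⟩ := exists_quotE he
      rw [s_quotE, quotVtx_quotV, quotEdg_quotE, LeavittPathAlgebra.vtx_mul_edg]
  edg_mul_vtx e := by
    by_cases he : E.r e ∈ H.1
    · rw [quotEdg_of_mem F he, zero_mul]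
    · obtain ⟨e, rfl⟩ := exists_quotE he
      rw [r_quotE, quotVtx_quotV, quotEdg_quotE, LeavittPathAlgebra.edg_mul_vtx]
  vtx_mul_gho e := by
    by_cases he : E.r e ∈ H.1
    · rw [quotGho_of_mem F he, mul_zero]
    · obtain ⟨e, rfl⟩ := exists_quotE he
      rw [r_quotE, quotVtx_quotV, quotGho_quotE, LeavittPathAlgebra.vtx_mul_gho]
  gho_mul_vtx e := by
    by_cases he : E.r e ∈ H.1
    · rw [quotGho_of_mem F he, zero_mul]
    · obtain ⟨e, rfl⟩ := exists_quotE he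
      rw [s_quotE, quotVtx_quotV, quotGho_quotE, LeavittPathAlgebra.gho_mul_vtx]
  gho_mul_edg e := by
    by_cases he : E.r e ∈ H.1
    · rw [quotGho_of_mem F he, quotVtx_of_mem F he, zero_mul]
    · obtain ⟨e, rfl⟩ := exists_quotE he
      rw [r_quotE, quotVtx_quotV, quotGho_quotE, quotEdg_quotE, LeavittPathAlgebra.gho_mul_edg]
  gho_mul_edg_of_ne e f h := by
    by_cases he : E.r e ∈ H.1
    · rw [quotGho_of_mem F he, zero_mul]
    by_cases hf : E.r f ∈ H.1
    · rw [quotEdg_of_mem F hf, mul_zero]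
    obtain ⟨e, rfl⟩ := exists_quotE he
    obtain ⟨f, rfl⟩ := exists_quotE hf
    rw [quotGho_quotE, quotEdg_quotE,
      LeavittPathAlgebra.gho_mul_edg_of_ne fun h' => h (congr_arg quotE h')]
  sum_edg_mul_gho x hx := by
    by_cases hxH : x ∈ H.1
    · rw [quotVtx_of_mem F hxH]
      refine Finset.sum_eq_zero fun e he => ?_
      rw [quotGho_of_mem F (H.2.1 e ((E.mem_out x e).1 he ▸ hxH)), mul_zero]
    · obtain ⟨x, rfl⟩ := exists_quotV hxH
      rw [sum_out_quot x (fun e => quotEdg F H e * quotGho F H e)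
        fun e _ he => by rw [quotGho_of_mem F he, mul_zero]]
      simp only [quotEdg_quotE, quotGho_quotE]
      rw [quotVtx_quotV, LeavittPathAlgebra.sum_edg_mul_gho (exists_edge_quot hx)]

/-- The quotient map to the Leavitt path algebra of a quotient graph. -/
noncomputable def quotHom : E.LeavittPathAlgebra F →ₙₐ[F] (E.quot H).LeavittPathAlgebra F :=
  (quotFamily F H).lift F

variable {H} {F}

theorem quotHom_vtx (x : (E.quot H).Vertex) : quotHom F H (vtx F E (quotV x)) = vtx F _ x :=
  ((quotFamily F H).lift_vtx _).trans (quotVtx_quotV F x)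

theorem quotHom_vtx_of_mem {x : E.Vertex} (hx : x ∈ H.1) : quotHom F H (vtx F E x) = 0 :=
  ((quotFamily F H).lift_vtx _).trans (quotVtx_of_mem F hx)

theorem quotHom_path (x : (E.quot H).Vertex) (p : List (E.quot H).Edge) :
    quotHom F H (path F (quotV x) (p.map quotE)) = path F x p := by
  induction p generalizing x with
  | nil => exact quotHom_vtx x
  | cons e p ih =>
    rw [List.map_cons, path_cons, map_mul, r_quotE, ih, quotHom, LeavittFamily.lift_edg]
    change quotEdg F H _ * _ = _
    rw [quotEdg_quotE, path_cons]

theorem quotHom_evq (c : (E.quot H).BasedCycle) (f : F[X]) :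
    quotHom F H (evq F c f) = ev F c.base c.edges f := by
  rw [evq]
  induction f using Polynomial.induction_on' with
  | add f g hf hg => rw [map_add, map_add, map_add, hf, hg]
  | monomial k a =>
    rw [ev_monomial, ev_monomial, map_smul]
    congr 1
    induction k with
    | zero => exact quotHom_vtx _
    | succ k ih => rw [cpow, map_mul, ih, quotHom_path, cpow]

end Quotient

/-! #### The grading -/

section Grading

open Polynomial

variable {F : Type w} [Field F] {E : DirectedGraph.{u, v}} [E.RowFinite]

variable (F E) in
/-- The family defining the grading. -/
noncomputable def gradingFamily :
    LeavittFamily E (AddMonoidAlgebra (Unitization F (E.LeavittPathAlgebra F)) ℤ) where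
  vtx x := .single 0 (vtx F E x : Unitization F (E.LeavittPathAlgebra F))
  edg e := .single 1 (edg F E e : Unitization F (E.LeavittPathAlgebra F))
  gho e := .single (-1) (gho F E e : Unitization F (E.LeavittPathAlgebra F))
  vtx_mul_self x := by
    rw [AddMonoidAlgebra.single_mul_single, ← Unitization.inr_mul,
      LeavittPathAlgebra.vtx_mul_self, add_zero]
  vtx_mul_of_ne x y h := by
    rw [AddMonoidAlgebra.single_mul_single, ← Unitization.inr_mul,
      LeavittPathAlgebra.vtx_mul_of_ne h, Unitization.inr_zero, AddMonoidAlgebra.single_zero]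
  vtx_mul_edg e := by
    rw [AddMonoidAlgebra.single_mul_single, ← Unitization.inr_mul,
      LeavittPathAlgebra.vtx_mul_edg, zero_add]
  edg_mul_vtx e := by
    rw [AddMonoidAlgebra.single_mul_single, ← Unitization.inr_mul,
      LeavittPathAlgebra.edg_mul_vtx, add_zero]
  vtx_mul_gho e := by
    rw [AddMonoidAlgebra.single_mul_single, ← Unitization.inr_mul,
      LeavittPathAlgebra.vtx_mul_gho, zero_add]
  gho_mul_vtx e := by
    rw [AddMonoidAlgebra.single_mul_single, ← Unitization.inr_mul,
      LeavittPathAlgebra.gho_mul_vtx, add_zero]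
  gho_mul_edg e := by
    rw [AddMonoidAlgebra.single_mul_single, ← Unitization.inr_mul,
      LeavittPathAlgebra.gho_mul_edg, neg_add_cancel]
  gho_mul_edg_of_ne e f h := by
    rw [AddMonoidAlgebra.single_mul_single, ← Unitization.inr_mul,
      LeavittPathAlgebra.gho_mul_edg_of_ne h, Unitization.inr_zero, AddMonoidAlgebra.single_zero]
  sum_edg_mul_gho x hx := by
    simp_rw [AddMonoidAlgebra.single_mul_single, ← Unitization.inr_mul, add_neg_cancel]
    rw [← LeavittPathAlgebra.sum_edg_mul_gho hx]
    have := map_sum ((AddMonoidAlgebra.singleAddHom (R := Unitization F (E.LeavittPathAlgebra F))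
      (0 : ℤ)).comp (Unitization.inrNonUnitalAlgHom F (E.LeavittPathAlgebra F) : _ →+ _))
      (fun e => edg F E e * gho F E e) (E.out x)
    exact this.symm

variable (F E) in
/-- The homomorphism multiplying an element of degree `n` by `t ^ n`. -/
noncomputable def gradingHom : E.LeavittPathAlgebra F →ₙₐ[F]
    AddMonoidAlgebra (Unitization F (E.LeavittPathAlgebra F)) ℤ :=
  (gradingFamily F E).lift F

/-- `a` is multiplied by `t ^ n`. -/
def HasDegree (n : ℤ) (a : E.LeavittPathAlgebra F) : Prop :=
  gradingHom F E a = .single n (a : Unitization F (E.LeavittPathAlgebra F))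

theorem HasDegree.mul {m n : ℤ} {a b : E.LeavittPathAlgebra F} (ha : HasDegree m a)
    (hb : HasDegree n b) : HasDegree (m + n) (a * b) := by
  unfold HasDegree at *
  rw [map_mul, ha, hb, AddMonoidAlgebra.single_mul_single, Unitization.inr_mul]

theorem HasDegree.add {n : ℤ} {a b : E.LeavittPathAlgebra F} (ha : HasDegree n a)
    (hb : HasDegree n b) : HasDegree n (a + b) := by
  unfold HasDegree at *
  rw [map_add, ha, hb, Unitization.inr_add, AddMonoidAlgebra.single_add]

theorem HasDegree.smul {n : ℤ} {a : E.LeavittPathAlgebra F} (c : F) (ha : HasDegree n a) :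
    HasDegree n (c • a) := by
  unfold HasDegree at *
  rw [map_smul, ha, Unitization.inr_smul, AddMonoidAlgebra.smul_single]

theorem hasDegree_zero (n : ℤ) : HasDegree n (0 : E.LeavittPathAlgebra F) := by
  unfold HasDegree
  rw [map_zero, Unitization.inr_zero, AddMonoidAlgebra.single_zero]

theorem hasDegree_gen (g : E.LeavittGen) : HasDegree g.degree (gen F E g) := by
  cases g with
  | vertex x => exact (gradingFamily F E).lift_vtx x
  | edge e => exact (gradingFamily F E).lift_edg e
  | ghost e => exact (gradingFamily F E).lift_gho e

theorem hasDegree_word (x : FreeSemigroup E.LeavittGen) :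
    HasDegree (wordDegree E x) (mk F E (MonoidAlgebra.single x 1)) := by
  induction x using FreeSemigroup.recOnMul with
  | ih1 g =>
    have := hasDegree_gen (F := F) g
    rw [← mk_freeGen] at this
    simpa [wordDegree, freeGen] using this
  | ih2 g x _ ih =>
    rw [wordDegree_mul, mk_single_of_mul]
    have := (hasDegree_gen (F := F) g).mul ih
    simpa [wordDegree] using this

theorem hasDegree_of_mem {n : ℤ} {a : E.LeavittPathAlgebra F}
    (ha : a ∈ homogeneousComponent F E n) : HasDegree n a := by
  refine Submodule.span_induction (p := fun a _ => HasDegree n a) ?_ (hasDegree_zero n)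
    (fun _ _ _ _ => HasDegree.add) (fun c _ _ => HasDegree.smul c) ha
  rintro _ ⟨x, rfl, rfl⟩
  exact hasDegree_word x

theorem hasDegree_path (x : E.Vertex) (p : List E.Edge) : HasDegree p.length (path F x p) := by
  induction p generalizing x with
  | nil => exact hasDegree_gen (.vertex x)
  | cons e p ih =>
    have := (hasDegree_gen (F := F) (.edge e)).mul (ih (E.r e))
    rw [List.length_cons, Nat.cast_succ, add_comm]
    exact this

theorem hasDegree_cpow (x : E.Vertex) (p : List E.Edge) (k : ℕ) :
    HasDegree (k * p.length) (cpow F x p k) := by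
  induction k with
  | zero => rw [Nat.cast_zero, zero_mul]; exact hasDegree_gen (.vertex x)
  | succ k ih =>
    have := (hasDegree_path (F := F) x p).mul ih
    rwa [← one_add_mul, add_comm, ← Nat.cast_succ] at this

/-- The powers of a nonempty closed path have distinct degrees, so each term of the polynomial can
be read off separately. -/
theorem gradingHom_ev_apply (x : E.Vertex) {p : List E.Edge} (hp : p ≠ []) (f : F[X]) (k : ℕ) :
    (gradingHom F E (ev F x p f)).coeff (k * p.length : ℤ) =
      ((f.coeff k • cpow F x p k : E.LeavittPathAlgebra F) :
        Unitization F (E.LeavittPathAlgebra F)) := by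
  induction f using Polynomial.induction_on' with
  | add f g hf hg => rw [map_add, map_add, coeff_add, add_smul, Unitization.inr_add, ← hf, ← hg]; rfl
  | monomial j a =>
    have h : HasDegree (j * p.length) (ev F x p (monomial j a)) := by
      rw [ev_monomial]
      exact (hasDegree_cpow x p j).smul a
    rw [h, coeff_monomial]
    have hl : (p.length : ℤ) ≠ 0 := by simpa using hp
    by_cases hjk : j = k
    · subst hjk
      rw [if_pos rfl, ev_monomial]
      exact Finsupp.single_eq_same
    · rw [if_neg hjk, zero_smul, Unitization.inr_zero]
      exact Finsupp.single_eq_of_ne fun h => hjk (by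
        have := mul_right_cancel₀ hl h
        exact_mod_cast this.symm)

/-- The coefficient in degree `k * p.length` is computed twice: from a decomposition into
homogeneous elements of `K`, and from the polynomial. -/
theorem IsGraded.smul_cpow_mem {K : TwoSidedIdeal (E.LeavittPathAlgebra F)} (hK : IsGraded K)
    {x : E.Vertex} {p : List E.Edge} (hp : p ≠ []) {f : F[X]} (hf : ev F x p f ∈ K) (k : ℕ) :
    f.coeff k • cpow F x p k ∈ K := by
  obtain ⟨g, hg, hgf⟩ := hK _ hf
  have h₁ : (gradingHom F E (g.sum fun _ b => b)).coeff (k * p.length : ℤ) =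
      (g (k * p.length) : Unitization F (E.LeavittPathAlgebra F)) := by
    have : gradingHom F E (g.sum fun _ b => b) =
        g.sum fun n b => .single n (b : Unitization F (E.LeavittPathAlgebra F)) := by
      rw [Finsupp.sum, map_sum]
      exact Finset.sum_congr rfl fun n _ => hasDegree_of_mem (hg n).2
    rw [this, Finsupp.sum, AddMonoidAlgebra.coeff_sum]
    refine (Finsupp.finsetSum_apply _ _ _).trans ?_
    rw [Finset.sum_eq_single (k * p.length : ℤ)]
    · exact Finsupp.single_eq_same
    · intro n _ hn
      exact Finsupp.single_eq_of_ne hn.symm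
    · intro hn
      rw [Finsupp.notMem_support_iff.1 hn, Unitization.inr_zero]
      exact Finsupp.single_eq_same
  rw [hgf, gradingHom_ev_apply x hp] at h₁
  rw [Unitization.inr_injective h₁]
  exact (hg _).1

/-- A nonzero coefficient would put a power of the closed path into `K`, and cancelling the powers
of `X` would leave the vertex. -/
theorem IsGraded.eq_zero_of_ev_mem {K : TwoSidedIdeal (E.LeavittPathAlgebra F)} (hK : IsGraded K)
    {x : E.Vertex} {p : List E.Edge} (hp : E.IsPath x p x) (hne : p ≠ []) (hx : vtx F E x ∉ K)
    {f : F[X]} (hf : ev F x p f ∈ K) : f = 0 := by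
  ext k
  by_contra hk
  rw [coeff_zero] at hk
  have h := smul_mem_ideal (f.coeff k)⁻¹ (hK.smul_cpow_mem hne hf k)
  rw [smul_smul, inv_mul_cancel₀ hk, one_smul, ← ev_X_pow, ← mem_evIdeal (hp := hp)] at h
  refine hx ?_
  have : (1 : F[X]) ∈ evIdeal K hp := by
    clear hk
    induction k with
    | zero => simpa using h
    | succ k ih =>
      rw [pow_succ'] at h
      exact ih (mem_evIdeal_of_X_mul_mem h)
  rwa [mem_evIdeal, ev_one] at this

/-- The span of the homogeneous elements of an ideal. -/
noncomputable def homogeneousSpan (K : TwoSidedIdeal (E.LeavittPathAlgebra F)) :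
    Submodule F (E.LeavittPathAlgebra F) :=
  Submodule.span F {a | a ∈ K ∧ ∃ n, a ∈ homogeneousComponent F E n}

theorem word_mul_mem {n : ℤ} {a : E.LeavittPathAlgebra F} (x : FreeSemigroup E.LeavittGen)
    (ha : a ∈ homogeneousComponent F E n) :
    mk F E (MonoidAlgebra.single x 1) * a ∈ homogeneousComponent F E (wordDegree E x + n) := by
  refine Submodule.span_induction (p := fun a _ => mk F E (MonoidAlgebra.single x 1) * a ∈
    homogeneousComponent F E (wordDegree E x + n)) ?_ (by simp) ?_ ?_ ha
  · rintro _ ⟨y, rfl, rfl⟩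
    refine Submodule.subset_span ⟨x * y, wordDegree_mul x y, ?_⟩
    rw [← mk_mul, MonoidAlgebra.single_mul_single, one_mul]
  · intro a b _ _ ha hb
    rw [mul_add]
    exact add_mem ha hb
  · intro c a _ ha
    rw [mul_smul_comm]
    exact Submodule.smul_mem _ _ ha

theorem mul_word_mem {n : ℤ} {a : E.LeavittPathAlgebra F} (x : FreeSemigroup E.LeavittGen)
    (ha : a ∈ homogeneousComponent F E n) :
    a * mk F E (MonoidAlgebra.single x 1) ∈ homogeneousComponent F E (n + wordDegree E x) := by
  refine Submodule.span_induction (p := fun a _ => a * mk F E (MonoidAlgebra.single x 1) ∈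
    homogeneousComponent F E (n + wordDegree E x)) ?_ (by simp) ?_ ?_ ha
  · rintro _ ⟨y, rfl, rfl⟩
    refine Submodule.subset_span ⟨y * x, wordDegree_mul y x, ?_⟩
    rw [← mk_mul, MonoidAlgebra.single_mul_single, one_mul]
  · intro a b _ _ ha hb
    rw [add_mul]
    exact add_mem ha hb
  · intro c a _ ha
    rw [smul_mul_assoc]
    exact Submodule.smul_mem _ _ ha

theorem mul_mem_homogeneousSpan {K : TwoSidedIdeal (E.LeavittPathAlgebra F)}
    {a : E.LeavittPathAlgebra F} (b : E.LeavittPathAlgebra F) (ha : a ∈ homogeneousSpan K) :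
    b * a ∈ homogeneousSpan K ∧ a * b ∈ homogeneousSpan K := by
  refine Submodule.span_induction (p := fun a _ => b * a ∈ homogeneousSpan K ∧
    a * b ∈ homogeneousSpan K) ?_ (by simp) ?_ ?_ ha
  · rintro a ⟨haK, n, han⟩
    induction b using span_words_induction with
    | h0 => simp
    | hadd b c hb hc =>
      rw [add_mul, mul_add]
      exact ⟨add_mem hb.1 hc.1, add_mem hb.2 hc.2⟩
    | hsmul c b hb =>
      rw [smul_mul_assoc, mul_smul_comm]
      exact ⟨Submodule.smul_mem _ _ hb.1, Submodule.smul_mem _ _ hb.2⟩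
    | hword x => exact ⟨Submodule.subset_span ⟨K.mul_mem_left _ _ haK, _, word_mul_mem x han⟩,
        Submodule.subset_span ⟨K.mul_mem_right _ _ haK, _, mul_word_mem x han⟩⟩
  · intro x y _ _ hx hy
    rw [add_mul, mul_add]
    exact ⟨add_mem hx.1 hy.1, add_mem hx.2 hy.2⟩
  · intro c x _ hx
    rw [smul_mul_assoc, mul_smul_comm]
    exact ⟨Submodule.smul_mem _ _ hx.1, Submodule.smul_mem _ _ hx.2⟩

/-- The largest graded ideal contained in an ideal. -/
noncomputable def gradedPart (K : TwoSidedIdeal (E.LeavittPathAlgebra F)) :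
    TwoSidedIdeal (E.LeavittPathAlgebra F) :=
  TwoSidedIdeal.mk' (homogeneousSpan K) (zero_mem _) add_mem neg_mem
    (fun h => (mul_mem_homogeneousSpan _ h).1) (fun h => (mul_mem_homogeneousSpan _ h).2)

theorem mem_gradedPart {K : TwoSidedIdeal (E.LeavittPathAlgebra F)} {a : E.LeavittPathAlgebra F} :
    a ∈ gradedPart K ↔ a ∈ homogeneousSpan K := TwoSidedIdeal.mem_mk' _ _ _ _ _ _ _

theorem gradedPart_le (K : TwoSidedIdeal (E.LeavittPathAlgebra F)) : gradedPart K ≤ K := by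
  intro a ha
  refine Submodule.span_induction (p := fun a _ => a ∈ K) (fun _ h => h.1) K.zero_mem
    (fun _ _ _ _ => K.add_mem) (fun c _ _ => smul_mem_ideal c) (mem_gradedPart.1 ha)

theorem isGraded_gradedPart (K : TwoSidedIdeal (E.LeavittPathAlgebra F)) :
    IsGraded (gradedPart K) := by
  intro a ha
  refine Submodule.span_induction (p := fun a _ => ∃ f : ℤ →₀ LeavittPathAlgebra F E,
    (∀ n, f n ∈ gradedPart K ∧ f n ∈ homogeneousComponent F E n) ∧ f.sum (fun _ b => b) = a)
    ?_ ?_ ?_ ?_ (mem_gradedPart.1 ha)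
  · rintro a ⟨haK, n, han⟩
    refine ⟨Finsupp.single n a, fun m => ?_, Finsupp.sum_single_index rfl⟩
    by_cases hmn : m = n
    · subst hmn
      rw [Finsupp.single_eq_same]
      exact ⟨mem_gradedPart.2 (Submodule.subset_span ⟨haK, m, han⟩), han⟩
    · rw [Finsupp.single_eq_of_ne hmn]
      exact ⟨zero_mem _, zero_mem _⟩
  · exact ⟨0, fun n => ⟨zero_mem _, zero_mem _⟩, Finsupp.sum_zero_index⟩
  · rintro a b _ _ ⟨f, hf, rfl⟩ ⟨g, hg, rfl⟩
    exact ⟨f + g, fun n => ⟨add_mem (hf n).1 (hg n).1, add_mem (hf n).2 (hg n).2⟩,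
      Finsupp.sum_add_index' (fun _ => rfl) fun _ _ _ => rfl⟩
  · rintro c a _ ⟨f, hf, rfl⟩
    refine ⟨c • f, fun n => ⟨smul_mem_ideal c (hf n).1, Submodule.smul_mem _ _ (hf n).2⟩, ?_⟩
    rw [Finsupp.sum_smul_index' fun _ => rfl, Finsupp.smul_sum]

theorem vtx_mem_homogeneousComponent (x : E.Vertex) :
    vtx F E x ∈ homogeneousComponent F E 0 :=
  Submodule.subset_span ⟨FreeSemigroup.of (.vertex x), by simp [wordDegree, LeavittGen.degree],
    rfl⟩

/-- Vertices are homogeneous of degree zero, so none is lost in the graded part. -/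
theorem vertexSet_gradedPart (K : TwoSidedIdeal (E.LeavittPathAlgebra F)) :
    vertexSet (gradedPart K) = vertexSet K := by
  refine Subtype.ext (Set.ext fun x => ⟨fun h => gradedPart_le K h, fun h => ?_⟩)
  exact mem_gradedPart.2 (Submodule.subset_span ⟨h, 0, vtx_mem_homogeneousComponent x⟩)

end Grading

/-! #### The classification of the ideals -/

section Classification

open Polynomial

variable {F : Type w} [Field F] {E : DirectedGraph.{u, v}} [E.RowFinite]

/-- An element of `I` outside `K` would reduce to a vertex or to a polynomial in a cycle without
exits. The result is still in `I` and still outside `K`, contrary to the hypotheses. -/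
theorem le_of_evq_mem {I K : TwoSidedIdeal (E.LeavittPathAlgebra F)} {H : E.HSet}
    (hK : vertexSet K = H) (hI : vertexSet I = H)
    (h : ∀ (c : (E.quot H).BasedCycle) (f : F[X]), c.NoExit → evq F c f ∈ I → evq F c f ∈ K) :
    I ≤ K := by
  subst hK
  intro a ha
  by_contra haK
  obtain ⟨l, y, z, q, -, h₁, h₂⟩ := exists_mul_mul_path K haK
  have h₃ : l * (a * path F y q) ∈ I := I.mul_mem_left _ _ (I.mul_mem_right _ _ ha)
  rcases h₂ with h₂ | ⟨c, f, hc, -, h₂⟩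
  · rw [h₂] at h₁ h₃
    rw [← mem_vertexSet, hI] at h₃
    exact h₁ h₃
  · rw [h₂] at h₁ h₃
    exact h₁ (h c f hc h₃)

theorem vertexSet_inf {I K : TwoSidedIdeal (E.LeavittPathAlgebra F)}
    (h : vertexSet I ≤ vertexSet K) : vertexSet (I ⊓ K) = vertexSet I := by
  refine Subtype.ext (Set.ext fun x => ?_)
  rw [mem_vertexSet, TwoSidedIdeal.mem_inf, mem_vertexSet]
  exact ⟨fun hx => hx.1, fun hx => ⟨hx, h hx⟩⟩

/-- The polynomials in the cycles without exits of the quotient graph that lie in an ideal. -/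
noncomputable def cycleIdeals {H : E.HSet}
    (K : {K : TwoSidedIdeal (E.LeavittPathAlgebra F) // vertexSet K = H})
    (c : (E.quot H).exitlessCycles) : SatIdeal F :=
  ⟨evIdeal K.1 (isPath_seg_quot (exitlessCycles.rep c)), by
    rw [Ne, Ideal.eq_top_iff_one, mem_evIdeal, ev_one, ← mem_vertexSet, K.2]
    exact quotV_notMem _, fun _ => mem_evIdeal_of_X_mul_mem⟩

theorem mem_cycleIdeals {H : E.HSet}
    {K : {K : TwoSidedIdeal (E.LeavittPathAlgebra F) // vertexSet K = H}}
    {c : (E.quot H).exitlessCycles} {f : F[X]} :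
    f ∈ (cycleIdeals K c).1 ↔ evq F (exitlessCycles.rep c) f ∈ K.1 := Iff.rfl

/-- Membership is unaffected by rotating the cycle, so it may be tested on the chosen
representative. -/
theorem evq_mem_iff {H : E.HSet}
    (K : {K : TwoSidedIdeal (E.LeavittPathAlgebra F) // vertexSet K = H})
    (c : (E.quot H).BasedCycle) (hc : c.NoExit) (f : F[X]) :
    evq F c f ∈ K.1 ↔ f ∈ (cycleIdeals K (c.toExitless hc)).1 := by
  rw [mem_cycleIdeals]
  have h : c.edges ~r (exitlessCycles.rep (c.toExitless hc)).edges := by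
    rw [← Cycle.coe_eq_coe, exitlessCycles.coe_rep]
    rfl
  have h' := h.map quotE
  have hne : ∀ d : (E.quot H).BasedCycle, d.edges.map quotE ≠ [] := fun d hd =>
    d.ne_nil (List.map_eq_nil_iff.1 hd)
  exact ⟨ev_mem_of_isRotated (isPath_seg_quot c) (isPath_seg_quot _) (hne _) h',
    ev_mem_of_isRotated (isPath_seg_quot _) (isPath_seg_quot c) (hne _) h'.symm⟩

theorem le_of_cycleIdeals_le {H : E.HSet}
    {I K : {K : TwoSidedIdeal (E.LeavittPathAlgebra F) // vertexSet K = H}}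
    (h : ∀ c, (cycleIdeals I c).1 ≤ (cycleIdeals K c).1) : I.1 ≤ K.1 := by
  have hv : vertexSet (I.1 ⊓ K.1) = H := by
    rw [vertexSet_inf (by rw [I.2, K.2]), I.2]
  refine (le_of_evq_mem hv I.2 fun c f hc hI => ?_).trans inf_le_right
  refine (TwoSidedIdeal.mem_inf _).2 ⟨hI, ?_⟩
  rw [evq_mem_iff K c hc]
  rw [evq_mem_iff I c hc] at hI
  exact h _ hI

theorem vertexSet_comap_quotHom {H : E.HSet}
    {K : TwoSidedIdeal ((E.quot H).LeavittPathAlgebra F)} (hK : ∀ x, vtx F _ x ∉ K) :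
    vertexSet (K.comap (quotHom F H)) = H := by
  refine Subtype.ext (Set.ext fun x => ?_)
  rw [mem_vertexSet, TwoSidedIdeal.mem_comap]
  constructor
  · intro h
    by_contra hx
    obtain ⟨x, rfl⟩ := exists_quotV hx
    rw [quotHom_vtx] at h
    exact hK x h
  · intro h
    rw [quotHom_vtx_of_mem h]
    exact K.zero_mem

/-- Injectivity is the reduction theorem. For surjectivity, an ideal without vertices is built over
the quotient graph and pulled back along `quotHom`. -/
theorem cycleIdeals_bijective (H : E.HSet) :
    Function.Bijective (cycleIdeals (F := F) (H := H)) := by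
  constructor
  · intro I K h
    exact Subtype.ext (le_antisymm (le_of_cycleIdeals_le fun c => by rw [h])
      (le_of_cycleIdeals_le fun c => by rw [h]))
  · intro J
    obtain ⟨K, hK, hJ⟩ := exists_ideal_of_satIdeal J
    refine ⟨⟨K.comap (quotHom F H), vertexSet_comap_quotHom hK⟩, funext fun c => Subtype.ext ?_⟩
    ext f
    rw [mem_cycleIdeals, TwoSidedIdeal.mem_comap, quotHom_evq, hJ]

theorem IsGraded.cycleIdeals_eq {H : E.HSet}
    {K : {K : TwoSidedIdeal (E.LeavittPathAlgebra F) // vertexSet K = H}} (hK : IsGraded K.1)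
    (c : (E.quot H).exitlessCycles) : cycleIdeals K c = SatIdeal.bot := by
  refine Subtype.ext (le_antisymm (fun f hf => ?_) bot_le)
  refine hK.eq_zero_of_ev_mem (isPath_seg_quot _) ?_ ?_ (mem_cycleIdeals.1 hf)
  · exact fun h => (exitlessCycles.rep c).ne_nil (List.map_eq_nil_iff.1 h)
  · rw [← mem_vertexSet, K.2]
    exact quotV_notMem _

/-- If all the polynomials are zero, then `K` lies in its own graded part, which has the same
vertices. -/
theorem isGraded_iff_cycleIdeals {H : E.HSet}
    (K : {K : TwoSidedIdeal (E.LeavittPathAlgebra F) // vertexSet K = H}) :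
    IsGraded K.1 ↔ cycleIdeals K = fun _ => SatIdeal.bot := by
  refine ⟨fun h => funext h.cycleIdeals_eq, fun h => ?_⟩
  let K' : {K : TwoSidedIdeal (E.LeavittPathAlgebra F) // vertexSet K = H} :=
    ⟨gradedPart K.1, (vertexSet_gradedPart K.1).trans K.2⟩
  have hle : K.1 ≤ K'.1 := le_of_cycleIdeals_le fun c => by
    rw [h]
    exact bot_le
  rw [le_antisymm hle (gradedPart_le K.1)]
  exact isGraded_gradedPart K.1

/-- A graded ideal contains no nonzero polynomials to compare, so vertices decide. The comparison is
made with `I ⊓ K`, which has the same vertices as `I`. -/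
theorem vertexSet_le_vertexSet_iff {I K : TwoSidedIdeal (E.LeavittPathAlgebra F)}
    (hI : IsGraded I) : vertexSet I ≤ vertexSet K ↔ I ≤ K := by
  refine ⟨fun h => ?_, fun h x hx => h hx⟩
  refine (le_of_evq_mem (vertexSet_inf h) rfl fun c f hc hf => ?_).trans inf_le_right
  have h0 := (evq_mem_iff ⟨I, rfl⟩ c hc f).1 hf
  rw [IsGraded.cycleIdeals_eq (K := ⟨I, rfl⟩) hI] at h0
  rw [(Submodule.mem_bot _).1 h0, map_zero]
  exact zero_mem _

variable (F E) in
/-- The graded ideals correspond to the hereditary saturated sets of vertices. -/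
noncomputable def gradedIdealOrderIso :
    {I : TwoSidedIdeal (E.LeavittPathAlgebra F) // IsGraded I} ≃o E.HSet where
  toEquiv := Equiv.ofBijective (fun I => vertexSet I.1) <| by
    constructor
    · intro I K h
      exact Subtype.ext (le_antisymm ((vertexSet_le_vertexSet_iff I.2).1 h.le)
        ((vertexSet_le_vertexSet_iff K.2).1 h.ge))
    · intro H
      obtain ⟨K, hK⟩ := (cycleIdeals_bijective (F := F) H).2 fun _ => SatIdeal.bot
      exact ⟨⟨K.1, (isGraded_iff_cycleIdeals K).2 hK⟩, K.2⟩
  map_rel_iff' {I _} := vertexSet_le_vertexSet_iff I.2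

variable (F E) in
/-- The ideals correspond to the hereditary saturated sets of vertices with a proper ideal of
Laurent polynomials for each cycle without exits of the quotient graph. -/
noncomputable def idealEquiv : TwoSidedIdeal (E.LeavittPathAlgebra F) ≃
    Σ H : E.HSet, ((E.quot H).exitlessCycles → SatIdeal F) :=
  (Equiv.sigmaFiberEquiv vertexSet).symm.trans
    (Equiv.sigmaCongrRight fun H => Equiv.ofBijective _ (cycleIdeals_bijective H))

theorem isGraded_iff_idealEquiv (K : TwoSidedIdeal (E.LeavittPathAlgebra F)) :
    IsGraded K ↔ (idealEquiv F E K).2 = fun _ => SatIdeal.bot :=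
  isGraded_iff_cycleIdeals ⟨K, rfl⟩

theorem isGraded_idealEquiv_symm_iff (d : Σ H : E.HSet, ((E.quot H).exitlessCycles → SatIdeal F)) :
    IsGraded ((idealEquiv F E).symm d) ↔ d.2 = fun _ => SatIdeal.bot := by
  obtain ⟨K, rfl⟩ := (idealEquiv F E).surjective d
  rw [Equiv.symm_apply_apply, isGraded_iff_idealEquiv]

end Classification

end LeavittPathAlgebra

end DirectedGraph

namespace DirectedGraph

/-! ### Vertices below which nothing branches -/

section NonBifurcating

variable {E : DirectedGraph.{u, v}}

/-- No vertex reachable from `x` emits two edges. -/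
def NonBifurcating (E : DirectedGraph.{u, v}) (x : E.Vertex) : Prop :=
  ∀ p w, E.IsPath x p w → ∀ e f, E.s e = w → E.s f = w → e = f

theorem NonBifurcating.of_path {x y : E.Vertex} {p : List E.Edge} (h : E.NonBifurcating x)
    (hp : E.IsPath x p y) : E.NonBifurcating y :=
  fun q w hq => h (p ++ q) w (hp.append hq)

theorem NonBifurcating.noExit {c : E.BasedCycle} (h : E.NonBifurcating c.base) : c.NoExit := by
  rintro ⟨e, he, f, hs, hne⟩
  obtain ⟨i, _, rfl⟩ := c.exists_nth_eq he
  have hp := c.isPath_seg 0 i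
  rw [c.s_nth_zero, zero_add] at hp
  exact hne (h _ _ hp f _ hs rfl)

theorem BasedCycle.NoExit.nonBifurcating {c : E.BasedCycle} (hc : c.NoExit) :
    E.NonBifurcating c.base := by
  intro p w hp e f he hf
  rw [← c.s_nth_zero] at hp
  obtain ⟨_, rfl⟩ := hc.eq_seg hp
  rw [hc.eq_nth he, hc.eq_nth hf]

theorem NonBifurcating.eq_append {x y z : E.Vertex} {p q : List E.Edge} (h : E.NonBifurcating x)
    (hp : E.IsPath x p y) (hq : E.IsPath x q z) (hl : p.length ≤ q.length) :
    ∃ t, q = p ++ t := by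
  induction p generalizing x q with
  | nil => exact ⟨q, rfl⟩
  | cons e p ih =>
    cases q with
    | nil => simp at hl
    | cons f q =>
      obtain rfl : e = f := h [] x rfl e f hp.1 hq.1
      have h' : E.NonBifurcating (E.r e) := h.of_path (p := [e]) ⟨hp.1, rfl⟩
      obtain ⟨t, rfl⟩ := ih h' hp.2 hq.2 (by simpa using hl)
      exact ⟨t, rfl⟩

theorem BasedCycle.isPath_nth (c : E.BasedCycle) (i : ℕ) :
    E.IsPath c.base (c.seg 0 i) (E.s (c.nth i)) := by
  have h := c.isPath_seg 0 i
  rwa [c.s_nth_zero, zero_add] at h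

end NonBifurcating

namespace GradedMonoid

/-! ### The graded monoid and its minimal elements -/

section Basic

variable {E : DirectedGraph.{u, v}} [E.RowFinite]

theorem mk_eq_sum (A : Multiset (E.Vertex × ℤ)) : mk E A = (A.map fun y => of E y.1 y.2).sum := by
  induction A using Multiset.induction with
  | empty => simp
  | cons y A ih =>
    rw [← Multiset.singleton_add, map_add, ih, Multiset.singleton_add, Multiset.map_cons,
      Multiset.sum_cons]
    rfl

theorem of_eq_sum {x : E.Vertex} (hx : ∃ e, E.s e = x) (i : ℤ) :
    of E x i = ∑ e ∈ E.out x, of E (E.r e) (i + 1) := by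
  rw [of, mk_rel E (.rel x i hx), mk_eq_sum, Multiset.map_map]
  rfl

theorem vadd_of (n : ℤ) (x : E.Vertex) (i : ℤ) : n +ᵥ of E x i = of E x (i + n) := rfl

theorem hom_ext {N : Type*} [AddCommMonoid N] {f g : E.GradedMonoid →+ N}
    (h : ∀ x i, f (of E x i) = g (of E x i)) : f = g := by
  ext a
  obtain ⟨A, rfl⟩ := mk_surjective E a
  rw [mk_eq_sum, map_multiset_sum, map_multiset_sum, Multiset.map_map, Multiset.map_map]
  congr 1
  exact Multiset.map_congr rfl fun y _ => h y.1 y.2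

/-- The universal property of the graded monoid. -/
noncomputable def lift {N : Type*} [AddCommMonoid N] (f : E.Vertex → ℤ → N)
    (hf : ∀ x i, (∃ e, E.s e = x) → f x i = ∑ e ∈ E.out x, f (E.r e) (i + 1)) :
    E.GradedMonoid →+ N :=
  AddCon.lift (addConGen E.GradedMonoidRel)
    (Multiset.sumAddMonoidHom.comp (Multiset.mapAddMonoidHom fun y : E.Vertex × ℤ => f y.1 y.2)) <|
    AddCon.addConGen_le.2 fun a b h => by
      obtain ⟨x, i, hx⟩ := h
      simpa [AddCon.ker_rel, Multiset.map_map, Function.comp_def] using hf x i hx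

theorem lift_of {N : Type*} [AddCommMonoid N] {f : E.Vertex → ℤ → N}
    (hf : ∀ x i, (∃ e, E.s e = x) → f x i = ∑ e ∈ E.out x, f (E.r e) (i + 1))
    (x : E.Vertex) (i : ℤ) : lift f hf (of E x i) = f x i := by
  change Multiset.sum (Multiset.map (fun y : E.Vertex × ℤ => f y.1 y.2) {(x, i)}) = _
  simp

/-! #### Expansions -/

open Classical in
/-- The expansion of `x(i)` by `k` steps. -/
noncomputable def expandAux : ℕ → E.Vertex → ℤ → Multiset (E.Vertex × ℤ)
  | 0, x, i => {(x, i)}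
  | k + 1, x, i => if ∃ e, E.s e = x then ∑ e ∈ E.out x, expandAux k (E.r e) (i + 1) else {(x, i)}

/-- The expansion of all elements up to level `n`. -/
noncomputable def expand (n : ℤ) : Multiset (E.Vertex × ℤ) →+ Multiset (E.Vertex × ℤ) :=
  Multiset.sumAddMonoidHom.comp
    (Multiset.mapAddMonoidHom fun y => expandAux (n - y.2).toNat y.1 y.2)

theorem expand_singleton (n : ℤ) (y : E.Vertex × ℤ) :
    expand n {y} = expandAux (n - y.2).toNat y.1 y.2 := by
  simp [expand]

/-- Having equal expansions at all sufficiently high levels is a congruence, and it contains the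
defining relations. It reduces questions about the monoid to multisets, where cardinalities can be
counted. -/
theorem exists_expand_eq {A B : Multiset (E.Vertex × ℤ)} (h : mk E A = mk E B) :
    ∃ m : ℤ, ∀ n, m ≤ n → expand n A = expand n B := by
  let c : AddCon (Multiset (E.Vertex × ℤ)) :=
    { r := fun A B => ∃ m : ℤ, ∀ n, m ≤ n → expand n A = expand n B
      iseqv :=
        { refl := fun A => ⟨0, fun _ _ => rfl⟩
          symm := fun ⟨m, hm⟩ => ⟨m, fun n hn => (hm n hn).symm⟩
          trans := fun ⟨m, hm⟩ ⟨m', hm'⟩ => ⟨max m m', fun n hn =>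
            (hm n (le_of_max_le_left hn)).trans (hm' n (le_of_max_le_right hn))⟩ }
      add' := fun ⟨m, hm⟩ ⟨m', hm'⟩ => ⟨max m m', fun n hn => by
        rw [map_add, map_add, hm n (le_of_max_le_left hn), hm' n (le_of_max_le_right hn)]⟩ }
  have hc : addConGen E.GradedMonoidRel ≤ c := by
    refine AddCon.addConGen_le.2 fun a b h => ?_
    obtain ⟨x, i, hx⟩ := h
    -- Level `i + 1` is the first at which expanding `x(i)` applies the relation; below it neither
    -- side is expanded at all.
    refine ⟨i + 1, fun n hn => ?_⟩
    have hk : (n - i).toNat = (n - (i + 1)).toNat + 1 := by omega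
    rw [expand_singleton, hk, expandAux, if_pos hx]
    simp [expand, Multiset.map_map]
  exact hc ((AddCon.eq _).1 h)

theorem one_le_card_expandAux (k : ℕ) (x : E.Vertex) (i : ℤ) :
    1 ≤ (expandAux k x i).card := by
  induction k generalizing x i with
  | zero => simp [expandAux]
  | succ k ih =>
    rw [expandAux]
    split_ifs with h
    · obtain ⟨e, he⟩ := h
      rw [Multiset.card_sum]
      exact (ih _ _).trans (Finset.single_le_sum (f := fun e => (expandAux k (E.r e) (i + 1)).card)
        (fun _ _ => Nat.zero_le _) ((E.mem_out x e).2 he))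
    · simp

theorem card_le_card_expand (n : ℤ) (A : Multiset (E.Vertex × ℤ)) :
    A.card ≤ (expand n A).card := by
  induction A using Multiset.induction with
  | empty => simp
  | cons y A ih =>
    rw [← Multiset.singleton_add, map_add, Multiset.card_add, Multiset.card_add, expand_singleton,
      Multiset.card_singleton]
    exact add_le_add (one_le_card_expandAux _ _ _) ih

theorem exists_isPath_of_mem_expandAux {k : ℕ} {x : E.Vertex} {i : ℤ} {y : E.Vertex × ℤ}
    (h : y ∈ expandAux k x i) : ∃ p, E.IsPath x p y.1 ∧ y.2 = i + p.length := by
  induction k generalizing x i with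
  | zero =>
    obtain rfl := Multiset.mem_singleton.1 h
    exact ⟨[], rfl, by simp⟩
  | succ k ih =>
    rw [expandAux] at h
    split_ifs at h with hx
    · obtain ⟨e, he, h⟩ := Multiset.mem_sum.1 h
      obtain ⟨p, hp, hy⟩ := ih h
      refine ⟨e :: p, ⟨(E.mem_out x e).1 he, hp⟩, ?_⟩
      rw [hy, List.length_cons]
      push_cast
      ring
    · obtain rfl := Multiset.mem_singleton.1 h
      exact ⟨[], rfl, by simp⟩

theorem out_eq_singleton {x : E.Vertex} (h : E.NonBifurcating x) {e : E.Edge} (he : E.s e = x) :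
    E.out x = {e} := by
  ext f
  rw [E.mem_out, Finset.mem_singleton]
  exact ⟨fun hf => h [] x rfl f e hf he, fun hf => hf ▸ he⟩

theorem card_expandAux_of_nonBifurcating {x : E.Vertex} (h : E.NonBifurcating x) (k : ℕ) (i : ℤ) :
    (expandAux k x i).card = 1 := by
  induction k generalizing x i with
  | zero => simp [expandAux]
  | succ k ih =>
    rw [expandAux]
    split_ifs with hx
    · obtain ⟨e, he⟩ := hx
      rw [out_eq_singleton h he, Finset.sum_singleton]
      exact ih (h.of_path (p := [e]) ⟨he, rfl⟩) _
    · simp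

theorem mk_eq_zero_iff {A : Multiset (E.Vertex × ℤ)} : mk E A = 0 ↔ A = 0 := by
  refine ⟨fun h => ?_, fun h => by rw [h, map_zero]⟩
  rw [← map_zero (mk E)] at h
  obtain ⟨m, hm⟩ := exists_expand_eq h
  have := card_le_card_expand m A
  rw [hm m le_rfl, map_zero, Multiset.card_zero, Nat.le_zero, Multiset.card_eq_zero] at this
  exact this

theorem of_ne_zero (x : E.Vertex) (i : ℤ) : of E x i ≠ 0 :=
  fun h => Multiset.singleton_ne_zero _ (mk_eq_zero_iff.1 h)

theorem eq_zero_of_add_eq_zero {a b : E.GradedMonoid} (h : a + b = 0) : a = 0 := by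
  obtain ⟨A, rfl⟩ := mk_surjective E a
  obtain ⟨B, rfl⟩ := mk_surjective E b
  rw [← map_add, mk_eq_zero_iff, add_eq_zero] at h
  rw [h.1, map_zero]

/-- Any term of a common expansion is reached from both vertices, and its level records the lengths
of the two paths. -/
theorem exists_isPath_of_of_eq {x y : E.Vertex} {i j : ℤ} (h : of E x i = of E y j) :
    ∃ w p q, E.IsPath x p w ∧ E.IsPath y q w ∧ i + p.length = j + q.length := by
  obtain ⟨m, hm⟩ := exists_expand_eq h
  have h := hm m le_rfl
  rw [expand_singleton, expand_singleton] at h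
  obtain ⟨z, hz⟩ := Multiset.card_pos_iff_exists_mem.1
    (one_le_card_expandAux (m - i).toNat x i)
  obtain ⟨p, hp, hi⟩ := exists_isPath_of_mem_expandAux hz
  simp only at h
  rw [h] at hz
  obtain ⟨q, hq, hj⟩ := exists_isPath_of_mem_expandAux hz
  exact ⟨z.1, p, q, hp, hq, hi.symm.trans hj⟩

theorem of_eq_of_isPath {x y : E.Vertex} (h : E.NonBifurcating x) {p : List E.Edge}
    (hp : E.IsPath x p y) (i : ℤ) : of E x i = of E y (i + p.length) := by
  induction p generalizing x i with
  | nil =>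
    obtain rfl : x = y := hp
    simp
  | cons e p ih =>
    rw [of_eq_sum ⟨e, hp.1⟩, out_eq_singleton h hp.1, Finset.sum_singleton,
      ih (h.of_path (p := [e]) ⟨hp.1, rfl⟩) hp.2, List.length_cons]
    congr 1
    push_cast
    ring

/-! #### Minimal elements -/

/-- All expansions of `x(i)` consist of a single term, and expanding never decreases the number of
terms, so there is no room for two nonzero summands. -/
theorem isMinimalElement_of {x : E.Vertex} (h : E.NonBifurcating x) (i : ℤ) :
    IsMinimalElement (of E x i) := by
  refine ⟨of_ne_zero x i, fun b c hb hbc => ?_⟩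
  obtain ⟨B, rfl⟩ := mk_surjective E b
  obtain ⟨C, rfl⟩ := mk_surjective E c
  suffices hC : C = 0 by rw [hbc, hC, map_zero, add_zero]
  rw [← map_add] at hbc
  obtain ⟨m, hm⟩ := exists_expand_eq hbc
  have h₁ := card_le_card_expand m (B + C)
  rw [← hm m le_rfl, expand_singleton, card_expandAux_of_nonBifurcating h, Multiset.card_add] at h₁
  have h₂ : 0 < B.card := Multiset.card_pos.2 fun h => hb (by rw [h, map_zero])
  exact Multiset.card_eq_zero.1 (by omega)

/-- After expansion the number `n` of terms of `a` satisfies `n ≥ 2 * n`. -/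
theorem eq_zero_of_eq_add_add {a b : E.GradedMonoid} (h : a = a + a + b) : a = 0 := by
  obtain ⟨A, rfl⟩ := mk_surjective E a
  obtain ⟨B, rfl⟩ := mk_surjective E b
  rw [← map_add, ← map_add] at h
  obtain ⟨m, hm⟩ := exists_expand_eq h
  have h₁ := congr_arg Multiset.card (hm m le_rfl)
  rw [map_add, map_add, Multiset.card_add, Multiset.card_add] at h₁
  have h₂ := card_le_card_expand m A
  rw [Multiset.card_eq_zero.1 (show A.card = 0 by omega), map_zero]

theorem of_eq_of_isMinimalElement {x : E.Vertex} {i : ℤ} (h : IsMinimalElement (of E x i))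
    {e : E.Edge} (he : E.s e = x) : of E (E.r e) (i + 1) = of E x i := by
  classical
  refine h.2 _ (∑ f ∈ (E.out x).erase e, of E (E.r f) (i + 1)) (of_ne_zero _ _) ?_
  rw [of_eq_sum ⟨e, he⟩, ← Finset.add_sum_erase _ _ ((E.mem_out x e).2 he)]

/-- By minimality the range of each edge from `x`, at the next level, represents the same element
`a`. Two edges would give `a = a + a + b`, which forces `a = 0`. -/
theorem nonBifurcating_of_isMinimalElement {x : E.Vertex} {i : ℤ}
    (h : IsMinimalElement (of E x i)) : E.NonBifurcating x := by
  classical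
  intro p w hp
  induction p generalizing x i with
  | nil =>
    obtain rfl : x = w := hp
    intro e f he hf
    by_contra hne
    refine h.1 (eq_zero_of_eq_add_add
      (b := ∑ g ∈ ((E.out x).erase e).erase f, of E (E.r g) (i + 1)) ?_)
    conv_rhs => rw [← of_eq_of_isMinimalElement h he]
    conv_rhs => enter [1, 2]; rw [of_eq_of_isMinimalElement h he, ← of_eq_of_isMinimalElement h hf]
    rw [add_assoc, Finset.add_sum_erase _ (fun g => of E (E.r g) (i + 1))
        (Finset.mem_erase.2 ⟨fun h => hne h.symm, (E.mem_out x f).2 hf⟩),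
      Finset.add_sum_erase _ (fun g => of E (E.r g) (i + 1)) ((E.mem_out x e).2 he),
      ← of_eq_sum ⟨e, he⟩]
  | cons e p ih =>
    refine ih (i := i + 1) ?_ hp.2
    rw [of_eq_of_isMinimalElement h hp.1]
    exact h

theorem exists_eq_of_of_isMinimalElement {a : E.GradedMonoid} (h : IsMinimalElement a) :
    ∃ x i, a = of E x i ∧ E.NonBifurcating x := by
  obtain ⟨A, rfl⟩ := mk_surjective E a
  have hA : A ≠ 0 := fun h0 => h.1 (by rw [h0, map_zero])
  obtain ⟨y, hy⟩ := Multiset.exists_mem_of_ne_zero hA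
  obtain ⟨B, rfl⟩ := Multiset.exists_cons_of_mem hy
  have := h.2 (of E y.1 y.2) (mk E B) (of_ne_zero _ _)
    (by rw [← Multiset.singleton_add, map_add]; rfl)
  exact ⟨y.1, y.2, this.symm, nonBifurcating_of_isMinimalElement (this ▸ h)⟩

theorem orbit_of (x : E.Vertex) (i : ℤ) :
    AddAction.orbit ℤ (of E x i) = AddAction.orbit ℤ (of E x 0) :=
  AddAction.orbit_eq_iff.2 ⟨i, (vadd_of i x 0).trans (by rw [zero_add])⟩

theorem orbit_eq_iff {x y : E.Vertex} (hx : E.NonBifurcating x) (hy : E.NonBifurcating y) :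
    AddAction.orbit ℤ (of E x 0) = AddAction.orbit ℤ (of E y 0) ↔
      ∃ w p q, E.IsPath x p w ∧ E.IsPath y q w := by
  rw [AddAction.orbit_eq_iff]
  constructor
  · rintro ⟨n, hn⟩
    obtain ⟨w, p, q, hp, hq, -⟩ := exists_isPath_of_of_eq (hn.symm.trans (vadd_of n y 0))
    exact ⟨w, p, q, hp, hq⟩
  · rintro ⟨w, p, q, hp, hq⟩
    refine ⟨p.length - q.length, (vadd_of _ y 0).trans ?_⟩
    rw [of_eq_of_isPath hx hp, of_eq_of_isPath hy hq]
    congr 1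
    ring

/-- Periodicity gives two paths of different lengths from `x` to the same vertex. As nothing
branches, the longer one extends the shorter one by a closed path. -/
theorem exists_basedCycle_of_isPeriodicElement {x : E.Vertex} {i : ℤ} (hx : E.NonBifurcating x)
    (h : IsPeriodicElement (of E x i)) :
    ∃ (c : E.BasedCycle) (p : List E.Edge), c.NoExit ∧ E.IsPath x p c.base := by
  obtain ⟨n, hn, h⟩ := h
  rw [vadd_of] at h
  obtain ⟨w, p, q, hp, hq, hl⟩ := exists_isPath_of_of_eq h
  have key : ∀ {p q : List E.Edge}, E.IsPath x p w → E.IsPath x q w → p.length < q.length →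
      ∃ (c : E.BasedCycle) (p : List E.Edge), c.NoExit ∧ E.IsPath x p c.base := by
    intro p q hp hq hl
    obtain ⟨t, rfl⟩ := hx.eq_append hp hq hl.le
    obtain ⟨w', hw', ht⟩ := isPath_append.1 hq
    obtain rfl := hp.target_unique hw'
    obtain ⟨c, rfl⟩ := IsClosedPath.exists_basedCycle (E := E) (x := w) (p := t)
      ⟨by rintro rfl; simp at hl, ht⟩
    exact ⟨c, p, (hx.of_path hp).noExit, hp⟩
  rcases Nat.lt_trichotomy p.length q.length with h | h | h
  · exact key hp hq h
  · omega
  · exact key hq hp h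

theorem isPeriodicElement_of_basedCycle {x : E.Vertex} (hx : E.NonBifurcating x) {c : E.BasedCycle}
    {p : List E.Edge} (hp : E.IsPath x p c.base) (i : ℤ) : IsPeriodicElement (of E x i) := by
  refine ⟨c.len, by have := c.len_pos; omega, ?_⟩
  rw [of_eq_of_isPath hx hp, vadd_of]
  exact (of_eq_of_isPath (hx.of_path hp) c.isPath _).symm

/-! #### Cycles without exits -/

/-- The orbit of a cycle without exits. -/
noncomputable def cycleOrbit (c : E.exitlessCycles) : E.minimalPeriodicOrbits :=
  ⟨AddAction.orbit ℤ (of E (exitlessCycles.rep c).base 0), _,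
    isMinimalElement_of (exitlessCycles.rep_noExit c).nonBifurcating 0,
    isPeriodicElement_of_basedCycle (exitlessCycles.rep_noExit c).nonBifurcating (p := []) rfl 0,
    rfl⟩

/-- Equal orbits give a common descendant, which lies on both cycles. Conversely, a minimal periodic
element comes from a vertex that leads to a cycle without exits, and moving down to it does not
change the orbit. -/
theorem cycleOrbit_bijective : Function.Bijective (cycleOrbit (E := E)) := by
  constructor
  · intro c d h
    have h' := (orbit_eq_iff (exitlessCycles.rep_noExit c).nonBifurcating
      (exitlessCycles.rep_noExit d).nonBifurcating).1 (congr_arg Subtype.val h)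
    obtain ⟨w, p, q, hp, hq⟩ := h'
    rw [← BasedCycle.s_nth_zero] at hp hq
    have h₁ := ((exitlessCycles.rep_noExit c).eq_seg hp).2
    have h₂ := ((exitlessCycles.rep_noExit d).eq_seg hq).2
    exact exitlessCycles.eq_of_s_nth_eq (h₁.symm.trans h₂)
  · rintro ⟨O, a, hmin, hper, rfl⟩
    obtain ⟨x, i, rfl, hx⟩ := exists_eq_of_of_isMinimalElement hmin
    obtain ⟨c, p, hc, hp⟩ := exists_basedCycle_of_isPeriodicElement hx hper
    refine ⟨c.toExitless hc, Subtype.ext ?_⟩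
    refine ((orbit_eq_iff (exitlessCycles.rep_noExit _).nonBifurcating hx).2 ?_).trans
      (orbit_of x i).symm
    -- The chosen representative may have another base point; a segment of the cycle leads from
    -- there to `c.base`.
    have hr : c.edges ~r (exitlessCycles.rep (c.toExitless hc)).edges := by
      rw [← Cycle.coe_eq_coe, exitlessCycles.coe_rep]
      rfl
    obtain ⟨i, _, hi⟩ := (exitlessCycles.rep (c.toExitless hc)).exists_nth_eq
      (hr.mem_iff.1 (c.nth_mem 0))
    refine ⟨c.base, (exitlessCycles.rep (c.toExitless hc)).seg 0 i, p, ?_, hp⟩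
    rw [← c.s_nth_zero, ← hi]
    exact BasedCycle.isPath_nth _ i

theorem cycleOrbit_eq_orbit (c : E.exitlessCycles) {e : E.Edge} (he : e ∈ c.1) :
    (cycleOrbit c).1 = AddAction.orbit ℤ (of E (E.s e) 0) := by
  rw [← exitlessCycles.coe_rep, Cycle.mem_coe_iff] at he
  obtain ⟨i, _, rfl⟩ := (exitlessCycles.rep c).exists_nth_eq he
  have hc := (exitlessCycles.rep_noExit c).nonBifurcating
  have hp := BasedCycle.isPath_nth (exitlessCycles.rep c) i
  exact (orbit_eq_iff hc (hc.of_path hp)).2 ⟨_, _, [], hp, rfl⟩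

/-- A full turn is a period. Conversely, two paths from the base to the same vertex have lengths
congruent modulo `c.len`. -/
theorem of_base_eq_iff {c : E.BasedCycle} (hc : c.NoExit) {i j : ℤ} :
    of E c.base i = of E c.base j ↔ i ≡ j [ZMOD c.len] := by
  have hper : ∀ i, of E c.base i = of E c.base (i + c.len) :=
    of_eq_of_isPath hc.nonBifurcating c.isPath
  constructor
  · intro h
    obtain ⟨w, p, q, hp, hq, hl⟩ := exists_isPath_of_of_eq h
    rw [← c.s_nth_zero] at hp hq
    have h₁ := c.mod_eq_of_s_nth_eq ((hc.eq_seg hp).2.symm.trans (hc.eq_seg hq).2)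
    rw [zero_add, zero_add] at h₁
    have h₂ : (p.length : ℤ) ≡ q.length [ZMOD c.len] := (Int.natCast_modEq_iff).2 h₁
    exact Int.ModEq.add_right_cancel h₂ (hl ▸ rfl)
  · intro h
    obtain ⟨k, hk⟩ := h.dvd
    obtain rfl : j = i + c.len * k := by omega
    have hk' : ∀ n : ℤ, of E c.base (i + c.len * n) = of E c.base i := by
      intro n
      induction n with
      | zero => simp
      | succ n ih => rw [mul_add, mul_one, ← add_assoc, ← hper, ih]
      | pred n ih => rw [← ih, hper, mul_sub, mul_one, ← add_sub_assoc, sub_add_cancel]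
    exact (hk' k).symm

theorem encard_cycleOrbit (c : E.exitlessCycles) : (cycleOrbit c).1.encard = c.1.length := by
  have hc := exitlessCycles.rep_noExit c
  rw [← exitlessCycles.coe_rep, Cycle.length_coe]
  change _ = ((exitlessCycles.rep c).len : ℕ∞)
  have hpos := (exitlessCycles.rep c).len_pos
  have himg : (cycleOrbit c).1 = (fun n : ℕ => of E (exitlessCycles.rep c).base n) ''
      (Finset.range (exitlessCycles.rep c).len) := by
    ext a
    constructor
    · rintro ⟨n, rfl⟩
      have hl : ((exitlessCycles.rep c).len : ℤ) ≠ 0 := by omega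
      have h0 := Int.emod_nonneg n hl
      have h1 := Int.emod_lt_of_pos n (show 0 < ((exitlessCycles.rep c).len : ℤ) by omega)
      refine ⟨(n % (exitlessCycles.rep c).len).toNat, ?_, ?_⟩
      · rw [Finset.mem_coe, Finset.mem_range]
        omega
      · change _ = n +ᵥ of E _ 0
        rw [vadd_of, zero_add]
        refine (of_base_eq_iff hc).2 ?_
        rw [Int.toNat_of_nonneg h0]
        exact Int.mod_modEq _ _
    · rintro ⟨n, _, rfl⟩
      exact ⟨n, by change (n : ℤ) +ᵥ of E _ 0 = _; rw [vadd_of, zero_add]⟩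
  rw [himg, Set.InjOn.encard_image, Set.encard_coe_eq_coe_finsetCard, Finset.card_range]
  intro m hm n hn h
  have := (of_base_eq_iff hc).1 h
  rw [Int.natCast_modEq_iff] at this
  exact Nat.ModEq.eq_of_lt_of_lt this (Finset.mem_range.1 hm) (Finset.mem_range.1 hn)

variable (E) in
theorem exists_exitlessCycles_equiv :
    ∃ Φ : E.exitlessCycles ≃ E.minimalPeriodicOrbits, ∀ c : E.exitlessCycles,
      (∀ e ∈ c.1, (Φ c).1 = AddAction.orbit ℤ (of E (E.s e) 0)) ∧
      (Φ c).1.encard = c.1.length :=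
  ⟨Equiv.ofBijective _ cycleOrbit_bijective, fun c =>
    ⟨fun _ he => cycleOrbit_eq_orbit c he, encard_cycleOrbit c⟩⟩

end Basic

end GradedMonoid

end DirectedGraph

/-- Both targets are the set of fibres of a surjection from `M`, and the fibres agree. -/
theorem exists_equiv_of_surjective {M A B : Type*} (f : M → A) (g : M → B)
    (hf : Function.Surjective f) (hg : Function.Surjective g) (h : ∀ a b, f a = f b ↔ g a = g b) :
    ∃ e : A ≃ B, ∀ a, e (f a) = g a := by
  let e : A → B := fun x => g (Function.surjInv hf x)
  have he : ∀ a, e (f a) = g a := fun a => (h _ _).1 (Function.surjInv_eq hf (f a))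
  have hbij : Function.Bijective e := by
    constructor
    · intro x y hxy
      obtain ⟨x, rfl⟩ := hf x
      obtain ⟨y, rfl⟩ := hf y
      rw [he, he] at hxy
      exact (h x y).2 hxy
    · intro z
      obtain ⟨a, rfl⟩ := hg z
      exact ⟨f a, he a⟩
  exact ⟨Equiv.ofBijective e hbij, he⟩

theorem exists_addEquiv_of_surjective {M A B : Type*} [AddCommMonoid M] [AddCommMonoid A]
    [AddCommMonoid B] (f : M →+ A) (g : M →+ B) (hf : Function.Surjective f)
    (hg : Function.Surjective g) (h : ∀ a b, f a = f b ↔ g a = g b) :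
    ∃ e : A ≃+ B, ∀ a, e (f a) = g a := by
  obtain ⟨e, he⟩ := exists_equiv_of_surjective f g hf hg h
  refine ⟨{ e with map_add' := fun x y => ?_ }, he⟩
  obtain ⟨x, rfl⟩ := hf x
  obtain ⟨y, rfl⟩ := hf y
  change e _ = e _ + e _
  rw [← map_add, he, he, he, map_add]

namespace DirectedGraph

namespace GradedMonoid

/-! ### Quotient graphs and order ideals of the graded monoid -/

section Quot

variable {E : DirectedGraph.{u, v}} [E.RowFinite] (H : E.HSet)

/-- The map to the graded monoid of a quotient graph. -/
noncomputable def toQuot : E.GradedMonoid →+ (E.quot H).GradedMonoid :=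
  lift (fun x i => Function.extend quotV (fun y => of (E.quot H) y i) 0 x) fun x i hx => by
    by_cases hxH : x ∈ H.1
    · rw [extend_quotV_of_mem _ hxH]
      refine (Finset.sum_eq_zero fun e he => ?_).symm
      exact extend_quotV_of_mem _ (H.2.1 e ((E.mem_out x e).1 he ▸ hxH))
    · obtain ⟨x, rfl⟩ := exists_quotV hxH
      rw [sum_out_quot x _ fun e _ he => extend_quotV_of_mem _ he, extend_quotV,
        of_eq_sum (exists_edge_quot hx)]
      refine Finset.sum_congr rfl fun e _ => ?_
      rw [r_quotE, extend_quotV]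

variable {H}

theorem toQuot_of (x : (E.quot H).Vertex) (i : ℤ) :
    toQuot H (of E (quotV x) i) = of (E.quot H) x i :=
  (lift_of _ _ _).trans (extend_quotV _ x)

theorem toQuot_of_mem {x : E.Vertex} (hx : x ∈ H.1) (i : ℤ) : toQuot H (of E x i) = 0 :=
  (lift_of _ _ _).trans (extend_quotV_of_mem _ hx)

theorem toQuot_of_eq_zero_iff {x : E.Vertex} {i : ℤ} : toQuot H (of E x i) = 0 ↔ x ∈ H.1 := by
  refine ⟨fun h => ?_, fun h => toQuot_of_mem h i⟩
  by_contra hx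
  obtain ⟨x, rfl⟩ := exists_quotV hx
  rw [toQuot_of] at h
  exact of_ne_zero x i h

theorem toQuot_surjective : Function.Surjective (toQuot H) := by
  intro a
  obtain ⟨A, rfl⟩ := mk_surjective _ a
  induction A using Multiset.induction with
  | empty => exact ⟨0, by simp⟩
  | cons y A ih =>
    obtain ⟨b, hb⟩ := ih
    refine ⟨of E (quotV y.1) y.2 + b, ?_⟩
    rw [map_add, toQuot_of, hb, ← Multiset.singleton_add, map_add]
    rfl

theorem toQuot_vadd (n : ℤ) (a : E.GradedMonoid) : toQuot H (n +ᵥ a) = n +ᵥ toQuot H a := by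
  have : (toQuot H).comp (shift E n) = (shift (E.quot H) n).comp (toQuot H) := by
    refine hom_ext fun x i => ?_
    change toQuot H (of E x (i + n)) = n +ᵥ toQuot H (of E x i)
    by_cases hx : x ∈ H.1
    · rw [toQuot_of_mem hx, toQuot_of_mem hx]
      exact (map_zero (shift (E.quot H) n)).symm
    · obtain ⟨x, rfl⟩ := exists_quotV hx
      rw [toQuot_of, toQuot_of, vadd_of]
  exact DFunLike.congr_fun this a

variable (H) in
/-- The congruence identifying elements that become equal after adding elements of the kernel. -/
def kerCon : AddCon E.GradedMonoid where
  r a b := ∃ t t', toQuot H t = 0 ∧ toQuot H t' = 0 ∧ a + t = b + t'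
  iseqv :=
    { refl := fun a => ⟨0, 0, map_zero _, map_zero _, rfl⟩
      symm := fun ⟨t, t', h, h', he⟩ => ⟨t', t, h', h, he.symm⟩
      trans := fun {a b c} ⟨t, t', h, h', he⟩ ⟨s, s', k, k', ke⟩ => by
        refine ⟨t + s, s' + t', by rw [map_add, h, k, add_zero], by rw [map_add, h', k', add_zero],
          ?_⟩
        rw [← add_assoc, he, add_right_comm, ke, add_assoc] }
  add' := fun {a b c d} ⟨t, t', h, h', he⟩ ⟨s, s', k, k', ke⟩ => by
    refine ⟨t + s, t' + s', by rw [map_add, h, k, add_zero], by rw [map_add, h', k', add_zero], ?_⟩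
    rw [add_add_add_comm, he, ke, add_add_add_comm]

/-- Modulo `kerCon` the vertices of `H` vanish, so the relations of the quotient graph hold there
and the universal property gives a map `σ` back. The point is that the congruence depends on the
kernel alone, which an isomorphism can transport. -/
theorem toQuot_eq_iff {a b : E.GradedMonoid} : toQuot H a = toQuot H b ↔
    ∃ t t', toQuot H t = 0 ∧ toQuot H t' = 0 ∧ a + t = b + t' := by
  constructor
  · intro h
    have h0 : ∀ {x : E.Vertex} (i : ℤ), x ∈ H.1 → (kerCon H).mk' (of E x i) = 0 := by
      intro x i hx
      rw [← map_zero (kerCon H).mk']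
      refine ((kerCon H).eq).2 ⟨0, of E x i, map_zero _, toQuot_of_mem hx i, ?_⟩
      rw [add_zero, zero_add]
    let σ : (E.quot H).GradedMonoid →+ (kerCon H).Quotient :=
      lift (fun x i => (kerCon H).mk' (of E (quotV x) i)) fun x i ⟨e, he⟩ => by
        rw [of_eq_sum ⟨quotE e, s_quot_eq_iff.1 he⟩, map_sum, sum_out_quot x _ fun e _ he => h0 _ he]
        rfl
    have hσ : σ.comp (toQuot H) = (kerCon H).mk' := by
      refine hom_ext fun x i => ?_
      rw [AddMonoidHom.comp_apply]
      by_cases hx : x ∈ H.1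
      · rw [toQuot_of_mem hx, map_zero, h0 i hx]
      · obtain ⟨x, rfl⟩ := exists_quotV hx
        rw [toQuot_of]
        exact lift_of _ _ _
    have h' := congr_arg σ h
    rw [← AddMonoidHom.comp_apply, ← AddMonoidHom.comp_apply, hσ] at h'
    exact (kerCon H).eq.1 h'
  · rintro ⟨t, t', h, h', he⟩
    have := congr_arg (toQuot H) he
    rwa [map_add, map_add, h, h', add_zero, add_zero] at this

/-! #### Invariant order ideals -/

/-- The order ideals of the graded monoid that are invariant under the shifts. -/
def IsInvariantIdeal (T : AddSubmonoid E.GradedMonoid) : Prop :=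
  (∀ a b, a + b ∈ T → a ∈ T) ∧ ∀ (n : ℤ) (a), a ∈ T → n +ᵥ a ∈ T

theorem isInvariantIdeal_mker (H : E.HSet) :
    IsInvariantIdeal (AddMonoidHom.mker (toQuot H)) := by
  refine ⟨fun a b h => ?_, fun n a h => ?_⟩
  · rw [AddMonoidHom.mem_mker, map_add] at h
    exact eq_zero_of_add_eq_zero h
  · rw [AddMonoidHom.mem_mker] at h ⊢
    rw [toQuot_vadd, h]
    exact map_zero (shift (E.quot H) n)

theorem IsInvariantIdeal.of_mem_iff {T : AddSubmonoid E.GradedMonoid} (hT : IsInvariantIdeal T)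
    {x : E.Vertex} (i j : ℤ) : of E x i ∈ T ↔ of E x j ∈ T := by
  have key : ∀ i j : ℤ, of E x i ∈ T → of E x j ∈ T := by
    intro i j h
    have := hT.2 (j - i) _ h
    rwa [vadd_of, add_sub_cancel] at this
  exact ⟨key i j, key j i⟩

theorem IsInvariantIdeal.sum_mem_iff {T : AddSubmonoid E.GradedMonoid} (hT : IsInvariantIdeal T)
    {ι : Type*} (s : Finset ι) (f : ι → E.GradedMonoid) :
    ∑ i ∈ s, f i ∈ T ↔ ∀ i ∈ s, f i ∈ T := by
  classical
  refine ⟨fun h i hi => ?_, fun h => sum_mem h⟩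
  rw [← Finset.add_sum_erase _ _ hi] at h
  exact hT.1 _ _ h

/-- The hereditary saturated set of an invariant order ideal. -/
def hset (T : {T : AddSubmonoid E.GradedMonoid // IsInvariantIdeal T}) : E.HSet :=
  ⟨{x | of E x 0 ∈ T.1}, by
    have key : ∀ x, (∃ e, E.s e = x) →
        (of E x 0 ∈ T.1 ↔ ∀ e, E.s e = x → of E (E.r e) 0 ∈ T.1) := by
      intro x hx
      rw [of_eq_sum hx, T.2.sum_mem_iff]
      simp only [E.mem_out, T.2.of_mem_iff (0 + 1) 0]
    exact ⟨fun e he => (key _ ⟨e, rfl⟩).1 he e rfl, fun x hx h => (key x hx).2 h⟩⟩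

theorem mem_hset {T : {T : AddSubmonoid E.GradedMonoid // IsInvariantIdeal T}} {x : E.Vertex} :
    x ∈ (hset T).1 ↔ of E x 0 ∈ T.1 := Iff.rfl

/-- An order ideal contains a sum only together with its summands, and shift invariance makes the
levels irrelevant, so the vertices determine it. -/
theorem hset_le_hset_iff {T T' : {T : AddSubmonoid E.GradedMonoid // IsInvariantIdeal T}} :
    hset T ≤ hset T' ↔ T ≤ T' := by
  refine ⟨fun h => ?_, fun h x hx => h hx⟩
  intro a
  obtain ⟨A, rfl⟩ := mk_surjective E a
  induction A using Multiset.induction with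
  | empty => simp
  | cons y A ih =>
    intro hy
    rw [← Multiset.singleton_add, map_add] at hy ⊢
    refine add_mem ?_ (ih ?_)
    · have h1 : of E y.1 y.2 ∈ T.1 := T.2.1 _ _ hy
      change of E y.1 y.2 ∈ T'.1
      rw [T'.2.of_mem_iff y.2 0]
      exact h ((T.2.of_mem_iff y.2 0).1 h1)
    · rw [add_comm] at hy
      exact T.2.1 _ _ hy

variable (E) in
/-- The invariant order ideals correspond to the hereditary saturated sets. -/
noncomputable def invariantIdealOrderIso :
    {T : AddSubmonoid E.GradedMonoid // IsInvariantIdeal T} ≃o E.HSet where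
  toEquiv := Equiv.ofBijective hset <| by
    constructor
    · exact fun T T' h => le_antisymm (hset_le_hset_iff.1 h.le) (hset_le_hset_iff.1 h.ge)
    · refine fun H => ⟨⟨_, isInvariantIdeal_mker H⟩, Subtype.ext (Set.ext fun x => ?_)⟩
      rw [mem_hset, AddMonoidHom.mem_mker, toQuot_of_eq_zero_iff]
  map_rel_iff' := hset_le_hset_iff

theorem invariantIdealOrderIso_mker (H : E.HSet) :
    invariantIdealOrderIso E ⟨_, isInvariantIdeal_mker H⟩ = H :=
  Subtype.ext (Set.ext fun _ => toQuot_of_eq_zero_iff)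

theorem invariantIdealOrderIso_symm_apply (H : E.HSet) :
    (invariantIdealOrderIso E).symm H = ⟨_, isInvariantIdeal_mker H⟩ := by
  rw [OrderIso.symm_apply_eq, invariantIdealOrderIso_mker]

end Quot

/-! #### Equivariant isomorphisms -/

section Equivariant

variable {E₁ : DirectedGraph.{u, v}} {E₂ : DirectedGraph.{u', v'}} [E₁.RowFinite] [E₂.RowFinite]

theorem symm_vadd {φ : E₁.GradedMonoid ≃+ E₂.GradedMonoid}
    (hφ : ∀ (n : ℤ) (a : E₁.GradedMonoid), φ (n +ᵥ a) = n +ᵥ φ a) (n : ℤ) (a : E₂.GradedMonoid) :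
    φ.symm (n +ᵥ a) = n +ᵥ φ.symm a := by
  rw [AddEquiv.symm_apply_eq, hφ, AddEquiv.apply_symm_apply]

theorem IsInvariantIdeal.comap {φ : E₁.GradedMonoid ≃+ E₂.GradedMonoid}
    (hφ : ∀ (n : ℤ) (a : E₁.GradedMonoid), φ (n +ᵥ a) = n +ᵥ φ a)
    {T : AddSubmonoid E₂.GradedMonoid} (hT : IsInvariantIdeal T) :
    IsInvariantIdeal (T.comap φ) := by
  refine ⟨fun a b h => ?_, fun n a h => ?_⟩
  · rw [AddSubmonoid.mem_comap, map_add] at h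
    exact hT.1 _ _ h
  · rw [AddSubmonoid.mem_comap] at h ⊢
    have := hT.2 n _ h
    rwa [← hφ] at this

/-- The bijection between the invariant order ideals given by an equivariant isomorphism. -/
noncomputable def invariantIdealCongr (φ : E₁.GradedMonoid ≃+ E₂.GradedMonoid)
    (hφ : ∀ (n : ℤ) (a : E₁.GradedMonoid), φ (n +ᵥ a) = n +ᵥ φ a) :
    {T : AddSubmonoid E₁.GradedMonoid // IsInvariantIdeal T} ≃o
      {T : AddSubmonoid E₂.GradedMonoid // IsInvariantIdeal T} where
  toFun T := ⟨T.1.comap φ.symm, T.2.comap (symm_vadd hφ)⟩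
  invFun T := ⟨T.1.comap φ, T.2.comap hφ⟩
  left_inv T := by
    ext a
    simp
  right_inv T := by
    ext a
    simp
  map_rel_iff' {T T'} := by
    refine ⟨fun h a ha => ?_, fun h a ha => h ha⟩
    have : φ a ∈ T.1.comap (φ.symm : E₂.GradedMonoid →+ E₁.GradedMonoid) := by
      simpa using ha
    have h2 := h this
    simpa using h2

/-- The bijection between the hereditary saturated sets given by an equivariant isomorphism. -/
noncomputable def hsetCongr (φ : E₁.GradedMonoid ≃+ E₂.GradedMonoid)
    (hφ : ∀ (n : ℤ) (a : E₁.GradedMonoid), φ (n +ᵥ a) = n +ᵥ φ a) : E₁.HSet ≃o E₂.HSet :=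
  (invariantIdealOrderIso E₁).symm.trans
    ((invariantIdealCongr φ hφ).trans (invariantIdealOrderIso E₂))

theorem toQuot_hsetCongr_eq_zero_iff {φ : E₁.GradedMonoid ≃+ E₂.GradedMonoid}
    (hφ : ∀ (n : ℤ) (a : E₁.GradedMonoid), φ (n +ᵥ a) = n +ᵥ φ a) {H : E₁.HSet}
    {a : E₁.GradedMonoid} : toQuot (hsetCongr φ hφ H) (φ a) = 0 ↔ toQuot H a = 0 := by
  have h : (invariantIdealOrderIso E₂).symm (hsetCongr φ hφ H) =
      invariantIdealCongr φ hφ ((invariantIdealOrderIso E₁).symm H) := by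
    rw [hsetCongr, OrderIso.trans_apply, OrderIso.trans_apply, OrderIso.symm_apply_apply]
  rw [invariantIdealOrderIso_symm_apply, invariantIdealOrderIso_symm_apply] at h
  have h' : φ a ∈ AddMonoidHom.mker (toQuot (hsetCongr φ hφ H)) ↔
      φ a ∈ (AddMonoidHom.mker (toQuot H)).comap (φ.symm : E₂.GradedMonoid →+ E₁.GradedMonoid) :=
    Iff.of_eq (congr_arg (fun T => φ a ∈ T.1) h)
  rw [AddMonoidHom.mem_mker] at h'
  rw [h', AddSubmonoid.mem_comap, AddMonoidHom.mem_mker]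
  simp

/-- An equivariant isomorphism induces equivariant isomorphisms of the graded monoids of the
quotient graphs. -/
theorem exists_quot_addEquiv {φ : E₁.GradedMonoid ≃+ E₂.GradedMonoid}
    (hφ : ∀ (n : ℤ) (a : E₁.GradedMonoid), φ (n +ᵥ a) = n +ᵥ φ a) (H : E₁.HSet) :
    ∃ ψ : (E₁.quot H).GradedMonoid ≃+ (E₂.quot (hsetCongr φ hφ H)).GradedMonoid,
      ∀ (n : ℤ) (a : (E₁.quot H).GradedMonoid), ψ (n +ᵥ a) = n +ᵥ ψ a := by
  obtain ⟨ψ, hψ⟩ := exists_addEquiv_of_surjective (toQuot H)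
    ((toQuot (hsetCongr φ hφ H)).comp (φ : E₁.GradedMonoid →+ E₂.GradedMonoid))
    toQuot_surjective (toQuot_surjective.comp φ.surjective) <| by
      intro a b
      -- Both congruences are now expressed through the kernels, and `φ` matches these.
      rw [toQuot_eq_iff, AddMonoidHom.comp_apply, AddMonoidHom.comp_apply, toQuot_eq_iff]
      constructor
      · rintro ⟨t, t', h, h', he⟩
        refine ⟨φ t, φ t', (toQuot_hsetCongr_eq_zero_iff hφ).2 h,
          (toQuot_hsetCongr_eq_zero_iff hφ).2 h', ?_⟩
        simpa using congr_arg φ he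
      · rintro ⟨t, t', h, h', he⟩
        obtain ⟨t, rfl⟩ := φ.surjective t
        obtain ⟨t', rfl⟩ := φ.surjective t'
        refine ⟨t, t', (toQuot_hsetCongr_eq_zero_iff hφ).1 h,
          (toQuot_hsetCongr_eq_zero_iff hφ).1 h', φ.injective ?_⟩
        simpa using he
  refine ⟨ψ, fun n a => ?_⟩
  obtain ⟨a, rfl⟩ := toQuot_surjective a
  rw [← toQuot_vadd, hψ, hψ]
  simp only [AddMonoidHom.comp_apply, AddMonoidHom.coe_coe, hφ, toQuot_vadd]

theorem isMinimalElement_map_iff {φ : E₁.GradedMonoid ≃+ E₂.GradedMonoid} {a : E₁.GradedMonoid} :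
    IsMinimalElement (φ a) ↔ IsMinimalElement a := by
  refine and_congr (by simp) ⟨fun h b c hb hbc => ?_, fun h b c hb hbc => ?_⟩
  · exact φ.injective (h (φ b) (φ c) (by simpa using hb) (by rw [hbc, map_add]))
  · rw [← φ.symm_apply_eq]
    refine (h (φ.symm b) (φ.symm c) (by simpa using hb) ?_)
    rw [← map_add, ← hbc, φ.symm_apply_apply]

theorem isPeriodicElement_map_iff {φ : E₁.GradedMonoid ≃+ E₂.GradedMonoid}
    (hφ : ∀ (n : ℤ) (a : E₁.GradedMonoid), φ (n +ᵥ a) = n +ᵥ φ a) {a : E₁.GradedMonoid} :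
    IsPeriodicElement (φ a) ↔ IsPeriodicElement a := by
  refine exists_congr fun n => and_congr_right fun _ => ?_
  rw [← hφ, φ.injective.eq_iff]

/-- The orbits of the elements satisfying a property. -/
def orbitsOf {E : DirectedGraph.{u, v}} [E.RowFinite] (P : E.GradedMonoid → Prop) :
    Set (Set E.GradedMonoid) :=
  {O | ∃ a, P a ∧ O = AddAction.orbit ℤ a}

theorem minimalPeriodicOrbits_eq {E : DirectedGraph.{u, v}} [E.RowFinite] :
    E.minimalPeriodicOrbits = orbitsOf fun a => IsMinimalElement a ∧ IsPeriodicElement a := by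
  ext O
  simp only [minimalPeriodicOrbits, orbitsOf, Set.mem_ofPred_eq, and_assoc]

theorem nonempty_orbitsOf_equiv {φ : E₁.GradedMonoid ≃+ E₂.GradedMonoid}
    (hφ : ∀ (n : ℤ) (a : E₁.GradedMonoid), φ (n +ᵥ a) = n +ᵥ φ a)
    {P₁ : E₁.GradedMonoid → Prop} {P₂ : E₂.GradedMonoid → Prop} (hP : ∀ a, P₂ (φ a) ↔ P₁ a) :
    Nonempty (orbitsOf P₁ ≃ orbitsOf P₂) := by
  have himg : ∀ a, φ '' AddAction.orbit ℤ a = AddAction.orbit ℤ (φ a) := by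
    intro a
    ext b
    constructor
    · rintro ⟨_, ⟨n, rfl⟩, rfl⟩
      exact ⟨n, (hφ n a).symm⟩
    · rintro ⟨n, rfl⟩
      exact ⟨_, ⟨n, rfl⟩, hφ n a⟩
  refine ⟨Equiv.subtypeEquiv (Equiv.Set.congr φ.toEquiv) fun O => ?_⟩
  change O ∈ orbitsOf P₁ ↔ φ '' O ∈ orbitsOf P₂
  constructor
  · rintro ⟨a, ha, rfl⟩
    exact ⟨φ a, (hP a).2 ha, himg a⟩
  · rintro ⟨b, hb, hO⟩
    obtain ⟨a, rfl⟩ := φ.surjective b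
    rw [← himg] at hO
    exact ⟨a, (hP a).1 hb, φ.injective.image_injective hO⟩

theorem nonempty_exitlessCycles_equiv {φ : E₁.GradedMonoid ≃+ E₂.GradedMonoid}
    (hφ : ∀ (n : ℤ) (a : E₁.GradedMonoid), φ (n +ᵥ a) = n +ᵥ φ a) :
    Nonempty (E₁.exitlessCycles ≃ E₂.exitlessCycles) := by
  obtain ⟨Φ₁, -⟩ := exists_exitlessCycles_equiv E₁
  obtain ⟨Φ₂, -⟩ := exists_exitlessCycles_equiv E₂
  obtain ⟨Ψ⟩ := nonempty_orbitsOf_equiv hφ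
    (P₁ := fun a => IsMinimalElement a ∧ IsPeriodicElement a)
    (P₂ := fun a => IsMinimalElement a ∧ IsPeriodicElement a)
    fun a => and_congr isMinimalElement_map_iff (isPeriodicElement_map_iff hφ)
  exact ⟨Φ₁.trans ((Equiv.setCongr minimalPeriodicOrbits_eq).trans
    (Ψ.trans ((Equiv.setCongr minimalPeriodicOrbits_eq).symm.trans Φ₂.symm)))⟩

theorem conditionL_congr {φ : E₁.GradedMonoid ≃+ E₂.GradedMonoid}
    (hφ : ∀ (n : ℤ) (a : E₁.GradedMonoid), φ (n +ᵥ a) = n +ᵥ φ a) :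
    E₁.ConditionL ↔ E₂.ConditionL := by
  obtain ⟨Φ⟩ := nonempty_exitlessCycles_equiv hφ
  rw [conditionL_iff, conditionL_iff, Φ.isEmpty_congr]

/-- Condition (K) is Condition (L) for all quotient graphs; these are matched by `hsetCongr`, with
isomorphic monoids. -/
theorem conditionK_congr {φ : E₁.GradedMonoid ≃+ E₂.GradedMonoid}
    (hφ : ∀ (n : ℤ) (a : E₁.GradedMonoid), φ (n +ᵥ a) = n +ᵥ φ a) :
    E₁.ConditionK ↔ E₂.ConditionK := by
  rw [conditionK_iff, conditionK_iff, ← (hsetCongr φ hφ).toEquiv.forall_congr_right]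
  refine forall_congr' fun H => ?_
  obtain ⟨ψ, hψ⟩ := exists_quot_addEquiv hφ H
  exact conditionL_congr hψ

end Equivariant

end GradedMonoid

/-! ### Transport of two-sided ideals -/

namespace LeavittPathAlgebra

variable (F : Type w) [Field F] {E₁ : DirectedGraph.{u, v}} {E₂ : DirectedGraph.{u', v'}}
  [E₁.RowFinite] [E₂.RowFinite]

theorem nonempty_nonGradedIdeal_equiv {φ : E₁.GradedMonoid ≃+ E₂.GradedMonoid}
    (hφ : ∀ (n : ℤ) (a : E₁.GradedMonoid), φ (n +ᵥ a) = n +ᵥ φ a) :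
    Nonempty ({I : TwoSidedIdeal (E₁.LeavittPathAlgebra F) // ¬ IsGraded I} ≃
      {I : TwoSidedIdeal (E₂.LeavittPathAlgebra F) // ¬ IsGraded I}) := by
  have hcyc : ∀ H : E₁.HSet, Nonempty ((E₁.quot H).exitlessCycles ≃
      (E₂.quot (GradedMonoid.hsetCongr φ hφ H)).exitlessCycles) := fun H => by
    obtain ⟨ψ, hψ⟩ := GradedMonoid.exists_quot_addEquiv hφ H
    exact GradedMonoid.nonempty_exitlessCycles_equiv hψ
  let Ψ : (Σ H : E₁.HSet, ((E₁.quot H).exitlessCycles → SatIdeal F)) ≃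
      Σ H : E₂.HSet, ((E₂.quot H).exitlessCycles → SatIdeal F) :=
    Equiv.sigmaCongr (GradedMonoid.hsetCongr φ hφ).toEquiv fun H =>
      -- Only the cycles are relabelled and the polynomial ideals stay as they are. The zero
      -- families therefore correspond to each other, and so do their complements.
      Equiv.arrowCongr (Classical.choice (hcyc H)) (Equiv.refl _)
  have hΨ : ∀ d, d.2 = (fun _ => SatIdeal.bot) ↔ (Ψ d).2 = fun _ => SatIdeal.bot := by
    rintro ⟨H, J⟩
    change J = _ ↔ Equiv.arrowCongr (Classical.choice (hcyc H)) (Equiv.refl _) J = _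
    rw [← (Equiv.arrowCongr (Classical.choice (hcyc H)) (Equiv.refl (SatIdeal F))).injective.eq_iff]
    rfl
  refine ⟨Equiv.subtypeEquiv ((idealEquiv F E₁).trans (Ψ.trans (idealEquiv F E₂).symm)) fun I => ?_⟩
  rw [not_iff_not, isGraded_iff_idealEquiv, hΨ, Equiv.trans_apply, Equiv.trans_apply,
    isGraded_idealEquiv_symm_iff]

theorem nonempty_gradedIdeal_orderIso {φ : E₁.GradedMonoid ≃+ E₂.GradedMonoid}
    (hφ : ∀ (n : ℤ) (a : E₁.GradedMonoid), φ (n +ᵥ a) = n +ᵥ φ a) :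
    Nonempty ({I : TwoSidedIdeal (E₁.LeavittPathAlgebra F) // IsGraded I} ≃o
      {I : TwoSidedIdeal (E₂.LeavittPathAlgebra F) // IsGraded I}) :=
  ⟨(gradedIdealOrderIso F E₁).trans
    ((GradedMonoid.hsetCongr φ hφ).trans (gradedIdealOrderIso F E₂).symm)⟩

end LeavittPathAlgebra

end DirectedGraph

/-! ### Minimal left ideals -/

section MinimalIdeals

variable {A : Type*} [NonUnitalRing A]

/-- The left ideal of the multiples of an element. -/
def leftMultiples (a : A) : NonUnitalLeftIdeal A :=
  ⟨(AddMonoidHom.mulRight a).range, by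
    rintro b _ ⟨c, rfl⟩
    exact ⟨b * c, mul_assoc b c a⟩⟩

/-- Right multiplication of a left ideal. -/
def NonUnitalLeftIdeal.mulRight (I : NonUnitalLeftIdeal A) (g : A) : NonUnitalLeftIdeal A :=
  ⟨I.1.map (AddMonoidHom.mulRight g), by
    rintro b _ ⟨c, hc, rfl⟩
    exact ⟨b * c, I.2 b c hc, mul_assoc b c g⟩⟩

/-- The left multiples of `a` form a nonzero left ideal inside `I`, hence all of `I`. Without a
unit, that they are nonzero has to be assumed. -/
theorem MinimalLeftIdeal.exists_mul_eq (I : MinimalLeftIdeal A) {a b : A} (ha : a ∈ I.1.1)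
    (hb : b ∈ I.1.1) (h : ∃ c, c * a ≠ 0) : ∃ c, c * a = b := by
  have hle : (leftMultiples a).1 ≤ I.1.1 := by
    rintro _ ⟨c, rfl⟩
    exact I.1.2 c a ha
  have hne : (leftMultiples a).1 ≠ ⊥ := by
    obtain ⟨c, hc⟩ := h
    intro h0
    have : c * a ∈ (leftMultiples a).1 := ⟨c, rfl⟩
    rw [h0] at this
    exact hc this
  rw [← I.2.2 _ hle hne] at hb
  exact hb

theorem MinimalLeftIdeal.exists_ne_zero (I : MinimalLeftIdeal A) : ∃ a ∈ I.1.1, a ≠ 0 :=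
  I.1.1.bot_or_exists_ne_zero.resolve_left I.2.1

/-- Right multiplication gives isomorphisms of minimal left ideals. -/
theorem MinimalLeftIdeal.equiv_of_mul (hA : ∀ a : A, a ≠ 0 → ∃ c, c * a ≠ 0)
    (I J : MinimalLeftIdeal A) (g : A) (hg : ∀ x ∈ I.1.1, x * g ∈ J.1.1)
    (hne : ∃ x ∈ I.1.1, x * g ≠ 0) : minimalLeftIdealSetoid A I J := by
  -- A nonzero `x` has all of `I` as its left multiples, so `x * g = 0` would make `g` kill `I`.
  have hinj : ∀ x ∈ I.1.1, x * g = 0 → x = 0 := by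
    intro x hx hxg
    by_contra h0
    obtain ⟨y, hy, hyg⟩ := hne
    obtain ⟨c, rfl⟩ := I.exists_mul_eq hx hy (hA x h0)
    exact hyg (by rw [mul_assoc, hxg, mul_zero])
  let f : I.1.1 →+ J.1.1 :=
    { toFun := fun x => ⟨x * g, hg x x.2⟩
      map_zero' := Subtype.ext (zero_mul g)
      map_add' := fun x y => Subtype.ext (add_mul _ _ _) }
  have hf : Function.Bijective f := by
    constructor
    · rw [injective_iff_map_eq_zero]
      exact fun x hx => Subtype.ext (hinj x x.2 (congr_arg Subtype.val hx))
    · have hJ : (I.1.mulRight g).1 = J.1.1 := by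
        refine J.2.2 _ ?_ ?_
        · rintro _ ⟨x, hx, rfl⟩
          exact hg x hx
        · intro h0
          obtain ⟨x, hx, hxg⟩ := hne
          have : x * g ∈ (I.1.mulRight g).1 := ⟨x, hx, rfl⟩
          rw [h0] at this
          exact hxg this
      rintro ⟨y, hy⟩
      rw [← hJ] at hy
      obtain ⟨x, hx, rfl⟩ := hy
      exact ⟨⟨x, hx⟩, rfl⟩
  exact ⟨AddEquiv.ofBijective f hf, fun a x => Subtype.ext (mul_assoc a x g)⟩

/-- The left ideal corresponding to a right ideal under an involution. -/
def NonUnitalRightIdeal.toLeft (σ : A ≃+ A) (hσ : ∀ a b, σ (a * b) = σ b * σ a)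
    (I : NonUnitalRightIdeal A) : NonUnitalLeftIdeal A :=
  ⟨I.1.comap (σ : A →+ A), fun a x hx => by
    change σ (a * x) ∈ I.1
    rw [hσ]
    exact I.2 _ _ hx⟩

/-- The right ideal corresponding to a left ideal under an involution. -/
def NonUnitalLeftIdeal.toRight (σ : A ≃+ A) (hσ : ∀ a b, σ (a * b) = σ b * σ a)
    (I : NonUnitalLeftIdeal A) : NonUnitalRightIdeal A :=
  ⟨I.1.comap (σ : A →+ A), fun a x hx => by
    change σ (x * a) ∈ I.1
    rw [hσ]
    exact I.2 _ _ hx⟩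

theorem comap_comap_involution (σ : A ≃+ A) (hinv : ∀ a, σ (σ a) = a) (I : AddSubgroup A) :
    (I.comap (σ : A →+ A)).comap (σ : A →+ A) = I := by
  ext a
  simp [hinv]

theorem comap_involution_le (σ : A ≃+ A) (hinv : ∀ a, σ (σ a) = a)
    {I J : AddSubgroup A} (h : I ≤ J.comap (σ : A →+ A)) :
    I.comap (σ : A →+ A) ≤ J := by
  intro a ha
  have := h ha
  simpa [hinv] using this

theorem comap_involution_ne_bot (σ : A ≃+ A) (hinv : ∀ a, σ (σ a) = a)
    {I : AddSubgroup A} (h : I ≠ ⊥) : I.comap (σ : A →+ A) ≠ ⊥ := by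
  intro h0
  refine h ?_
  rw [← comap_comap_involution σ hinv I, h0]
  ext a
  simp

/-- The minimal left ideal corresponding to a minimal right ideal under an involution. -/
def MinimalRightIdeal.toLeft (σ : A ≃+ A) (hσ : ∀ a b, σ (a * b) = σ b * σ a)
    (hinv : ∀ a, σ (σ a) = a) (I : MinimalRightIdeal A) : MinimalLeftIdeal A :=
  ⟨I.1.toLeft σ hσ, comap_involution_ne_bot σ hinv I.2.1, fun J hJ h0 => by
    have := I.2.2 (J.toRight σ hσ) (comap_involution_le σ hinv hJ)
      (comap_involution_ne_bot σ hinv h0)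
    change _ = I.1.1.comap (σ : A →+ A)
    rw [← this]
    exact (comap_comap_involution σ hinv J.1).symm⟩

/-- The minimal right ideal corresponding to a minimal left ideal under an involution. -/
def MinimalLeftIdeal.toRight (σ : A ≃+ A) (hσ : ∀ a b, σ (a * b) = σ b * σ a)
    (hinv : ∀ a, σ (σ a) = a) (I : MinimalLeftIdeal A) : MinimalRightIdeal A :=
  ⟨I.1.toRight σ hσ, comap_involution_ne_bot σ hinv I.2.1, fun J hJ h0 => by
    have := I.2.2 (J.toLeft σ hσ) (comap_involution_le σ hinv hJ)
      (comap_involution_ne_bot σ hinv h0)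
    change _ = I.1.1.comap (σ : A →+ A)
    rw [← this]
    exact (comap_comap_involution σ hinv J.1).symm⟩

/-- The restriction of an isomorphism along an involution. -/
def comapInvolutionEquiv (σ : A ≃+ A) (hinv : ∀ a, σ (σ a) = a) {I J : AddSubgroup A} (f : I ≃+ J) :
    I.comap (σ : A →+ A) ≃+ J.comap (σ : A →+ A) where
  toFun x := ⟨σ (f ⟨σ x, x.2⟩), by
    change σ (σ _) ∈ J
    rw [hinv]
    exact (f _).2⟩
  invFun x := ⟨σ (f.symm ⟨σ x, x.2⟩), by
    change σ (σ _) ∈ I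
    rw [hinv]
    exact (f.symm _).2⟩
  left_inv x := by simp [hinv]
  right_inv x := by simp [hinv]
  map_add' x y := by
    have h := congr_arg Subtype.val (map_add f ⟨σ x, x.2⟩ ⟨σ y, y.2⟩)
    have h' : (⟨σ (x + y), (x + y).2⟩ : I) = ⟨σ x, x.2⟩ + ⟨σ y, y.2⟩ :=
      Subtype.ext (map_add σ _ _)
    refine Subtype.ext ((congr_arg (fun z => σ (f z).1) h').trans ?_)
    exact (congr_arg σ h).trans (map_add σ _ _)

theorem MinimalRightIdeal.toLeft_congr (σ : A ≃+ A) (hσ : ∀ a b, σ (a * b) = σ b * σ a)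
    (hinv : ∀ a, σ (σ a) = a) {I J : MinimalRightIdeal A} (h : minimalRightIdealSetoid A I J) :
    minimalLeftIdealSetoid A (I.toLeft σ hσ hinv) (J.toLeft σ hσ hinv) := by
  obtain ⟨f, hf⟩ := h
  refine ⟨comapInvolutionEquiv σ hinv f, fun a x => Subtype.ext ?_⟩
  have h := congr_arg (fun z => σ z.1) (hf (σ a) ⟨σ x, x.2⟩)
  have h' : (⟨σ (a * x), (I.toLeft σ hσ hinv).1.2 a x x.2⟩ : I.1.1) =
      ⟨σ x * σ a, I.1.2 _ _ x.2⟩ := Subtype.ext (hσ a x)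
  refine (congr_arg (fun z => σ (f z).1) h').trans (h.trans ?_)
  exact (hσ _ _).trans (by rw [hinv]; rfl)

theorem MinimalLeftIdeal.toRight_congr (σ : A ≃+ A) (hσ : ∀ a b, σ (a * b) = σ b * σ a)
    (hinv : ∀ a, σ (σ a) = a) {I J : MinimalLeftIdeal A} (h : minimalLeftIdealSetoid A I J) :
    minimalRightIdealSetoid A (I.toRight σ hσ hinv) (J.toRight σ hσ hinv) := by
  obtain ⟨f, hf⟩ := h
  refine ⟨comapInvolutionEquiv σ hinv f, fun a x => Subtype.ext ?_⟩
  have h := congr_arg (fun z => σ z.1) (hf (σ a) ⟨σ x, x.2⟩)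
  have h' : (⟨σ (x * a), (I.toRight σ hσ hinv).1.2 a x x.2⟩ : I.1.1) =
      ⟨σ a * σ x, I.1.2 _ _ x.2⟩ := Subtype.ext (hσ x a)
  refine (congr_arg (fun z => σ (f z).1) h').trans (h.trans ?_)
  exact (hσ _ _).trans (by rw [hinv]; rfl)

/-- An involution exchanges the isomorphism classes of minimal left and right ideals. -/
def minimalRightIdealClassesEquiv (σ : A ≃+ A) (hσ : ∀ a b, σ (a * b) = σ b * σ a)
    (hinv : ∀ a, σ (σ a) = a) : MinimalRightIdealClasses A ≃ MinimalLeftIdealClasses A where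
  toFun := Quotient.map (MinimalRightIdeal.toLeft σ hσ hinv) fun _ _ h =>
    MinimalRightIdeal.toLeft_congr σ hσ hinv h
  invFun := Quotient.map (MinimalLeftIdeal.toRight σ hσ hinv) fun _ _ h =>
    MinimalLeftIdeal.toRight_congr σ hσ hinv h
  left_inv := by
    rintro ⟨I⟩
    exact congr_arg (Quotient.mk _)
      (Subtype.ext (Subtype.ext (comap_comap_involution σ hinv I.1.1)))
  right_inv := by
    rintro ⟨I⟩
    exact congr_arg (Quotient.mk _)
      (Subtype.ext (Subtype.ext (comap_comap_involution σ hinv I.1.1)))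

end MinimalIdeals

namespace DirectedGraph

/-- A line point is a vertex from which no bifurcations and no cycles can be reached. -/
def IsLinePoint (E : DirectedGraph.{u, v}) [E.RowFinite] (x : E.Vertex) : Prop :=
  E.NonBifurcating x ∧ ¬ IsPeriodicElement (GradedMonoid.of E x 0)

namespace LeavittPathAlgebra

open Polynomial

/-! ### Separating polynomials in a cycle by ideals -/

section Separation

variable {F : Type w} [Field F] {E : DirectedGraph.{u, v}} [E.RowFinite]

/-- The ideal generated by a power of `X - 1`. -/
noncomputable def SatIdeal.ofPow (F : Type w) [Field F] (n : ℕ) : SatIdeal F :=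
  ⟨Ideal.span {(X - C 1) ^ (n + 1)}, by
    rw [Ne, Ideal.span_singleton_eq_top, isUnit_pow_iff n.succ_ne_zero]
    exact not_isUnit_X_sub_C 1, fun f hf => by
    rw [Ideal.mem_span_singleton] at hf ⊢
    -- The coefficients express `1` as `-(X - 1) + X`.
    refine IsCoprime.dvd_of_dvd_mul_left (IsCoprime.pow_left ⟨-1, 1, ?_⟩) hf
    simp⟩

/-- Prescribe the ideal generated by the power of `X - 1` one above its multiplicity in `f`: one
further factor `X - 1` is just enough for membership. This makes precise that `c - 1` is not
invertible. -/
theorem exists_ideal_separating {c : E.BasedCycle} (hc : c.NoExit) {f : F[X]} (hf : f ≠ 0) :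
    ∃ K : TwoSidedIdeal (E.LeavittPathAlgebra F),
      ev F c.base c.edges ((X - C 1) * f) ∈ K ∧ ev F c.base c.edges f ∉ K := by
  obtain ⟨K, -, hK⟩ := exists_ideal_of_satIdeal (G := E) fun _ =>
    SatIdeal.ofPow F (f.rootMultiplicity 1)
  have h : c.edges ~r (exitlessCycles.rep (c.toExitless hc)).edges := by
    rw [← Cycle.coe_eq_coe, exitlessCycles.coe_rep]
    rfl
  have key : ∀ g : F[X], ev F c.base c.edges g ∈ K ↔ (X - C 1) ^ (f.rootMultiplicity 1 + 1) ∣ g := by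
    intro g
    rw [← Ideal.mem_span_singleton]
    refine Iff.trans ?_ (hK (c.toExitless hc) g)
    exact ⟨ev_mem_of_isRotated c.isPath (BasedCycle.isPath _) c.ne_nil h,
      ev_mem_of_isRotated (BasedCycle.isPath _) c.isPath (BasedCycle.ne_nil _) h.symm⟩
  refine ⟨K, (key _).2 ?_, fun h => ?_⟩
  · rw [pow_succ']
    exact mul_dvd_mul_left _ (pow_rootMultiplicity_dvd f 1)
  · exact (pow_rootMultiplicity_not_dvd hf 1) ((key f).1 h)

theorem ev_ne_zero {c : E.BasedCycle} (hc : c.NoExit) {f : F[X]} (hf : f ≠ 0) :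
    ev F c.base c.edges f ≠ 0 := by
  obtain ⟨K, -, h⟩ := exists_ideal_separating hc hf
  exact fun h0 => h (h0 ▸ K.zero_mem)

theorem mul_ev_ne {c : E.BasedCycle} (hc : c.NoExit) {f : F[X]} (hf : f ≠ 0)
    (a : E.LeavittPathAlgebra F) :
    a * ev F c.base c.edges ((X - C 1) * f) ≠ ev F c.base c.edges f := by
  obtain ⟨K, h₁, h₂⟩ := exists_ideal_separating hc hf
  exact fun h => h₂ (h ▸ K.mul_mem_left _ _ h₁)

theorem vtx_ne_zero (x : E.Vertex) : vtx F E x ≠ 0 := by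
  obtain ⟨K, hK, -⟩ := exists_ideal_of_satIdeal (G := E) fun _ => (SatIdeal.bot : SatIdeal F)
  exact fun h => hK x (h ▸ K.zero_mem)

theorem notMem_vertexSet_bot (x : E.Vertex) :
    x ∉ (vertexSet (⊥ : TwoSidedIdeal (E.LeavittPathAlgebra F))).1 := by
  rw [mem_vertexSet, TwoSidedIdeal.mem_bot]
  exact vtx_ne_zero x

/-- For empty `H` the quotient graph is the graph itself. This brings the reduction theorem for the
zero ideal back to `E`. -/
theorem exists_basedCycle_of_quot {H : E.HSet} (hH : ∀ x, x ∉ H.1) {c : (E.quot H).BasedCycle}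
    (hc : c.NoExit) : ∃ d : E.BasedCycle, d.NoExit ∧ d.base = quotV c.base ∧
      ∀ f, evq F c f = ev F d.base d.edges f := by
  refine ⟨⟨c.edges.map quotE, quotV c.base, fun h => c.ne_nil (List.map_eq_nil_iff.1 h),
    isPath_seg_quot c, nodup_quotE_iff.2 c.nodup⟩, ?_, rfl, fun _ => rfl⟩
  rintro ⟨_, he, f, hs, hne⟩
  obtain ⟨e, he', rfl⟩ := List.mem_map.1 he
  obtain ⟨f, rfl⟩ := exists_quotE (H := H) (e := f) (hH _)
  exact hc ⟨e, he', f, quotV_injective hs, fun h => hne (congr_arg quotE h)⟩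

theorem exists_mul_mul_path_ne_zero {a : E.LeavittPathAlgebra F} (ha : a ≠ 0) :
    ∃ (l : E.LeavittPathAlgebra F) (y z : E.Vertex) (q : List E.Edge), E.IsPath y q z ∧
      l * (a * path F y q) ≠ 0 ∧ (l * (a * path F y q) = vtx F E z ∨
        ∃ (c : E.BasedCycle) (f : F[X]), c.NoExit ∧ c.base = z ∧
          l * (a * path F y q) = ev F c.base c.edges f) := by
  obtain ⟨l, y, z, q, hq, h₁, h₂⟩ := exists_mul_mul_path ⊥ (a := a)
    (by rwa [TwoSidedIdeal.mem_bot])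
  rw [TwoSidedIdeal.mem_bot] at h₁
  refine ⟨l, y, z, q, hq, h₁, h₂.imp_right ?_⟩
  rintro ⟨c, f, hc, rfl, h⟩
  obtain ⟨d, hd, hb, hev⟩ := exists_basedCycle_of_quot (F := F) notMem_vertexSet_bot hc
  exact ⟨d, f, hd, hb, by rw [h, hev]⟩

theorem exists_mul_ne_zero {a : E.LeavittPathAlgebra F} (ha : a ≠ 0) : ∃ c, c * a ≠ 0 := by
  obtain ⟨S, hS⟩ := exists_left_unit a
  exact ⟨_, hS.symm ▸ ha⟩

/-- Where a vertex emits a single edge `e`, its relation reads `e e* = s(e)`. So paths from `x` are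
invertible on both sides. -/
theorem path_mul_adj_path {x y : E.Vertex} (hx : E.NonBifurcating x) {p : List E.Edge}
    (hp : E.IsPath x p y) : path F x p * adj (path F x p) = vtx F E x := by
  induction p generalizing x with
  | nil => simp [vtx_mul_self]
  | cons e p ih =>
    rw [path_cons, adj_mul, adj_edg, mul_assoc, ← mul_assoc (path F _ p),
      ih (hx.of_path (p := [e]) ⟨hp.1, rfl⟩) hp.2, vtx_mul_gho,
      ← sum_edg_mul_gho ⟨e, hp.1⟩, GradedMonoid.out_eq_singleton hx hp.1, Finset.sum_singleton]

end Separation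

/-! ### Minimal left ideals and line points -/

section MinimalLeft

variable {F : Type w} [Field F] {E : DirectedGraph.{u, v}} [E.RowFinite]

variable (F) in
/-- The minimal left ideal of a line point. -/
noncomputable def linePointIdeal (x : {x : E.Vertex // E.IsLinePoint x}) :
    MinimalLeftIdeal (E.LeavittPathAlgebra F) :=
  ⟨leftMultiples (vtx F E x.1), by
    intro h
    have : vtx F E x.1 ∈ (leftMultiples (vtx F E x.1)).1 := ⟨_, vtx_mul_self x.1⟩
    rw [h] at this
    exact vtx_ne_zero x.1 this, by
    intro J hJ hne
    refine le_antisymm hJ ?_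
    obtain ⟨a, haJ, ha⟩ := J.1.bot_or_exists_ne_zero.resolve_left hne
    have hax : a * vtx F E x.1 = a := by
      obtain ⟨b, rfl⟩ := hJ haJ
      change b * _ * _ = b * _
      rw [mul_assoc, vtx_mul_self]
    obtain ⟨l, y, z, q, hq, h₁, h₂⟩ := exists_mul_mul_path_ne_zero ha
    have hxy : x.1 = y := by
      by_contra hxy
      refine h₁ ?_
      rw [← hax, mul_assoc a, vtx_mul_path_of_ne hq hxy, mul_zero, mul_zero]
    subst hxy
    rcases h₂ with h₂ | ⟨c, f, hc, rfl, h₂⟩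
    -- Below a line point `q q* = x`, so `l a q = z` gives `l a = q*`, whence `q l a = x` lies in
    -- `J`. The other case is excluded, as no cycle can be reached from `x`.
    · have h₃ : path F x.1 q * (l * a) = vtx F E x.1 := by
        rw [← hax, ← path_mul_adj_path x.2.1 hq, ← mul_assoc a, ← mul_assoc l, h₂,
          vtx_mul_adj_path hq]
      rintro _ ⟨b, rfl⟩
      change b * _ ∈ _
      rw [← h₃, ← mul_assoc, ← mul_assoc]
      exact J.2 _ _ haJ
    · exact absurd (GradedMonoid.isPeriodicElement_of_basedCycle x.2.1 hq 0) x.2.2⟩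

theorem mem_linePointIdeal {x : {x : E.Vertex // E.IsLinePoint x}} {a : E.LeavittPathAlgebra F} :
    a ∈ (linePointIdeal F x).1.1 ↔ a * vtx F E x.1 = a := by
  constructor
  · rintro ⟨b, rfl⟩
    change b * _ * _ = b * _
    rw [mul_assoc, vtx_mul_self]
  · exact fun h => ⟨a, h⟩

/-- Right multiplication by `g` passes the minimality of `I` on to the left multiples of `z`: each
nonzero one generates all the others. A bifurcation or a cycle below `z` produces a nonzero multiple
that does not. -/
theorem isLinePoint_of_mul_eq_vtx (I : MinimalLeftIdeal (E.LeavittPathAlgebra F)) {z : E.Vertex}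
    {a g : E.LeavittPathAlgebra F} (ha : a ∈ I.1.1) (h : a * g = vtx F E z) :
    E.IsLinePoint z := by
  have key : ∀ b c : E.LeavittPathAlgebra F, b * vtx F E z ≠ 0 →
      ∃ d, d * (b * vtx F E z) = c * vtx F E z := by
    intro b c hb
    have hba : b * a ≠ 0 := fun h0 => hb (by rw [← h, ← mul_assoc, h0, zero_mul])
    obtain ⟨d, hd⟩ := I.exists_mul_eq (I.1.2 b a ha) (I.1.2 c a ha) (exists_mul_ne_zero hba)
    refine ⟨d, ?_⟩
    rw [← h, ← mul_assoc b, ← mul_assoc c, ← mul_assoc d, hd]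
  have hz : E.NonBifurcating z := by
    intro p w hp e f he hf
    by_contra hef
    subst he
    have hpe : ∀ d : E.Edge, E.s d = E.s e →
        adj (path F z p) * (path F z p * edg F E d) = edg F E d := by
      intro d hd
      rw [← mul_assoc, adj_path_mul_path hp, ← hd, vtx_mul_edg]
    -- From `d e* p* = f* p*`, multiplication by `p f` on the right gives `0 = r(f)`.
    obtain ⟨d, hd⟩ := key (gho F E e * adj (path F z p)) (gho F E f * adj (path F z p)) <| by
      rw [mul_assoc, adj_path_mul_vtx hp]
      intro h0
      have h1 := congr_arg (· * (path F z p * edg F E e)) h0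
      simp only [zero_mul] at h1
      rw [mul_assoc, hpe e rfl, gho_mul_edg] at h1
      exact vtx_ne_zero _ h1
    rw [mul_assoc, mul_assoc, adj_path_mul_vtx hp] at hd
    have h1 := congr_arg (· * (path F z p * edg F E f)) hd
    simp only [mul_assoc] at h1
    rw [hpe f hf, gho_mul_edg_of_ne hef, gho_mul_edg, mul_zero] at h1
    exact vtx_ne_zero _ h1.symm
  refine ⟨hz, fun hper => ?_⟩
  obtain ⟨c, p, hc, hp⟩ := GradedMonoid.exists_basedCycle_of_isPeriodicElement hz hper
  have hev : ev F c.base c.edges (X - C 1) * (adj (path F z p) * path F z p) =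
      ev F c.base c.edges (X - C 1) := by
    rw [adj_path_mul_path hp, ← ev_one (F := F) c.base c.edges, ← ev_mul c.isPath, mul_one]
  -- From `d (c - 1) p* = p*`, multiplication by `p` would make `d` a left inverse of `c - 1`.
  obtain ⟨d, hd⟩ := key (ev F c.base c.edges (X - C 1) * adj (path F z p))
    (adj (path F z p)) <| by
      rw [mul_assoc, adj_path_mul_vtx hp]
      intro h0
      have h1 := congr_arg (· * path F z p) h0
      simp only [zero_mul, mul_assoc] at h1
      rw [hev] at h1
      exact ev_ne_zero hc (X_sub_C_ne_zero 1) h1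
  rw [mul_assoc, adj_path_mul_vtx hp] at hd
  have h1 := congr_arg (· * path F z p) hd
  simp only [mul_assoc] at h1
  rw [hev, adj_path_mul_path hp, ← ev_one (F := F) c.base c.edges] at h1
  exact mul_ev_ne hc one_ne_zero d (by rwa [mul_one])

/-- Every minimal left ideal is isomorphic to that of a line point. -/
theorem exists_linePointIdeal_equiv (I : MinimalLeftIdeal (E.LeavittPathAlgebra F)) :
    ∃ x, minimalLeftIdealSetoid _ I (linePointIdeal F x) := by
  obtain ⟨a, haI, ha⟩ := I.exists_ne_zero
  obtain ⟨l, y, z, q, hq, h₁, h₂⟩ := exists_mul_mul_path_ne_zero ha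
  have hlI := I.1.2 l a haI
  rw [← mul_assoc] at h₁
  simp only [← mul_assoc] at h₂
  rcases h₂ with h₂ | ⟨c, f, hc, rfl, h₂⟩
  · refine ⟨⟨z, isLinePoint_of_mul_eq_vtx I hlI h₂⟩,
      MinimalLeftIdeal.equiv_of_mul (fun _ => exists_mul_ne_zero) _ _ (path F y q) ?_
        ⟨_, hlI, h₁⟩⟩
    intro x _
    rw [mem_linePointIdeal, mul_assoc, path_mul_vtx hq]
  -- If the reduction ended in `f(c)`, then `(c - 1) l a` would generate `I`, and `f(c)` would be a
  -- left multiple of `(c - 1) f(c)`.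
  · exfalso
    have hf : f ≠ 0 := by
      rintro rfl
      exact h₁ (by rw [h₂, map_zero])
    have hmul : ev F c.base c.edges (X - C 1) * (l * a) * path F y q =
        ev F c.base c.edges ((X - C 1) * f) := by
      rw [mul_assoc, h₂, ev_mul c.isPath]
    have hne : ev F c.base c.edges (X - C 1) * (l * a) ≠ 0 := by
      intro h0
      rw [h0, zero_mul] at hmul
      exact ev_ne_zero hc (mul_ne_zero (X_sub_C_ne_zero 1) hf) hmul.symm
    obtain ⟨b, hb⟩ := I.exists_mul_eq (I.1.2 _ _ hlI) hlI (exists_mul_ne_zero hne)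
    refine mul_ev_ne hc hf b ?_
    rw [← hmul, ← h₂, ← mul_assoc, hb]

/-- Multiplying `b` by a suitable path from `v` gives a nonzero combination of paths from `u` with
the same end, so at least one such path exists. -/
theorem exists_isPath_of_vtx_mul {u v : E.Vertex} {b : E.LeavittPathAlgebra F} (hb : b ≠ 0)
    (hu : vtx F E u * b = b) (hv : b * vtx F E v = b) :
    ∃ w p q, E.IsPath u p w ∧ E.IsPath v q w := by
  obtain ⟨N, hN⟩ := exists_mul_path_mem_pathsTo b
  obtain ⟨y, q, z, hq, h, hn⟩ := exists_mul_path_notMem (K := ⊥) (a := b)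
    (by rwa [TwoSidedIdeal.mem_bot]) N
  rw [TwoSidedIdeal.mem_bot] at hn
  have hvy : v = y := by
    by_contra hvy
    exact hn (by rw [← hv, mul_assoc, vtx_mul_path_of_ne hq hvy, mul_zero])
  subst hvy
  obtain ⟨D, hD⟩ := exists_vtx_mul_mem_pathsBetween (hN v q z hq h)
  have hmem := hD D le_rfl u
  rw [← mul_assoc, hu] at hmem
  by_contra hno
  exact hn (eq_zero_of_mem_pathsBetween hmem fun p hp _ => absurd ⟨z, p, q, hp, hq⟩ hno)

/-- An isomorphism sends the vertex `x` to a nonzero element fixed by `x` on the left and by `y` on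
the right. Conversely, right multiplication by `p q*` is an isomorphism. -/
theorem linePointIdeal_equiv_iff {x y : {x : E.Vertex // E.IsLinePoint x}} :
    minimalLeftIdealSetoid _ (linePointIdeal F x) (linePointIdeal F y) ↔
      ∃ w p q, E.IsPath x.1 p w ∧ E.IsPath y.1 q w := by
  constructor
  · rintro ⟨f, hf⟩
    have hx : vtx F E x.1 ∈ (linePointIdeal F x).1.1 := mem_linePointIdeal.2 (vtx_mul_self _)
    have hne : (f ⟨_, hx⟩).1 ≠ 0 := by
      intro h0
      have h1 : f ⟨_, hx⟩ = 0 := Subtype.ext h0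
      rw [map_eq_zero_iff f f.injective] at h1
      exact vtx_ne_zero x.1 (congr_arg Subtype.val h1)
    refine exists_isPath_of_vtx_mul hne ?_ (mem_linePointIdeal.1 (f ⟨_, hx⟩).2)
    have h := congr_arg Subtype.val (hf (vtx F E x.1) ⟨_, hx⟩)
    simp only [vtx_mul_self] at h
    exact h.symm
  · rintro ⟨w, p, q, hp, hq⟩
    refine MinimalLeftIdeal.equiv_of_mul (fun _ => exists_mul_ne_zero) _ _
      (path F x.1 p * adj (path F y.1 q)) ?_
      ⟨vtx F E x.1, mem_linePointIdeal.2 (vtx_mul_self _), ?_⟩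
    · intro a _
      rw [mem_linePointIdeal, mul_assoc, mul_assoc, adj_path_mul_vtx hq]
    -- The factor `q p*` on the right undoes `p q*`, as `p p* = x` at a line point.
    · intro h0
      have h1 := congr_arg (· * (path F y.1 q * adj (path F x.1 p))) h0
      simp only [zero_mul, mul_assoc] at h1
      rw [← mul_assoc (adj (path F y.1 q)), adj_path_mul_path hq, vtx_mul_adj_path hp,
        path_mul_adj_path x.2.1 hp, vtx_mul_self] at h1
      exact vtx_ne_zero _ h1

variable (F E) in
/-- The isomorphism classes of minimal left ideals correspond to the orbits of the minimal elements
that are not periodic. -/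
theorem nonempty_minimalLeftIdealClasses_equiv :
    Nonempty (MinimalLeftIdealClasses (E.LeavittPathAlgebra F) ≃
      GradedMonoid.orbitsOf fun a : E.GradedMonoid => IsMinimalElement a ∧ ¬ IsPeriodicElement a) := by
  refine (exists_equiv_of_surjective
    (fun x : {x : E.Vertex // E.IsLinePoint x} =>
      (Quotient.mk _ (linePointIdeal F x) : MinimalLeftIdealClasses (E.LeavittPathAlgebra F)))
    (fun x => (⟨AddAction.orbit ℤ (GradedMonoid.of E x.1 0), GradedMonoid.of E x.1 0,
      ⟨GradedMonoid.isMinimalElement_of x.2.1 0, x.2.2⟩, rfl⟩ :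
      GradedMonoid.orbitsOf fun a : E.GradedMonoid =>
        IsMinimalElement a ∧ ¬ IsPeriodicElement a)) ?_ ?_ ?_).elim fun e _ => ⟨e⟩
  · rintro ⟨I⟩
    obtain ⟨x, hx⟩ := exists_linePointIdeal_equiv I
    exact ⟨x, Quotient.sound ((minimalLeftIdealSetoid _).symm hx)⟩
  · rintro ⟨_, a, ⟨hmin, hper⟩, rfl⟩
    obtain ⟨x, i, rfl, hx⟩ := GradedMonoid.exists_eq_of_of_isMinimalElement hmin
    refine ⟨⟨x, hx, fun h => hper ?_⟩, Subtype.ext (GradedMonoid.orbit_of x i).symm⟩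
    obtain ⟨c, p, -, hp⟩ := GradedMonoid.exists_basedCycle_of_isPeriodicElement hx h
    exact GradedMonoid.isPeriodicElement_of_basedCycle hx hp i
  · intro x y
    refine Iff.trans ?_ Subtype.ext_iff.symm
    refine Iff.trans ?_ (GradedMonoid.orbit_eq_iff x.2.1 y.2.1).symm
    exact Quotient.eq.trans linePointIdeal_equiv_iff

variable (F E) in
/-- The involution as an additive equivalence. -/
noncomputable def adjEquiv : E.LeavittPathAlgebra F ≃+ E.LeavittPathAlgebra F where
  toFun := adj
  invFun := adj
  left_inv := adj_adj
  right_inv := adj_adj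
  map_add' := adj_add

end MinimalLeft

/-! ### Transport of minimal one-sided ideals -/

section Congr

variable {E₁ : DirectedGraph.{u, v}} {E₂ : DirectedGraph.{u', v'}} [E₁.RowFinite] [E₂.RowFinite]

theorem nonempty_minimalLeftIdealClasses_congr (F : Type w) [Field F]
    {φ : E₁.GradedMonoid ≃+ E₂.GradedMonoid}
    (hφ : ∀ (n : ℤ) (a : E₁.GradedMonoid), φ (n +ᵥ a) = n +ᵥ φ a) :
    Nonempty (MinimalLeftIdealClasses (E₁.LeavittPathAlgebra F) ≃
      MinimalLeftIdealClasses (E₂.LeavittPathAlgebra F)) := by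
  obtain ⟨Φ₁⟩ := nonempty_minimalLeftIdealClasses_equiv F E₁
  obtain ⟨Φ₂⟩ := nonempty_minimalLeftIdealClasses_equiv F E₂
  obtain ⟨Ψ⟩ := GradedMonoid.nonempty_orbitsOf_equiv hφ
    (P₁ := fun a => IsMinimalElement a ∧ ¬ IsPeriodicElement a)
    (P₂ := fun a => IsMinimalElement a ∧ ¬ IsPeriodicElement a)
    fun a => and_congr GradedMonoid.isMinimalElement_map_iff
      (not_congr (GradedMonoid.isPeriodicElement_map_iff hφ))
  exact ⟨Φ₁.trans (Ψ.trans Φ₂.symm)⟩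

theorem nonempty_minimalRightIdealClasses_congr (F : Type w) [Field F]
    {φ : E₁.GradedMonoid ≃+ E₂.GradedMonoid}
    (hφ : ∀ (n : ℤ) (a : E₁.GradedMonoid), φ (n +ᵥ a) = n +ᵥ φ a) :
    Nonempty (MinimalRightIdealClasses (E₁.LeavittPathAlgebra F) ≃
      MinimalRightIdealClasses (E₂.LeavittPathAlgebra F)) := by
  obtain ⟨Φ⟩ := nonempty_minimalLeftIdealClasses_congr F hφ
  exact ⟨((minimalRightIdealClassesEquiv (adjEquiv F E₁) adj_mul adj_adj).trans Φ).trans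
    (minimalRightIdealClassesEquiv (adjEquiv F E₂) adj_mul adj_adj).symm⟩

end Congr

end LeavittPathAlgebra

end DirectedGraph

theorem theorem4p7 (F : Type w) [Field F]
    (E₁ : DirectedGraph.{u, v}) (E₂ : DirectedGraph.{u', v'}) [E₁.RowFinite] [E₂.RowFinite]
    (φ : E₁.GradedMonoid ≃+ E₂.GradedMonoid)
    (hφ : ∀ (n : ℤ) (a : E₁.GradedMonoid), φ (n +ᵥ a) = n +ᵥ φ a) :
    (E₁.ConditionL ↔ E₂.ConditionL) ∧
    (E₁.ConditionK ↔ E₂.ConditionK) ∧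
    Nonempty
      ({I : TwoSidedIdeal (E₁.LeavittPathAlgebra F) //
          DirectedGraph.LeavittPathAlgebra.IsGraded I} ≃o
        {I : TwoSidedIdeal (E₂.LeavittPathAlgebra F) //
          DirectedGraph.LeavittPathAlgebra.IsGraded I}) ∧
    Nonempty
      ({I : TwoSidedIdeal (E₁.LeavittPathAlgebra F) //
          ¬ DirectedGraph.LeavittPathAlgebra.IsGraded I} ≃
        {I : TwoSidedIdeal (E₂.LeavittPathAlgebra F) //
          ¬ DirectedGraph.LeavittPathAlgebra.IsGraded I}) ∧
    Nonempty
      (MinimalLeftIdealClasses (E₁.LeavittPathAlgebra F) ≃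
        MinimalLeftIdealClasses (E₂.LeavittPathAlgebra F)) ∧
    Nonempty
      (MinimalRightIdealClasses (E₁.LeavittPathAlgebra F) ≃
        MinimalRightIdealClasses (E₂.LeavittPathAlgebra F)) ∧
    (∃ Φ : E₁.exitlessCycles ≃ E₁.minimalPeriodicOrbits, ∀ c : E₁.exitlessCycles,
      (∀ e ∈ c.1, (Φ c).1 = AddAction.orbit ℤ (DirectedGraph.GradedMonoid.of E₁ (E₁.s e) 0)) ∧
      (Φ c).1.encard = c.1.length) ∧
    (∃ Φ : E₂.exitlessCycles ≃ E₂.minimalPeriodicOrbits, ∀ c : E₂.exitlessCycles,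
      (∀ e ∈ c.1, (Φ c).1 = AddAction.orbit ℤ (DirectedGraph.GradedMonoid.of E₂ (E₂.s e) 0)) ∧
      (Φ c).1.encard = c.1.length) :=
  ⟨DirectedGraph.GradedMonoid.conditionL_congr hφ, DirectedGraph.GradedMonoid.conditionK_congr hφ,
    DirectedGraph.LeavittPathAlgebra.nonempty_gradedIdeal_orderIso F hφ,
    DirectedGraph.LeavittPathAlgebra.nonempty_nonGradedIdeal_equiv F hφ,
    DirectedGraph.LeavittPathAlgebra.nonempty_minimalLeftIdealClasses_congr F hφ,
    DirectedGraph.LeavittPathAlgebra.nonempty_minimalRightIdealClasses_congr F hφ,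
    DirectedGraph.GradedMonoid.exists_exitlessCycles_equiv E₁,
    DirectedGraph.GradedMonoid.exists_exitlessCycles_equiv E₂⟩
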